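/- Let $n\ge 4$ and $0\le s\le n$, let $(M,g)$ be a smooth pseudo-Riemannian manifold of dimension $n$ and signature $(s,n-s)$, and let $\eta=\mathrm{diag}(1,\dots,1,-1,\dots,-1)$ ($s$ times $1$, $n-s$ times $-1$). Let $O(M,g)$ be the principal $O(s,n-s)$-bundle of frames $(e_1,\dots,e_n)$ of the tangent spaces of $M$ with $g(e_i,e_j)=\eta_{ij}$, with projection $\pi$ onto $M$, and let $\theta=(\theta^k)$ be its solder form: for $v\in T_rO(M,g)$, $\theta^k(v)$ is the $k$-th component of $\pi_*v$ in the frame $r$. Let $\omega=(\omega^i_j)$ be a smooth connection $1$-form on $O(M,g)$ (with values in the Lie algebra of $O(s,n-s)$, i.e. a metric connection), with torsion $\Theta^i=d\theta^i+\omega^i_j\wedge\theta^j$. Repeated indices are summed, $\omega^{ij}=\omega^i_k\eta^{kj}$ with $(\eta^{ij})=\eta^{-1}$, and for $q\le n$ $$\theta^*_{i_1\dots i_q}=\frac1{(n-q)!}\,\varepsilon_{i_1\dots i_n}\,\theta^{i_{q+1}}\wedge\dots\wedge\theta^{i_n},$$ where $\varepsilon$ is totally antisymmetric with $\varepsilon_{1\dots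 n}=1$. Define on $O(M,g)$, for $i=1,\dots,n$, the $(n-1)$-forms $$\tau_i=-\tfrac12\left(\omega^j_i\wedge\omega^{k\ell}\wedge\theta^*_{jk\ell}+\omega^j_\ell\wedge\omega^{\ell k}\wedge\theta^*_{ijk}\right)$$ and the $(n-2)$-forms $$\sigma_i=-\tfrac12\,\omega^{jk}\wedge\theta^*_{ijk}.$$ Then the following conditions are equivalent: (a) $d\tau_i=0$ for all $i$; (b) $\tau_i=d\sigma_i$ for all $i$; (c) $\omega$ is the Levi-Civita connection of $g$ (i.e. $\Theta=0$), and $g$ satisfies the vacuum Einstein equations $R_{\mu\nu}-\frac12 R\,g_{\mu\nu}=0$. -/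

import Mathlib

open scoped Manifold ContDiff

noncomputable section
namespace DiffGeom

open Set

/-! ### Submanifolds given by slice charts; regular level sets -/
section Submanifold

variable {EN HN N E V : Type*} [NormedAddCommGroup EN] [NormedSpace ℝ EN]
  [TopologicalSpace HN] (I : ModelWithCorners ℝ EN HN) [TopologicalSpace N] [ChartedSpace HN N]
  (E V) [NormedAddCommGroup E] [NormedSpace ℝ E] [NormedAddCommGroup V] [NormedSpace ℝ V]

/-- A slice chart of the manifold `N` at `p` adapted to the subset `S`: a diffeomorphism from an open
neighbourhood of `p` onto an open subset of `E × V` which maps `S` to the slice `E × {0}`. -/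
structure SliceChart (S : Set N) (p : N) where
  toOPH : OpenPartialHomeomorph N (E × V)
  mem_source : p ∈ toOPH.source
  contMDiffOn : ContMDiffOn I 𝓘(ℝ, E × V) ∞ toOPH toOPH.source
  contMDiffOn_symm : ContMDiffOn 𝓘(ℝ, E × V) I ∞ toOPH.symm toOPH.target
  mem_iff : ∀ q ∈ toOPH.source, q ∈ S ↔ (toOPH q).2 = 0

variable {I E V}

/-- The chart of `S`, with values in `E`, obtained by restricting a slice chart to `S`. -/
def SliceChart.chart {S : Set N} {p : S} (c : SliceChart I E V S p) :
    OpenPartialHomeomorph S E where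
  toFun q := (c.toOPH q).1
  invFun v := by
    classical
    exact if h : (v, (0 : V)) ∈ c.toOPH.target then
      ⟨c.toOPH.symm (v, 0), (c.mem_iff _ (c.toOPH.map_target h)).2
        (by rw [c.toOPH.right_inv h])⟩ else p
  source := {q | (q : N) ∈ c.toOPH.source}
  target := {v | (v, (0 : V)) ∈ c.toOPH.target}
  map_source' := by
    intro q hq
    have h2 := (c.mem_iff _ hq).1 q.2
    have h := c.toOPH.map_source hq
    rw [← Prod.mk.eta (p := c.toOPH q), h2] at h
    exact h
  map_target' := by
    intro v hv
    have hv' : (v, (0 : V)) ∈ c.toOPH.target := hv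
    simp only [dif_pos hv', mem_ofPred_eq]
    exact c.toOPH.map_target hv'
  left_inv' := by
    intro q hq
    have h2 := (c.mem_iff _ hq).1 q.2
    have h := c.toOPH.map_source hq
    have he : c.toOPH q = ((c.toOPH q).1, (0 : V)) := by rw [← h2]
    have h' : ((c.toOPH q).1, (0 : V)) ∈ c.toOPH.target := he ▸ h
    apply Subtype.ext
    simp only [dif_pos h']
    rw [← he, c.toOPH.left_inv hq]
  right_inv' := by
    intro v hv
    have hv' : (v, (0 : V)) ∈ c.toOPH.target := hv
    simp only [dif_pos hv']
    rw [c.toOPH.right_inv hv']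
  open_source := c.toOPH.open_source.preimage continuous_subtype_val
  open_target := c.toOPH.open_target.preimage (by fun_prop)
  continuousOn_toFun := by
    have h := c.toOPH.continuousOn.comp (s := {q : S | (q : N) ∈ c.toOPH.source})
      continuous_subtype_val.continuousOn (fun q hq => hq)
    exact continuous_fst.comp_continuousOn h
  continuousOn_invFun := by
    rw [Topology.IsInducing.subtypeVal.continuousOn_iff]
    have h := c.toOPH.continuousOn_symm.comp (s := {v : E | (v, (0 : V)) ∈ c.toOPH.target})
      (f := fun v => (v, (0 : V))) (by fun_prop) (fun q hq => hq)
    refine h.congr ?_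
    intro v hv
    have hv' : (v, (0 : V)) ∈ c.toOPH.target := hv
    simp only [Function.comp, dif_pos hv']

/-- The structure of embedded submanifold on a subset which admits a slice chart at each of its
points. -/
abbrev sliceChartedSpace {S : Set N} (c : ∀ p : S, SliceChart I E V S p) : ChartedSpace E S where
  atlas := range fun p => (c p).chart
  chartAt p := (c p).chart
  mem_chart_source p := (c p).mem_source
  chart_mem_atlas p := mem_range_self p

theorem sliceChartedSpace_isManifold {S : Set N} (c : ∀ p : S, SliceChart I E V S p) :
    letI := sliceChartedSpace c
    IsManifold 𝓘(ℝ, E) ∞ S := by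
  let _ := sliceChartedSpace c
  apply isManifold_of_contDiffOn
  rintro e e' ⟨p, rfl⟩ ⟨p', rfl⟩
  have h1 : ContMDiffOn 𝓘(ℝ, E) 𝓘(ℝ, E × V) ∞ (fun v : E => (v, (0 : V))) univ :=
    ContDiff.contMDiff (by fun_prop) |>.contMDiffOn
  have h2 := ((c p').contMDiffOn.comp' ((c p).contMDiffOn_symm.comp' h1))
  have h3 : ContMDiffOn 𝓘(ℝ, E × V) 𝓘(ℝ, E) ∞ (Prod.fst : E × V → E) univ :=
    ContDiff.contMDiff (by fun_prop) |>.contMDiffOn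
  have h4 := (h3.comp' h2).contDiffOn
  refine (h4.mono ?_).congr ?_
  · rintro v ⟨⟨hv, hv2⟩, -⟩
    have hv' : (v, (0 : V)) ∈ (c p).toOPH.target := hv
    refine ⟨⟨⟨mem_univ _, hv'⟩, ?_⟩, mem_univ _⟩
    simpa [SliceChart.chart, hv'] using hv2
  · rintro v ⟨⟨hv, hv2⟩, -⟩
    have hv' : (v, (0 : V)) ∈ (c p).toOPH.target := hv
    simp [SliceChart.chart, hv']

/-- A level set of a smooth map has slice charts at its regular points. -/
theorem nonempty_sliceChart [FiniteDimensional ℝ EN] [FiniteDimensional ℝ E] [FiniteDimensional ℝ V]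
    [I.Boundaryless] [IsManifold I ∞ N] (F : N → V) (hF : ContMDiff I 𝓘(ℝ, V) ∞ F)
    (hd : Module.finrank ℝ E + Module.finrank ℝ V = Module.finrank ℝ EN) (p : N)
    (hp : Function.Surjective (mfderiv I 𝓘(ℝ, V) F p)) :
    Nonempty (SliceChart I E V {q | F q = 0} p) := by
  let c : OpenPartialHomeomorph N EN :=
    (chartAt HN p).trans I.toHomeomorph.toOpenPartialHomeomorph
  have hc : ContMDiffOn I 𝓘(ℝ, EN) ∞ c c.source := by
    have := contMDiffOn_extChartAt (I := I) (n := ∞) (x := p)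
    have hs : c.source = (chartAt HN p).source := by simp [c]
    rw [hs]
    exact this
  have hcs : ContMDiffOn 𝓘(ℝ, EN) I ∞ c.symm c.target := by
    have := contMDiffOn_extChartAt_symm (I := I) (n := ∞) p
    refine (this.mono ?_)
    intro z hz
    rw [extChartAt_target, I.range_eq_univ]
    exact ⟨hz.2, mem_univ _⟩
  have hpc : p ∈ c.source := by simp [c]
  let f : EN → V := F ∘ c.symm
  have hf : ContDiffOn ℝ ∞ f c.target := (hF.comp_contMDiffOn hcs).contDiffOn
  have hz : c p ∈ c.target := c.map_source hpc
  have hfz : ContDiffAt ℝ ∞ f (c p) := hf.contDiffAt (c.open_target.mem_nhds hz)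
  have hstr : HasStrictFDerivAt f (fderiv ℝ f (c p)) (c p) :=
    hfz.hasStrictFDerivAt (by simp)
  have hsurj : Function.Surjective (fderiv ℝ f (c p)) := by
    have hm : mfderiv I 𝓘(ℝ, V) F p = fderiv ℝ f (c p) := by
      have h0 := (hF.mdifferentiable (by simp) p).mfderiv
      rw [I.range_eq_univ, fderivWithin_univ] at h0
      exact h0
    rw [← hm]; exact hp
  set f' := fderiv ℝ f (c p) with hf'
  have hker : Module.finrank ℝ f'.ker = Module.finrank ℝ E := by
    have h1 := LinearMap.finrank_range_add_finrank_ker (f' : EN →ₗ[ℝ] V)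
    rw [LinearMap.range_eq_top.2 hsurj, finrank_top] at h1
    have : Module.finrank ℝ f'.ker = Module.finrank ℝ (LinearMap.ker (f' : EN →ₗ[ℝ] V)) := rfl
    omega
  let κ : f'.ker ≃L[ℝ] E := ContinuousLinearEquiv.ofFinrankEq hker
  obtain ⟨P, hP⟩ := Submodule.ClosedComplemented.of_finiteDimensional f'.ker
  let G : EN → E × V := fun z => (κ (P z), f z)
  let G' : EN →L[ℝ] E × V := ((κ : f'.ker →L[ℝ] E).comp P).prod f'
  have hinj : Function.Injective G' := by
    rw [injective_iff_map_eq_zero]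
    intro z hz
    have h1 : κ (P z) = 0 := congrArg Prod.fst hz
    have h2 : f' z = 0 := congrArg Prod.snd hz
    have h3 := hP ⟨z, h2⟩
    have h4 : P z = 0 := by simpa using h1
    rw [h4] at h3
    exact (congrArg Subtype.val h3).symm
  have hbij : Module.finrank ℝ EN = Module.finrank ℝ (E × V) := by
    rw [Module.finrank_prod, hd]
  let G'e : EN ≃L[ℝ] E × V :=
    (LinearEquiv.ofInjectiveOfFinrankEq (G' : EN →ₗ[ℝ] E × V) hinj hbij).toContinuousLinearEquiv
  have hG'e : (G'e : EN →L[ℝ] E × V) = G' := by ext z <;> rfl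
  have hGs : ContDiffOn ℝ ∞ G c.target :=
    ((κ.contDiff.comp P.contDiff).contDiffOn).prodMk hf
  have hGz : HasStrictFDerivAt G (G'e : EN →L[ℝ] E × V) (c p) := by
    rw [hG'e]
    exact (((κ : f'.ker →L[ℝ] E).comp P).hasStrictFDerivAt).prodMk hstr
  let h := hGz.toOpenPartialHomeomorph G
  let W : Set EN := c.target ∩ {z | fderiv ℝ G z ∈ range ((↑) : (EN ≃L[ℝ] E × V) → _)}
  have hW : IsOpen W := by
    refine ContinuousOn.isOpen_inter_preimage ?_ c.open_target
      (ContinuousLinearEquiv.isOpen)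
    exact hGs.continuousOn_fderiv_of_isOpen c.open_target (by simp)
  have hzW : c p ∈ W := ⟨hz, G'e, hGz.hasFDerivAt.fderiv.symm⟩
  let k : OpenPartialHomeomorph EN (E × V) := h.restrOpen W hW
  have hk : (k : EN → E × V) = G := rfl
  have hks : k.source ⊆ W := inter_subset_right
  have hk1 : ContDiffOn ℝ ∞ k k.source := hGs.mono (hks.trans inter_subset_left)
  have hk2 : ContDiffOn ℝ ∞ k.symm k.target := by
    intro w hw
    have hm := hks (k.map_target hw)
    obtain ⟨e, he⟩ := hm.2
    have hat : ContDiffAt ℝ ∞ k (k.symm w) := hGs.contDiffAt (c.open_target.mem_nhds hm.1)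
    refine (k.contDiffAt_symm (f₀' := e) hw ?_ hat).contDiffWithinAt
    rw [he]
    exact (hat.differentiableAt (by simp)).hasFDerivAt
  refine ⟨⟨c.trans k, ?_, ?_, ?_, ?_⟩⟩
  · refine ⟨hpc, ?_⟩
    exact ⟨hGz.mem_toOpenPartialHomeomorph_source, hzW⟩
  · exact hk1.contMDiffOn.comp (hc.mono inter_subset_left) (fun q hq => hq.2)
  · refine hcs.comp (hk2.contMDiffOn.mono ?_) ?_
    · intro w hw; exact hw.1
    · intro w hw; exact hw.2
  · intro q hq
    have : ((c.trans k) q).2 = F q := by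
      change f (c q) = F q
      simp only [f, Function.comp, c.left_inv hq.1]
    rw [this]; rfl

end Submanifold

section FrameBundle

open Bundle

variable {n : ℕ}

/-- The model space `ℝⁿ`. -/
abbrev Model (n : ℕ) : Type := EuclideanSpace ℝ (Fin n)

variable {M : Type*} [TopologicalSpace M] [ChartedSpace (Model n) M] [IsManifold (𝓡 n) ∞ M]

/-- `η_ii`: equal to `1` for the first `s` indices and to `-1` for the other ones. -/
def eta (n s : ℕ) (i : Fin n) : ℝ := if (i : ℕ) < s then 1 else -1

/-- The matrix `η = diag(1, …, 1, -1, …, -1)`; note that `η⁻¹ = η`. -/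
def etaMatrix (n s : ℕ) : Matrix (Fin n) (Fin n) ℝ := Matrix.diagonal (eta n s)

/-- A smooth pseudo-Riemannian metric of signature `(s, n - s)` on the `n`-manifold `M`: a smooth
field of symmetric bilinear forms which have the matrix `η` in some frame at each point. -/
structure PseudoRiemannianMetric (n s : ℕ) (M : Type*) [TopologicalSpace M]
    [ChartedSpace (Model n) M] [IsManifold (𝓡 n) ∞ M] where
  val (x : M) : TangentSpace (𝓡 n) x →L[ℝ] TangentSpace (𝓡 n) x →L[ℝ] ℝ
  symm (x : M) (v w : TangentSpace (𝓡 n) x) : val x v w = val x w v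
  exists_orthonormal (x : M) : ∃ e : Fin n → TangentSpace (𝓡 n) x,
    ∀ i j, val x (e i) (e j) = etaMatrix n s i j
  contMDiff : ContMDiff (𝓡 n) ((𝓡 n).prod 𝓘(ℝ, Model n →L[ℝ] Model n →L[ℝ] ℝ)) ∞
    (fun x => TotalSpace.mk' (Model n →L[ℝ] Model n →L[ℝ] ℝ)
      (E := fun x => TangentSpace (𝓡 n) x →L[ℝ] TangentSpace (𝓡 n) x →L[ℝ] ℝ) x (val x))

variable (n M) in
/-- The total space of the vector bundle `Hom(ℝⁿ, TM)` over `M`. A frame `(e₁, …, e_n)` of `T_x M` is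
identified with the linear isomorphism `ℝⁿ → T_x M` which maps the standard basis to it, so that
the bundle of frames `GL(M)` is the open subset of the isomorphisms. -/
abbrev FrameHom : Type _ := TotalSpace (Model n →L[ℝ] Model n)
  (fun x : M => Trivial M (Model n) x →L[ℝ] TangentSpace (𝓡 n) x)

/-- The standard basis of `ℝⁿ`. -/
abbrev stdVec (n : ℕ) (i : Fin n) : Model n := EuclideanSpace.single i 1

variable {s : ℕ} (g : PseudoRiemannianMetric n s M)

/-- The scalar products `g(e_i, e_j)` of the vectors `e_i = r(stdVec i)`. -/
def gram (r : FrameHom n M) (i j : Fin n) : ℝ := g.val r.proj (r.2 (stdVec n i)) (r.2 (stdVec n j))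

def gramDefect (r : FrameHom n M) (p : {p : Fin n × Fin n // p.1 ≤ p.2}) : ℝ :=
  gram g r p.1.1 p.1.2 - etaMatrix n s p.1.1 p.1.2

theorem contMDiff_gram (i j : Fin n) :
    ContMDiff ((𝓡 n).prod 𝓘(ℝ, Model n →L[ℝ] Model n)) 𝓘(ℝ) ∞ fun r : FrameHom n M => gram g r i j := by
  have hπ : ContMDiff ((𝓡 n).prod 𝓘(ℝ, Model n →L[ℝ] Model n)) (𝓡 n) ∞
      (fun r : FrameHom n M => r.proj) := contMDiff_proj _
  have hv (i : Fin n) : ContMDiff ((𝓡 n).prod 𝓘(ℝ, Model n →L[ℝ] Model n))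
      ((𝓡 n).prod 𝓘(ℝ, Model n)) ∞
      (fun r : FrameHom n M => TotalSpace.mk' (Model n) (E := fun x : M => TangentSpace (𝓡 n) x) r.proj (r.2 (stdVec n i))) := by
    refine ContMDiff.clm_bundle_apply (F₁ := Model n) (E₁ := Trivial M (Model n))
      (b := fun r : FrameHom n M => r.proj) (ϕ := fun r => r.2)
      (v := fun r => (stdVec n i : Trivial M (Model n) r.proj)) ?_ ?_
    · exact contMDiff_id
    · intro r
      rw [contMDiffAt_totalSpace]
      exact ⟨hπ r, contMDiffAt_const⟩
  have := ContMDiff.clm_bundle_apply₂ (F₁ := Model n) (F₂ := Model n) (F₃ := ℝ)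
    (E₁ := fun x : M => TangentSpace (𝓡 n) x) (E₂ := fun x : M => TangentSpace (𝓡 n) x)
    (E₃ := Trivial M ℝ) (b := fun r : FrameHom n M => r.proj) (ψ := fun r => g.val r.proj)
    (g.contMDiff.comp hπ) (hv i) (hv j)
  intro r
  exact (contMDiffAt_totalSpace.1 (this r)).2

theorem contMDiff_gramDefect :
    ContMDiff ((𝓡 n).prod 𝓘(ℝ, Model n →L[ℝ] Model n))
      𝓘(ℝ, {p : Fin n × Fin n // p.1 ≤ p.2} → ℝ) ∞ (gramDefect (M := M) g) := by
  rw [contMDiff_pi_space]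
  intro p
  exact (contMDiff_gram g p.1.1 p.1.2).sub contMDiff_const

theorem gramDefect_eq_zero_iff (r : FrameHom n M) :
    gramDefect g r = 0 ↔ ∀ i j, gram g r i j = etaMatrix n s i j := by
  constructor
  · intro h i j
    rcases le_total i j with hij | hij
    · exact sub_eq_zero.1 (congrFun h ⟨(i, j), hij⟩)
    · have h1 := sub_eq_zero.1 (congrFun h ⟨(j, i), hij⟩)
      have h2 : gram g r i j = gram g r j i := g.symm _ _ _
      have h3 : etaMatrix n s i j = etaMatrix n s j i := by
        have : (etaMatrix n s).transpose = etaMatrix n s := Matrix.diagonal_transpose _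
        exact congrFun (congrFun this j) i
      rw [h2, h3]; exact h1
  · intro h
    funext p
    exact sub_eq_zero.2 (h _ _)

theorem eta_mul_self (i : Fin n) : eta n s i * eta n s i = 1 := by
  unfold eta; split_ifs <;> norm_num

theorem surjective_mfderiv_gramDefect (r : FrameHom n M) (hr : gramDefect g r = 0) :
    Function.Surjective (mfderiv ((𝓡 n).prod 𝓘(ℝ, Model n →L[ℝ] Model n))
      𝓘(ℝ, {p : Fin n × Fin n // p.1 ≤ p.2} → ℝ) (gramDefect g) r) := by
  intro (Y : {p : Fin n × Fin n // p.1 ≤ p.2} → ℝ)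
  let S (i j : Fin n) : ℝ := Y ⟨(min i j, max i j), min_le_max⟩
  have hS (i j : Fin n) : S i j = S j i := by simp only [S, min_comm, max_comm]
  let Z : Model n →L[ℝ] Model n := LinearMap.toContinuousLinearMap
    ((EuclideanSpace.basisFun (Fin n) ℝ).toBasis.constr ℝ
      fun j => ∑ i, ((1 / 2) * eta n s i * S i j) • stdVec n i)
  have hZ (j : Fin n) : Z (stdVec n j) = ∑ i, ((1 / 2) * eta n s i * S i j) • stdVec n i := by
    have := (EuclideanSpace.basisFun (Fin n) ℝ).toBasis.constr_basis ℝ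
      (fun j => ∑ i, ((1 / 2) * eta n s i * S i j) • stdVec n i) j
    rwa [OrthonormalBasis.coe_toBasis, EuclideanSpace.basisFun_apply] at this
  let A : Model n →L[ℝ] TangentSpace (𝓡 n) r.proj := r.2
  have hA (i j : Fin n) : g.val r.proj (A (stdVec n i)) (A (stdVec n j)) = etaMatrix n s i j :=
    (gramDefect_eq_zero_iff g r).1 hr i j
  have hAZ (i j : Fin n) :
      g.val r.proj (A (Z (stdVec n i))) (A (stdVec n j)) = (1 / 2) * S i j := by
    rw [hZ]
    simp only [map_sum, map_smul, sum_apply, smul_apply, hA,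
      etaMatrix, Matrix.diagonal_apply, smul_eq_mul, mul_ite, mul_zero]
    simp only [Finset.sum_ite_eq', Finset.mem_univ, if_true]
    have h := eta_mul_self (s := s) j
    rw [hS j i]
    linear_combination (1 / 2 * S i j) * h
  let γ : ℝ → FrameHom n M := fun t => ⟨r.proj, A + t • A.comp Z⟩
  have hγ0 : γ 0 = r := by
    simp [γ, A]
  have hγ : MDifferentiableAt 𝓘(ℝ, ℝ) ((𝓡 n).prod 𝓘(ℝ, Model n →L[ℝ] Model n)) γ 0 := by
    rw [mdifferentiableAt_hom_bundle]
    refine ⟨mdifferentiableAt_const, ?_⟩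
    apply DifferentiableAt.mdifferentiableAt
    unfold ContinuousLinearMap.inCoordinates
    have h (P Q : Model n →L[ℝ] Model n) (B : Model n →L[ℝ] Model n) :
        DifferentiableAt ℝ (fun t : ℝ => P.comp ((B + t • B.comp Z).comp Q)) 0 := by
      simp only [ContinuousLinearMap.add_comp, ContinuousLinearMap.comp_add,
        ContinuousLinearMap.smul_comp, ContinuousLinearMap.comp_smul]
      fun_prop
    exact h ((trivializationAt (Model n) (TangentSpace (𝓡 n)) r.proj).continuousLinearMapAt ℝ r.proj)
      ((trivializationAt (Model n) (Trivial M (Model n)) r.proj).symmL ℝ r.proj) A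
  have hF : HasDerivAt (fun t => gramDefect g (γ t)) Y 0 := by
    rw [hasDerivAt_pi]
    rintro ⟨⟨i, j⟩, hij⟩
    have hij' : i ≤ j := hij
    have h1 : (fun t => gramDefect g (γ t) ⟨(i, j), hij⟩) = fun t : ℝ =>
        t * S i j + t ^ 2 * g.val r.proj (A (Z (stdVec n i))) (A (Z (stdVec n j))) := by
      funext t
      have h2 : g.val r.proj (A (stdVec n i)) (A (Z (stdVec n j))) = (1 / 2) * S j i := by
        rw [g.symm, hAZ]
      have h3 : gramDefect g (γ t) ⟨(i, j), hij⟩ = g.val r.proj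
          (A (stdVec n i) + t • A (Z (stdVec n i))) (A (stdVec n j) + t • A (Z (stdVec n j))) -
          etaMatrix n s i j := rfl
      rw [h3]
      simp only [map_add, map_smul, add_apply, smul_apply,
        hA, hAZ, h2, hS j i, smul_eq_mul]
      ring
    rw [h1]
    have h4 := ((hasDerivAt_id (0 : ℝ)).mul_const (S i j)).add
      ((hasDerivAt_pow 2 (0 : ℝ)).mul_const
        (g.val r.proj (A (Z (stdVec n i))) (A (Z (stdVec n j)))))
    have h5 : Y ⟨(i, j), hij⟩ = S i j := by
      simp only [S, min_eq_left hij', max_eq_right hij']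
    rw [h5]
    exact h4.congr_deriv (by simp)
  have hd : HasMFDerivAt ((𝓡 n).prod 𝓘(ℝ, Model n →L[ℝ] Model n))
      𝓘(ℝ, {p : Fin n × Fin n // p.1 ≤ p.2} → ℝ) (gramDefect g) (γ 0)
      (mfderiv ((𝓡 n).prod 𝓘(ℝ, Model n →L[ℝ] Model n))
      𝓘(ℝ, {p : Fin n × Fin n // p.1 ≤ p.2} → ℝ) (gramDefect g) (γ 0)) :=
    ((contMDiff_gramDefect g).mdifferentiable (by simp) (γ 0)).hasMFDerivAt
  have hcomp := hd.comp 0 hγ.hasMFDerivAt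
  have huniq := hasMFDerivAt_unique hcomp hF.hasFDerivAt.hasMFDerivAt
  rw [← hγ0]
  refine ⟨mfderiv 𝓘(ℝ, ℝ) ((𝓡 n).prod 𝓘(ℝ, Model n →L[ℝ] Model n)) γ 0 (1 : ℝ), ?_⟩
  have := congrArg (fun L => L (1 : ℝ)) huniq
  refine this.trans ?_
  change (1 : ℝ) • Y = Y
  exact one_smul _ _

theorem finrank_count (n : ℕ) : Module.finrank ℝ
      (Model n × ({p : Fin n × Fin n // p.2 < p.1} → ℝ)) +
      Module.finrank ℝ ({p : Fin n × Fin n // p.1 ≤ p.2} → ℝ) =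
    Module.finrank ℝ (Model n × (Model n →L[ℝ] Model n)) := by
  have h1 : Module.finrank ℝ (Model n →L[ℝ] Model n) = n * n := by
    rw [← (LinearMap.toContinuousLinearMap (𝕜 := ℝ) (E := Model n) (F' := Model n)).finrank_eq,
      Module.finrank_linearMap]
    simp
  have h2 : Fintype.card {p : Fin n × Fin n // p.1 ≤ p.2} +
      Fintype.card {p : Fin n × Fin n // p.2 < p.1} = n * n := by
    have h3 := Fintype.card_subtype_compl (fun p : Fin n × Fin n => p.1 ≤ p.2)
    have h4 := Fintype.card_subtype_le (fun p : Fin n × Fin n => p.1 ≤ p.2)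
    simp only [not_le, Fintype.card_prod, Fintype.card_fin] at h3 h4
    omega
  rw [Module.finrank_prod, Module.finrank_prod, h1, Module.finrank_fintype_fun_eq_card,
    Module.finrank_fintype_fun_eq_card]
  omega


/-- The set `O(M,g)` of orthonormal frames: `g(e_i, e_j) = η_ij`. -/
def orthonormalFrames : Set (FrameHom n M) := {r | ∀ i j, gram g r i j = etaMatrix n s i j}

/-- The bundle of orthonormal frames `O(M,g)`, as a topological subspace of `FrameHom n M`. -/
abbrev OFrame : Type _ := orthonormalFrames g

/-- The model space of `O(M,g)`, of dimension `n + n(n-1)/2`. -/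
abbrev OModel (n : ℕ) : Type := Model n × ({p : Fin n × Fin n // p.2 < p.1} → ℝ)

theorem nonempty_sliceChart_orthonormalFrames (r : OFrame g) :
    Nonempty (SliceChart ((𝓡 n).prod 𝓘(ℝ, Model n →L[ℝ] Model n)) (OModel n)
      ({p : Fin n × Fin n // p.1 ≤ p.2} → ℝ) (orthonormalFrames g) (r : FrameHom n M)) := by
  have h : orthonormalFrames g = {r | gramDefect g r = 0} := by
    ext r; exact (gramDefect_eq_zero_iff g r).symm
  have hr : gramDefect g r.1 = 0 := (gramDefect_eq_zero_iff g _).2 r.2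
  obtain ⟨r, hr'⟩ := r
  change Nonempty (SliceChart _ _ _ _ r)
  rw [h]
  exact nonempty_sliceChart (gramDefect g) (contMDiff_gramDefect g) (finrank_count n) r
    (surjective_mfderiv_gramDefect g r hr)

/-- `O(M,g)` is an embedded submanifold of `FrameHom n M` (a regular level set). -/
instance : ChartedSpace (OModel n) (OFrame g) :=
  sliceChartedSpace fun r => (nonempty_sliceChart_orthonormalFrames g r).some

instance : IsManifold 𝓘(ℝ, OModel n) ∞ (OFrame g) :=
  sliceChartedSpace_isManifold fun r => (nonempty_sliceChart_orthonormalFrames g r).some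

variable {g}

/-- The projection `π : O(M,g) → M`. -/
def OFrame.base (r : OFrame g) : M := r.1.proj

/-- The frame `r`, as a linear isomorphism `ℝⁿ → T_{π(r)} M`. -/
def OFrame.frame (r : OFrame g) : Model n →L[ℝ] TangentSpace (𝓡 n) r.base := r.1.2

theorem OFrame.frame_isInvertible (r : OFrame g) : r.frame.IsInvertible := by
  let A : Model n →ₗ[ℝ] Model n := r.frame.toLinearMap
  have hinj : Function.Injective A := by
    rw [injective_iff_map_eq_zero]
    intro v hv
    have hv' : r.frame v = 0 := hv
    have hsum : v = ∑ i, v i • stdVec n i := by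
      have := ((EuclideanSpace.basisFun (Fin n) ℝ).sum_repr v).symm
      simpa using this
    ext j
    have h1 : g.val r.base (r.frame v) (r.frame (stdVec n j)) = v j * eta n s j := by
      have h2 (i : Fin n) : g.val r.base (r.frame (stdVec n i)) (r.frame (stdVec n j)) =
        etaMatrix n s i j := r.2 i j
      conv_lhs => rw [hsum]
      simp only [map_sum, map_smul, sum_apply, smul_apply, h2,
        etaMatrix, Matrix.diagonal_apply, smul_eq_mul, mul_ite, mul_zero]
      simp
    rw [hv', map_zero] at h1
    have h3 := eta_mul_self (s := s) j
    have h4 : v j * (eta n s j * eta n s j) = 0 := by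
      rw [← mul_assoc, ← h1]; simp
    rw [h3, mul_one] at h4
    simpa using h4
  let e : Model n ≃L[ℝ] Model n :=
    (LinearEquiv.ofInjectiveEndo A hinj).toContinuousLinearEquiv
  exact ⟨e, by ext v; rfl⟩

/-- The group `O(s, n - s)` of matrices `a` with `aᵀ η a = η`. -/
def PseudoOrthogonal (n s : ℕ) : Type :=
  {a : Matrix (Fin n) (Fin n) ℝ // a.transpose * etaMatrix n s * a = etaMatrix n s}

/-- The right action `(r, a) ↦ r a` of `O(s, n - s)` on `O(M,g)`, `(r a)_j = ∑ i, a^i_j r_i`. -/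
def OFrame.act (r : OFrame g) (a : PseudoOrthogonal n s) : OFrame g :=
  ⟨⟨r.1.proj, r.frame.comp (Matrix.toEuclideanCLM (𝕜 := ℝ) a.1)⟩, by
    intro i j
    have ha (j : Fin n) : Matrix.toEuclideanCLM (𝕜 := ℝ) a.1 (stdVec n j) =
        ∑ k, a.1 k j • stdVec n k := by
      ext k
      simp [Matrix.mulVec, Matrix.ofLp_toEuclideanCLM, Pi.single_apply]
    have h2 (i j : Fin n) : g.val r.base (r.frame (stdVec n i)) (r.frame (stdVec n j)) =
        etaMatrix n s i j := r.2 i j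
    change g.val r.base (r.frame (Matrix.toEuclideanCLM (𝕜 := ℝ) a.1 (stdVec n i)))
      (r.frame (Matrix.toEuclideanCLM (𝕜 := ℝ) a.1 (stdVec n j))) = _
    rw [ha, ha]
    simp only [map_sum, map_smul, sum_apply, smul_apply, h2, smul_eq_mul]
    have h3 := congrFun (congrFun a.2 i) j
    rw [← h3, Matrix.mul_assoc]
    simp only [Matrix.mul_apply, Matrix.transpose_apply, Finset.mul_sum]
    rw [Finset.sum_comm]
    exact Finset.sum_congr rfl fun _ _ => Finset.sum_congr rfl fun _ _ => by ring⟩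

theorem exp_mem_pseudoOrthogonal {X : Matrix (Fin n) (Fin n) ℝ}
    (hX : X.transpose * etaMatrix n s + etaMatrix n s * X = 0) (t : ℝ) :
    (NormedSpace.exp (t • X)).transpose * etaMatrix n s * NormedSpace.exp (t • X) =
      etaMatrix n s := by
  have hη : etaMatrix n s * etaMatrix n s = 1 := by
    unfold etaMatrix
    rw [Matrix.diagonal_mul_diagonal, ← Matrix.diagonal_one]
    congr 1
    funext i
    exact eta_mul_self i
  have hu : IsUnit (etaMatrix n s) := ⟨⟨_, _, hη, hη⟩, rfl⟩
  have hinv : (etaMatrix n s)⁻¹ = etaMatrix n s := Matrix.inv_eq_right_inv hη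
  have hXt : (t • X).transpose = etaMatrix n s * (-(t • X)) * (etaMatrix n s)⁻¹ := by
    rw [hinv]
    have h1 : X.transpose * etaMatrix n s = -(etaMatrix n s * X) := eq_neg_of_add_eq_zero_left hX
    calc (t • X).transpose = t • (X.transpose * (etaMatrix n s * etaMatrix n s)) := by
          rw [hη, Matrix.mul_one, Matrix.transpose_smul]
      _ = _ := by
          rw [← Matrix.mul_assoc, h1]
          simp
  have hE : (NormedSpace.exp (t • X)).transpose =
      etaMatrix n s * (NormedSpace.exp (t • X))⁻¹ * etaMatrix n s := by
    rw [← Matrix.exp_transpose, hXt, Matrix.exp_conj _ _ hu, hinv, Matrix.exp_neg]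
  have hdet : IsUnit (NormedSpace.exp (t • X)).det :=
    (Matrix.isUnit_iff_isUnit_det _).1 (Matrix.isUnit_exp _)
  rw [hE]
  generalize NormedSpace.exp (t • X) = B at hdet ⊢
  calc etaMatrix n s * B⁻¹ * etaMatrix n s * etaMatrix n s * B
      = etaMatrix n s * (B⁻¹ * ((etaMatrix n s * etaMatrix n s) * B)) := by
        simp only [Matrix.mul_assoc]
    _ = etaMatrix n s := by
        rw [hη, Matrix.one_mul, Matrix.nonsing_inv_mul _ hdet, Matrix.mul_one]

/-- `t ↦ exp(t X)`, for `X` in the Lie algebra `so(s, n - s)`. -/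
def expPseudoOrthogonal {X : Matrix (Fin n) (Fin n) ℝ}
    (hX : X.transpose * etaMatrix n s + etaMatrix n s * X = 0) (t : ℝ) : PseudoOrthogonal n s :=
  ⟨NormedSpace.exp (t • X), exp_mem_pseudoOrthogonal hX t⟩

end FrameBundle

section Forms

/-- The exterior product `α ∧ β` of a `1`-form and a `k`-form on a vector space, with the
normalization `(α ∧ β)(v₀, …, v_k) = ∑ i, (-1)^i α(v_i) β(v₀, …, v̂_i, …, v_k)`
(the one for which `d(α ∧ β) = dα ∧ β - α ∧ dβ` holds for `extDeriv`). -/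
def wedge {T : Type*} [AddCommGroup T] [Module ℝ T] [TopologicalSpace T] {k : ℕ}
    (α : T →L[ℝ] ℝ) (β : T [⋀^Fin k]→L[ℝ] ℝ) : T [⋀^Fin (k + 1)]→L[ℝ] ℝ where
  toMultilinearMap := (AlternatingMap.alternatizeUncurryFin
    (LinearMap.smulRight α.toLinearMap β.toAlternatingMap)).toMultilinearMap
  map_eq_zero_of_eq' := (AlternatingMap.alternatizeUncurryFin
    (LinearMap.smulRight α.toLinearMap β.toAlternatingMap)).map_eq_zero_of_eq'
  cont := by
    have h : (fun v : Fin (k + 1) → T => AlternatingMap.alternatizeUncurryFin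
        (LinearMap.smulRight α.toLinearMap β.toAlternatingMap) v) =
        fun v => ∑ i : Fin (k + 1), (-1 : ℤ) ^ (i : ℕ) • (α (v i) * β (i.removeNth v)) := by
      funext v
      rw [AlternatingMap.alternatizeUncurryFin_apply]
      rfl
    change Continuous (fun v : Fin (k + 1) → T => AlternatingMap.alternatizeUncurryFin
        (LinearMap.smulRight α.toLinearMap β.toAlternatingMap) v)
    rw [h]
    refine continuous_finsetSum _ fun i _ => Continuous.zsmul ?_ _
    refine (α.continuous.comp (continuous_apply i)).mul (β.coe_continuous.comp ?_)
    exact continuous_pi fun j => continuous_apply _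

theorem wedge_apply {T : Type*} [AddCommGroup T] [Module ℝ T] [TopologicalSpace T] {k : ℕ}
    (α : T →L[ℝ] ℝ) (β : T [⋀^Fin k]→L[ℝ] ℝ) (v : Fin (k + 1) → T) :
    wedge α β v = ∑ i : Fin (k + 1), (-1 : ℝ) ^ (i : ℕ) * (α (v i) * β (i.removeNth v)) := by
  have h : wedge α β v = AlternatingMap.alternatizeUncurryFin
        (LinearMap.smulRight α.toLinearMap β.toAlternatingMap) v := rfl
  rw [h, AlternatingMap.alternatizeUncurryFin_apply]
  refine Finset.sum_congr rfl fun i _ => ?_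
  rw [zsmul_eq_mul]
  push_cast
  rfl

/-- The exterior product `α₀ ∧ … ∧ α_{k-1}` of `1`-forms. -/
def wedgeProd {T : Type*} [AddCommGroup T] [Module ℝ T] [TopologicalSpace T] :
    (k : ℕ) → (Fin k → T →L[ℝ] ℝ) → T [⋀^Fin k]→L[ℝ] ℝ
  | 0, _ => ContinuousAlternatingMap.constOfIsEmpty ℝ T (Fin 0) 1
  | k + 1, α => wedge (α 0) (wedgeProd k fun a => α a.succ)

/-- A linear form, as an alternating form of degree `1`. -/
def oneForm {T : Type*} [AddCommGroup T] [Module ℝ T] [TopologicalSpace T]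
    (α : T →L[ℝ] ℝ) : T [⋀^Fin 1]→L[ℝ] ℝ :=
  ContinuousAlternatingMap.ofSubsingleton ℝ T ℝ (0 : Fin 1) α

/-- The exterior derivative of a differential `k`-form `α` on a manifold modelled on the vector space
`E`: at `x`, transport `α` to `E` by the chart at `x`, differentiate there, and pull back. -/
def manifoldExtDeriv {E X : Type*} [NormedAddCommGroup E] [NormedSpace ℝ E] [TopologicalSpace X]
    [ChartedSpace E X] {k : ℕ} (α : ∀ x : X, TangentSpace 𝓘(ℝ, E) x [⋀^Fin k]→L[ℝ] ℝ) (x : X) :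
    TangentSpace 𝓘(ℝ, E) x [⋀^Fin (k + 1)]→L[ℝ] ℝ :=
  (extDeriv (fun y : E => (α ((chartAt E x).symm y)).compContinuousLinearMap
      ((mfderiv 𝓘(ℝ, E) 𝓘(ℝ, E) (chartAt E x).symm y).comp
        (NormedSpace.fromTangentSpace (𝕜 := ℝ) y).symm.toContinuousLinearMap))
    (chartAt E x x)).compContinuousLinearMap
      ((NormedSpace.fromTangentSpace (𝕜 := ℝ) (chartAt E x x)).toContinuousLinearMap.comp
        (mfderiv 𝓘(ℝ, E) 𝓘(ℝ, E) (chartAt E x) x))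

end Forms

section Einstein

open Bundle

variable {n s : ℕ} {M : Type*} [TopologicalSpace M] [ChartedSpace (Model n) M]
  [IsManifold (𝓡 n) ∞ M]

/-- (Not necessarily smooth) differential `k`-forms on `O(M,g)`. -/
abbrev OForm (g : PseudoRiemannianMetric n s M) (k : ℕ) : Type _ :=
  ∀ r : OFrame g, TangentSpace 𝓘(ℝ, OModel n) r [⋀^Fin k]→L[ℝ] ℝ

/-- A connection `1`-form on the principal bundle `O(M,g)`: a smooth `1`-form `(ω^i_j)` with values in
the Lie algebra of `O(s, n - s)`, equal to `X` on the fundamental vector field of `X`, and such that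
`R_a^* ω = a⁻¹ ω a`. Here `form r i j` is `ω^i_j` at `r`. -/
structure MetricConnection (g : PseudoRiemannianMetric n s M) where
  form (r : OFrame g) (i j : Fin n) : TangentSpace 𝓘(ℝ, OModel n) r →L[ℝ] ℝ
  contMDiff (i j : Fin n) : ContMDiff 𝓘(ℝ, OModel n)
    (𝓘(ℝ, OModel n).prod 𝓘(ℝ, OModel n →L[ℝ] ℝ)) ∞
    (fun r => TotalSpace.mk' (OModel n →L[ℝ] ℝ)
      (E := fun r : OFrame g => TangentSpace 𝓘(ℝ, OModel n) r →L[ℝ] Trivial (OFrame g) ℝ r)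
      r (form r i j))
  skew (r : OFrame g) (i j : Fin n) : eta n s i • form r i j + eta n s j • form r j i = 0
  vertical (r : OFrame g) (X : Matrix (Fin n) (Fin n) ℝ)
    (hX : X.transpose * etaMatrix n s + etaMatrix n s * X = 0) (i j : Fin n) :
    form (r.act (expPseudoOrthogonal hX 0)) i j
      (mfderiv 𝓘(ℝ, ℝ) 𝓘(ℝ, OModel n) (fun t : ℝ => r.act (expPseudoOrthogonal hX t)) 0 (1 : ℝ)) =
        X i j
  equivariant (a : PseudoOrthogonal n s) (r : OFrame g) (v : TangentSpace 𝓘(ℝ, OModel n) r)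
    (i j : Fin n) :
    form (r.act a) i j
      (mfderiv 𝓘(ℝ, OModel n) 𝓘(ℝ, OModel n) (fun r : OFrame g => r.act a) r v) =
        (a.1⁻¹ * (Matrix.of fun k l => form r k l v) * a.1) i j

/-- The solder form: `θ^k(v)` is the `k`-th component of `π_* v` in the frame `r`. -/
def solder {g : PseudoRiemannianMetric n s M} (r : OFrame g) (k : Fin n) :
    TangentSpace 𝓘(ℝ, OModel n) r →L[ℝ] ℝ :=
  (EuclideanSpace.proj k).comp
    (r.frame.inverse.comp (mfderiv 𝓘(ℝ, OModel n) (𝓡 n) OFrame.base r))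

/-- The totally antisymmetric symbol `ε_{p(1) … p(n)}`, with `ε_{1 … n} = 1`. -/
def leviCivitaSymbol {n : ℕ} (p : Fin n → Fin n) : ℝ := by
  classical
  exact if h : Function.Bijective p then ((Equiv.Perm.sign (Equiv.ofBijective p h) : ℤ) : ℝ) else 0

/-- The `(n-q)`-form
`θ*_{i₁ … i_q} = 1/(n-q)! ∑ ε_{i₁ … i_q i_{q+1} … i_n} θ^{i_{q+1}} ∧ … ∧ θ^{i_n}`. -/
def dualForm (g : PseudoRiemannianMetric n s M) {q : ℕ} (hq : q ≤ n) (I : Fin q → Fin n) :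
    OForm g (n - q) := fun r =>
  ((Nat.factorial (n - q) : ℝ)⁻¹) • ∑ f : Fin (n - q) → Fin n,
    leviCivitaSymbol (fun a : Fin n =>
      Fin.append I f (Fin.cast (Nat.add_sub_cancel' hq).symm a)) •
      wedgeProd (n - q) fun a => solder r (f a)

namespace MetricConnection

variable {g : PseudoRiemannianMetric n s M} (A : MetricConnection g)

/-- `ω^{ij} = ω^i_k η^{kj}`. -/
def upper (r : OFrame g) (i j : Fin n) : TangentSpace 𝓘(ℝ, OModel n) r →L[ℝ] ℝ :=
  eta n s j • A.form r i j

/-- The `(n-1)`-form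
`τ_i = -1/2 (ω^j_i ∧ ω^{kl} ∧ θ*_{jkl} + ω^j_l ∧ ω^{lk} ∧ θ*_{ijk})`. -/
def tau (hn : 3 ≤ n) (i : Fin n) : OForm g (n - 3 + 1 + 1) := fun r =>
  -(1 / 2 : ℝ) •
    (∑ j, ∑ k, ∑ l, wedge (A.form r j i) (wedge (A.upper r k l) (dualForm g hn ![j, k, l] r)) +
      ∑ j, ∑ k, ∑ l, wedge (A.form r j l) (wedge (A.upper r l k) (dualForm g hn ![i, j, k] r)))

/-- The `(n-2)`-form `σ_i = -1/2 ω^{jk} ∧ θ*_{ijk}`. -/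
def sigma (hn : 3 ≤ n) (i : Fin n) : OForm g (n - 3 + 1) := fun r =>
  -(1 / 2 : ℝ) • ∑ j, ∑ k, wedge (A.upper r j k) (dualForm g hn ![i, j, k] r)

/-- The torsion `2`-form `Θ^i = dθ^i + ω^i_j ∧ θ^j`. -/
def torsion (i : Fin n) : OForm g 2 := fun r =>
  manifoldExtDeriv (fun r : OFrame g => oneForm (solder r i)) r +
    ∑ j, wedge (A.form r i j) (oneForm (solder r j))

/-- The connection is the Levi-Civita connection of `g`: it (preserves `g` and) has no torsion. -/
def IsLeviCivita : Prop := ∀ i r, A.torsion i r = 0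

end MetricConnection

namespace PseudoRiemannianMetric

variable (g : PseudoRiemannianMetric n s M) (c : OpenPartialHomeomorph M (Model n))

/-- The components `g_{μν}` of the metric in the chart `c`, as functions on `ℝⁿ`. -/
def coord (y : Model n) : Matrix (Fin n) (Fin n) ℝ := Matrix.of fun μ ν =>
  g.val (c.symm y)
    (mfderiv (𝓡 n) (𝓡 n) c.symm y ((NormedSpace.fromTangentSpace (𝕜 := ℝ) y).symm (stdVec n μ)))
    (mfderiv (𝓡 n) (𝓡 n) c.symm y ((NormedSpace.fromTangentSpace (𝕜 := ℝ) y).symm (stdVec n ν)))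

/-- `Γ^l_{μν} = 1/2 g^{lρ} (∂_μ g_{νρ} + ∂_ν g_{μρ} - ∂_ρ g_{μν})`. -/
def christoffel (y : Model n) (l μ ν : Fin n) : ℝ :=
  (1 / 2) * ∑ ρ, (g.coord c y)⁻¹ l ρ *
    (fderiv ℝ (fun z => g.coord c z ν ρ) y (stdVec n μ) +
      fderiv ℝ (fun z => g.coord c z μ ρ) y (stdVec n ν) -
      fderiv ℝ (fun z => g.coord c z μ ν) y (stdVec n ρ))

/-- `R^l_{ρμν} = ∂_μ Γ^l_{ρν} - ∂_ν Γ^l_{ρμ} + Γ^l_{σμ} Γ^σ_{ρν} - Γ^l_{σν} Γ^σ_{ρμ}`. -/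
def riemann (y : Model n) (l ρ μ ν : Fin n) : ℝ :=
  fderiv ℝ (fun z => g.christoffel c z l ρ ν) y (stdVec n μ) -
    fderiv ℝ (fun z => g.christoffel c z l ρ μ) y (stdVec n ν) +
    ∑ σ, (g.christoffel c y l σ μ * g.christoffel c y σ ρ ν -
      g.christoffel c y l σ ν * g.christoffel c y σ ρ μ)

/-- `R_{μν} = R^l_{μlν}`. -/
def ricci (y : Model n) (μ ν : Fin n) : ℝ := ∑ l, g.riemann c y l μ l ν

/-- `R = g^{μν} R_{μν}`. -/
def scalarCurvature (y : Model n) : ℝ := ∑ μ, ∑ ν, (g.coord c y)⁻¹ μ ν * g.ricci c y μ ν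

/-- `G_{μν} = R_{μν} - 1/2 R g_{μν}`. -/
def einsteinTensor (y : Model n) (μ ν : Fin n) : ℝ :=
  g.ricci c y μ ν - (1 / 2) * g.scalarCurvature c y * g.coord c y μ ν

/-- The Einstein equations without source, `G_{μν} = 0`, at every point and in every chart. -/
def IsVacuumEinstein : Prop :=
  ∀ c ∈ IsManifold.maximalAtlas (𝓡 n) ∞ M, ∀ x ∈ c.source, ∀ μ ν, g.einsteinTensor c (c x) μ ν = 0

end PseudoRiemannianMetric

end Einstein

end DiffGeom

end

/-! Write Ω for the curvature. By Cartan's structure equations dθ^i = Θ^i − ω^i_j ∧ θ^j and dω^i_j =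
Ω^i_j − ω^i_k ∧ ω^k_j, where Θ and Ω are quadratic in θ. Hence dτ_i is a sum of terms ω ∧ Ω ∧ θ*, ω
∧ ω ∧ Θ^l ∧ θ*_{abcl} and ω ∧ ω ∧ ω ∧ θ*, which contain one, two and three connection forms
(`StructureEquations.extDeriv_wedge_wedge_starForm`). Evaluated on two vertical vectors and
otherwise horizontal ones, dτ_i sees only the torsion; evaluated on a single vertical vector, only
the curvature.

(a) ⇒ (c). On vertical vectors ω takes any prescribed value in the Lie algebra. Elementary rotations
with disjoint index pairs (a, i) and (b, c), where i is a fourth index available because n ≥ 4,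
isolate Θ^l ∧ θ*_{abcl}. Its vanishing is a linear system for the torsion components that has only
the zero solution, the trace part carrying a factor n − 3 (`StructureEquations.torsion_eq_zero`). A
single rotation (a, i) isolates Ω^{lm} ∧ θ*_{alm}, which equals −2 G^p_a θ*_p with G the Einstein
tensor (`StructureEquations.einstein_eq_zero`).

(c) ⇒ (b). Without torsion, dσ_i = −1/2 Ω^{jk} ∧ θ*_{ijk} + τ_i, and the curvature term is again the
Einstein tensor (`StructureEquations.extDeriv_sigmaForm_eq`). (b) ⇒ (a) is d² = 0.

The rest links this algebra to the bundle. In a chart, O(M,g) is described by the base point Y, the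
frame matrix B and the connection form ϖ (`IsAdaptedAt`). Coefficients Γ are defined so that dB = B
ϖ − Γ(dY) B; equivariance makes Γ constant along the fibres. Differentiating this identity and B θ =
dY gives the structure equations (`IsAdaptedAt.structureEquations`). Since ω is metric, Γ is
compatible with g, so without torsion it consists of the Christoffel symbols, and the frame
equations become those of the coordinate Einstein tensor (`IsAdaptedAt.einsteinTensor_eq_zero_iff`).
-/

noncomputable section
namespace DiffGeom
open Set
-- Exterior products with 1-forms and 2-forms, and their exterior derivative.
section ExteriorAlgebra
set_option maxSynthPendingDepth 3

variable {E : Type*} [NormedAddCommGroup E] [NormedSpace ℝ E] {k : ℕ}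

theorem wedge_eq_alternatizeUncurryFin (α : E →L[ℝ] ℝ) (β : E [⋀^Fin k]→L[ℝ] ℝ) :
    wedge α β = ContinuousAlternatingMap.alternatizeUncurryFin (α.smulRight β) := by
  ext v
  rw [wedge_apply, ContinuousAlternatingMap.alternatizeUncurryFin_apply]
  refine Finset.sum_congr rfl fun i _ => ?_
  rw [zsmul_eq_mul]
  push_cast
  rfl

/-- The exterior product by `1`-forms, as a continuous bilinear map. -/
def wedgeCLM (E : Type*) [NormedAddCommGroup E] [NormedSpace ℝ E] (k : ℕ) :
    (E →L[ℝ] ℝ) →L[ℝ] (E [⋀^Fin k]→L[ℝ] ℝ) →L[ℝ] (E [⋀^Fin (k + 1)]→L[ℝ] ℝ) :=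
  (ContinuousLinearMap.compL ℝ (E [⋀^Fin k]→L[ℝ] ℝ) (E →L[ℝ] E [⋀^Fin k]→L[ℝ] ℝ)
    (E [⋀^Fin (k + 1)]→L[ℝ] ℝ) (ContinuousAlternatingMap.alternatizeUncurryFinCLM ℝ E ℝ)).comp
    (ContinuousLinearMap.smulRightL ℝ E (E [⋀^Fin k]→L[ℝ] ℝ))

theorem wedgeCLM_apply (α : E →L[ℝ] ℝ) (β : E [⋀^Fin k]→L[ℝ] ℝ) :
    wedgeCLM E k α β = wedge α β := by
  rw [wedge_eq_alternatizeUncurryFin]; rfl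

theorem wedge_smul_left (c : ℝ) (α : E →L[ℝ] ℝ) (β : E [⋀^Fin k]→L[ℝ] ℝ) :
    wedge (c • α) β = c • wedge α β := by
  simp only [← wedgeCLM_apply, map_smul, smul_apply]

theorem wedge_zero_left (β : E [⋀^Fin k]→L[ℝ] ℝ) : wedge (0 : E →L[ℝ] ℝ) β = 0 := by
  simp only [← wedgeCLM_apply, map_zero, zero_apply]

theorem wedge_add_right (α : E →L[ℝ] ℝ) (β β' : E [⋀^Fin k]→L[ℝ] ℝ) :
    wedge α (β + β') = wedge α β + wedge α β' := by
  simp only [← wedgeCLM_apply, map_add]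

theorem wedge_sub_right (α : E →L[ℝ] ℝ) (β β' : E [⋀^Fin k]→L[ℝ] ℝ) :
    wedge α (β - β') = wedge α β - wedge α β' := by
  simp only [← wedgeCLM_apply, map_sub]

theorem wedge_neg_right (α : E →L[ℝ] ℝ) (β : E [⋀^Fin k]→L[ℝ] ℝ) :
    wedge α (-β) = -wedge α β := by
  simp only [← wedgeCLM_apply, map_neg]

theorem wedge_zero_right (α : E →L[ℝ] ℝ) : wedge α (0 : E [⋀^Fin k]→L[ℝ] ℝ) = 0 := by
  simp only [← wedgeCLM_apply, map_zero]

theorem wedge_smul_right (c : ℝ) (α : E →L[ℝ] ℝ) (β : E [⋀^Fin k]→L[ℝ] ℝ) :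
    wedge α (c • β) = c • wedge α β := by
  simp only [← wedgeCLM_apply, map_smul]

theorem wedge_sum_right {ι : Type*} (s : Finset ι) (α : E →L[ℝ] ℝ)
    (β : ι → E [⋀^Fin k]→L[ℝ] ℝ) : wedge α (∑ a ∈ s, β a) = ∑ a ∈ s, wedge α (β a) := by
  simp only [← wedgeCLM_apply, map_sum]

/-- The exterior product of the `2`-form obtained by alternating the bilinear form `B` and of the
`k`-form `β`. -/
def wedge2 (B : E →L[ℝ] E →L[ℝ] ℝ) (β : E [⋀^Fin k]→L[ℝ] ℝ) : E [⋀^Fin (k + 1 + 1)]→L[ℝ] ℝ :=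
  ContinuousAlternatingMap.alternatizeUncurryFin (((wedgeCLM E k).flip β).comp B)

theorem wedge2_add_left (B B' : E →L[ℝ] E →L[ℝ] ℝ) (β : E [⋀^Fin k]→L[ℝ] ℝ) :
    wedge2 (B + B') β = wedge2 B β + wedge2 B' β := by
  simp only [wedge2, ContinuousLinearMap.comp_add, ContinuousAlternatingMap.alternatizeUncurryFin_add]

theorem wedge2_smul_left (c : ℝ) (B : E →L[ℝ] E →L[ℝ] ℝ) (β : E [⋀^Fin k]→L[ℝ] ℝ) :
    wedge2 (c • B) β = c • wedge2 B β := by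
  simp only [wedge2, ContinuousLinearMap.comp_smul,
    ContinuousAlternatingMap.alternatizeUncurryFin_smul]

theorem wedge2_sub_left (B B' : E →L[ℝ] E →L[ℝ] ℝ) (β : E [⋀^Fin k]→L[ℝ] ℝ) :
    wedge2 (B - B') β = wedge2 B β - wedge2 B' β := by
  rw [eq_sub_iff_add_eq, ← wedge2_add_left, sub_add_cancel]

theorem wedge2_zero_left (β : E [⋀^Fin k]→L[ℝ] ℝ) :
    wedge2 (0 : E →L[ℝ] E →L[ℝ] ℝ) β = 0 := by
  have := wedge2_sub_left (0 : E →L[ℝ] E →L[ℝ] ℝ) 0 β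
  rwa [sub_self, sub_self] at this

theorem wedge2_sum_left {ι : Type*} (s : Finset ι) (B : ι → E →L[ℝ] E →L[ℝ] ℝ)
    (β : E [⋀^Fin k]→L[ℝ] ℝ) : wedge2 (∑ a ∈ s, B a) β = ∑ a ∈ s, wedge2 (B a) β := by
  classical
  induction s using Finset.induction_on with
  | empty => simp [wedge2_zero_left]
  | insert a s ha ih => rw [Finset.sum_insert ha, Finset.sum_insert ha, wedge2_add_left, ih]

theorem wedge2_smulRight (μ ν : E →L[ℝ] ℝ) (β : E [⋀^Fin k]→L[ℝ] ℝ) :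
    wedge2 (μ.smulRight ν) β = wedge μ (wedge ν β) := by
  rw [wedge2, wedge_eq_alternatizeUncurryFin μ]
  congr 1
  ext1 u
  change wedgeCLM E k (μ u • ν) β = μ u • wedge ν β
  rw [wedgeCLM_apply, wedge_smul_left]

/-- Double alternation kills symmetric bilinear maps, the same fact as in d² = 0. Consequently
`wedge2 B β` depends only on the antisymmetric part of `B`, and sign rules for products of 1-forms
reduce to symmetry checks on bilinear forms. -/
theorem wedge2_eq_zero_of_symm {B : E →L[ℝ] E →L[ℝ] ℝ} (hB : ∀ u v, B u v = B v u)
    (β : E [⋀^Fin k]→L[ℝ] ℝ) : wedge2 B β = 0 := by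
  let f : E →L[ℝ] E →L[ℝ] E [⋀^Fin k]→L[ℝ] ℝ :=
    ((ContinuousLinearMap.smulRightL ℝ E (E [⋀^Fin k]→L[ℝ] ℝ)).flip β).comp B
  have h := ContinuousAlternatingMap.alternatizeUncurryFin_alternatizeUncurryFinCLM_comp_of_symmetric
    (f := f) (fun u v => by change B u v • β = B v u • β; rw [hB])
  exact h

theorem wedge2_congr {B B' : E →L[ℝ] E →L[ℝ] ℝ} (h : ∀ u v, B u v - B v u = B' u v - B' v u)
    (β : E [⋀^Fin k]→L[ℝ] ℝ) : wedge2 B β = wedge2 B' β := by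
  rw [← sub_eq_zero, ← wedge2_sub_left]
  refine wedge2_eq_zero_of_symm (fun u v => ?_) β
  simp only [sub_apply]
  linarith [h u v]

theorem wedge_wedge_comm (α β : E →L[ℝ] ℝ) (γ : E [⋀^Fin k]→L[ℝ] ℝ) :
    wedge α (wedge β γ) = -wedge β (wedge α γ) := by
  rw [eq_neg_iff_add_eq_zero, ← wedge2_smulRight, ← wedge2_smulRight, ← wedge2_add_left]
  refine wedge2_eq_zero_of_symm (fun u v => ?_) γ
  simp only [add_apply, ContinuousLinearMap.smulRight_apply, smul_apply, smul_eq_mul]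
  ring

theorem wedge_wedge_self (α : E →L[ℝ] ℝ) (γ : E [⋀^Fin k]→L[ℝ] ℝ) :
    wedge α (wedge α γ) = 0 := by
  rw [← wedge2_smulRight]
  refine wedge2_eq_zero_of_symm (fun u v => ?_) γ
  simp only [ContinuousLinearMap.smulRight_apply, smul_apply, smul_eq_mul]
  ring

theorem wedge_compContinuousLinearMap {E' : Type*} [NormedAddCommGroup E'] [NormedSpace ℝ E']
    (L : E' →L[ℝ] E) (α : E →L[ℝ] ℝ) (β : E [⋀^Fin k]→L[ℝ] ℝ) :
    (wedge α β).compContinuousLinearMap L =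
      wedge (α.comp L) (β.compContinuousLinearMap L) := by
  ext v
  simp only [ContinuousAlternatingMap.compContinuousLinearMap_apply, wedge_apply]
  rfl

theorem wedge_apply_cons_eq_of_forall (α : E →L[ℝ] ℝ) (β : E [⋀^Fin k]→L[ℝ] ℝ) (x : E)
    (v : Fin k → E) (h : ∀ a, α (v a) = 0) :
    wedge α β (Matrix.vecCons x v) = α x * β v := by
  rw [wedge_apply, Fin.sum_univ_succ]
  rw [Finset.sum_eq_zero fun i _ => ?_]
  · simp
  · simp [h]

theorem wedge_apply_eq_zero_of_forall (α : E →L[ℝ] ℝ) (β : E [⋀^Fin k]→L[ℝ] ℝ)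
    (v : Fin (k + 1) → E) (h : ∀ a, α (v a) = 0) : wedge α β v = 0 := by
  rw [wedge_apply]
  exact Finset.sum_eq_zero fun i _ => by rw [h]; ring

/-- Interior multiplication is an antiderivation: the term `i = 0` of the defining sum feeds `x` to
`α`, all the others feed it to `β`. -/
theorem curryLeft_wedge (α : E →L[ℝ] ℝ) (β : E [⋀^Fin (k + 1)]→L[ℝ] ℝ) (x : E) :
    (wedge α β).curryLeft x = α x • β - wedge α (β.curryLeft x) := by
  ext v
  rw [ContinuousAlternatingMap.curryLeft_apply_apply, wedge_apply, Fin.sum_univ_succ]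
  simp only [ContinuousAlternatingMap.sub_apply, ContinuousAlternatingMap.smul_apply, wedge_apply,
    ContinuousAlternatingMap.curryLeft_apply_apply]
  have h0 : Fin.removeNth (0 : Fin (k + 2)) (Matrix.vecCons x v) = v := by
    funext a; simp [Fin.removeNth]
  have h1 (i : Fin (k + 1)) : Fin.removeNth i.succ (Matrix.vecCons x v) =
      Matrix.vecCons x (i.removeNth v) := by
    funext a
    refine Fin.cases ?_ (fun a => ?_) a
    · simp [Fin.removeNth]
    · simp [Fin.removeNth]
  rw [h0, sub_eq_add_neg, ← Finset.sum_neg_distrib]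
  congr 1
  · simp
  · refine Finset.sum_congr rfl fun i _ => ?_
    rw [h1]
    simp [pow_succ]

theorem hasFDerivAt_wedge {F : Type*} [NormedAddCommGroup F] [NormedSpace ℝ F]
    {α : F → E →L[ℝ] ℝ} {β : F → E [⋀^Fin k]→L[ℝ] ℝ} {x : F}
    {α' : F →L[ℝ] E →L[ℝ] ℝ} {β' : F →L[ℝ] E [⋀^Fin k]→L[ℝ] ℝ}
    (hα : HasFDerivAt α α' x) (hβ : HasFDerivAt β β' x) :
    HasFDerivAt (fun u => wedge (α u) (β u))
      ((wedgeCLM E k (α x)).comp β' + ((wedgeCLM E k).flip (β x)).comp α') x := by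
  simp only [← wedgeCLM_apply]
  exact (wedgeCLM E k).hasFDerivAt_of_bilinear hα hβ

theorem ContDiffAt.wedge {F : Type*} [NormedAddCommGroup F] [NormedSpace ℝ F] {N : WithTop ℕ∞}
    {α : F → E →L[ℝ] ℝ} {β : F → E [⋀^Fin k]→L[ℝ] ℝ} {x : F}
    (hα : ContDiffAt ℝ N α x) (hβ : ContDiffAt ℝ N β x) :
    ContDiffAt ℝ N (fun u => wedge (α u) (β u)) x := by
  simp only [← wedgeCLM_apply]
  exact ((wedgeCLM E k).contDiff.contDiffAt.comp x hα).clm_apply hβ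

theorem extDeriv_wedge {α : E → E →L[ℝ] ℝ} {β : E → E [⋀^Fin k]→L[ℝ] ℝ} {x : E}
    (hα : DifferentiableAt ℝ α x) (hβ : DifferentiableAt ℝ β x) :
    extDeriv (fun u => wedge (α u) (β u)) x =
      wedge2 (fderiv ℝ α x) (β x) - wedge (α x) (extDeriv β x) := by
  have h := (hasFDerivAt_wedge hα.hasFDerivAt hβ.hasFDerivAt).fderiv
  rw [extDeriv, h, ContinuousAlternatingMap.alternatizeUncurryFin_add, sub_eq_add_neg]
  refine (add_comm _ _).trans (congrArg (wedge2 (fderiv ℝ α x) (β x) + ·) ?_)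
  rw [eq_neg_iff_add_eq_zero, extDeriv, wedge_eq_alternatizeUncurryFin]
  -- The symmetrization of α ⊗ Dβ. Its double alternation vanishes, and it is also the sum of α ∧ dβ
  -- and of the alternation of u ↦ α ∧ D_uβ; this produces the minus sign of the Leibniz rule.
  let f : E →L[ℝ] E →L[ℝ] E [⋀^Fin k]→L[ℝ] ℝ :=
    (α x).smulRight (fderiv ℝ β x) +
      (ContinuousLinearMap.smulRightL ℝ E (E [⋀^Fin k]→L[ℝ] ℝ) (α x)).comp (fderiv ℝ β x)
  have hf := ContinuousAlternatingMap.alternatizeUncurryFin_alternatizeUncurryFinCLM_comp_of_symmetric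
    (f := f) (fun u v => by
      change α x u • fderiv ℝ β x v + α x v • fderiv ℝ β x u =
        α x v • fderiv ℝ β x u + α x u • fderiv ℝ β x v
      rw [add_comm])
  rw [← hf, ← ContinuousAlternatingMap.alternatizeUncurryFin_add]
  congr 1
  ext1 u
  simp only [f, ContinuousLinearMap.comp_add, add_apply, ContinuousLinearMap.comp_apply,
    ContinuousLinearMap.smulRight_apply, map_smul,
    ContinuousAlternatingMap.alternatizeUncurryFinCLM_apply, wedgeCLM_apply]
  rw [wedge_eq_alternatizeUncurryFin]
  exact add_comm _ _

theorem extDeriv_oneForm_apply {α : E → E →L[ℝ] ℝ} {x : E} (hα : DifferentiableAt ℝ α x)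
    (u v : E) : extDeriv (fun z => oneForm (α z)) x ![u, v] =
      fderiv ℝ α x u v - fderiv ℝ α x v u := by
  have h1 : (fun z => oneForm (α z)) =
      fun z => ContinuousAlternatingMap.ofSubsingletonLIE (𝕜 := ℝ) (E := E) (F := ℝ) (0 : Fin 1) (α z) := rfl
  have h2 : DifferentiableAt ℝ (fun z => oneForm (α z)) x := by
    rw [h1]; fun_prop
  rw [extDeriv_apply h2]
  refine (Fin.sum_univ_two _).trans ?_
  have h4 (w : Fin 1 → E) : fderiv ℝ (fun z => oneForm (α z) w) x = (fderiv ℝ α x).flip (w 0) := by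
    change fderiv ℝ (fun z => α z (w 0)) x = _
    rw [fderiv_clm_apply hα (by fun_prop)]
    ext; simp
  rw [h4, h4]
  simp [Fin.removeNth]
  ring

end ExteriorAlgebra
end DiffGeom
end

/-! ### The forms θ*: recursion, contraction, exterior derivative. -/

noncomputable section
namespace DiffGeom
open Set
section StarForm
set_option maxSynthPendingDepth 3

theorem add_smul_self {V : Type*} [AddCommGroup V] [Module ℝ V] (c : ℝ) (v : V) :
    v + c • v = (c + 1) • v := by
  rw [add_smul, one_smul, add_comm]

theorem leviCivitaSymbol_comp_swap {n : ℕ} (p : Fin n → Fin n) {a b : Fin n} (hab : a ≠ b) :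
    leviCivitaSymbol (p ∘ Equiv.swap a b) = -leviCivitaSymbol p := by
  classical
  unfold leviCivitaSymbol
  by_cases h : Function.Bijective p
  · have h' : Function.Bijective (p ∘ Equiv.swap a b) := h.comp (Equiv.swap a b).bijective
    rw [dif_pos h, dif_pos h']
    have : Equiv.ofBijective _ h' = Equiv.ofBijective p h * Equiv.swap a b := by
      ext; rfl
    rw [this, Equiv.Perm.sign_mul, Equiv.Perm.sign_swap hab]
    simp
  · have h' : ¬Function.Bijective (p ∘ Equiv.swap a b) := by
      rwa [Function.Bijective.of_comp_iff _ (Equiv.swap a b).bijective]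
    rw [dif_neg h, dif_neg h', neg_zero]

theorem leviCivitaSymbol_ne_zero {n : ℕ} {p : Fin n → Fin n} (hp : Function.Injective p) :
    leviCivitaSymbol p ≠ 0 := by
  unfold leviCivitaSymbol
  rw [dif_pos (Finite.injective_iff_bijective.1 hp)]
  rcases Int.units_eq_one_or (Equiv.Perm.sign (Equiv.ofBijective p
    (Finite.injective_iff_bijective.1 hp))) with h | h <;> simp [h]

theorem leviCivitaSymbol_eq_zero {n : ℕ} {p : Fin n → Fin n} (hp : ¬Function.Surjective p) :
    leviCivitaSymbol p = 0 := by
  unfold leviCivitaSymbol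
  exact dif_neg fun h => hp h.2

variable {E : Type*} [NormedAddCommGroup E] [NormedSpace ℝ E] {n : ℕ}

/-- The `k`-form `1/k! ∑ ε_{i₁ … i_q i_{q+1} … i_n} θ^{i_{q+1}} ∧ … ∧ θ^{i_n}` for a family `θ` of
`n = q + k` linear forms. -/
def starForm (θ : Fin n → E →L[ℝ] ℝ) {q k : ℕ} (h : q + k = n) (I : Fin q → Fin n) :
    E [⋀^Fin k]→L[ℝ] ℝ :=
  ((Nat.factorial k : ℝ)⁻¹) • ∑ f : Fin k → Fin n,
    leviCivitaSymbol (fun a : Fin n => Fin.append I f (Fin.cast h.symm a)) •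
      wedgeProd k fun a => θ (f a)

theorem starForm_zero (θ : Fin n → E →L[ℝ] ℝ) {q : ℕ} (h : q + 0 = n) (I : Fin q → Fin n) :
    starForm θ h I = ContinuousAlternatingMap.constOfIsEmpty ℝ E (Fin 0)
      (leviCivitaSymbol (I ∘ Fin.cast h.symm)) := by
  ext v
  simp only [starForm, Nat.factorial_zero, Nat.cast_one, inv_one, one_smul,
    Finset.univ_unique, Finset.sum_singleton, ContinuousAlternatingMap.smul_apply, wedgeProd,
    ContinuousAlternatingMap.constOfIsEmpty_apply, smul_eq_mul, mul_one]
  congr 1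
  funext a
  subst h
  exact Fin.append_left I _ a

/-- The sum over index maps is split according to the first value `l`, and the quotient of the
factorials leaves 1/(k+1). This recursion carries the inductions on the degree below. -/
theorem starForm_succ (θ : Fin n → E →L[ℝ] ℝ) {q k : ℕ} (h : q + (k + 1) = n)
    (h' : q + 1 + k = n) (I : Fin q → Fin n) :
    starForm θ h I = ((k + 1 : ℝ)⁻¹) •
      ∑ l, wedge (θ l) (starForm θ h' (Fin.snoc I l : Fin (q + 1) → Fin n)) := by
  simp only [starForm, wedge_smul_right, ← Finset.smul_sum, smul_smul, wedge_sum_right]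
  congr 1
  · rw [Nat.factorial_succ]; push_cast; rw [mul_inv]
  · rw [← (Fin.consEquiv fun _ => Fin n).sum_comp, Fintype.sum_prod_type]
    refine Finset.sum_congr rfl fun l _ => Finset.sum_congr rfl fun f _ => ?_
    congr 1
    congr 1
    funext a
    change Fin.append I (Fin.cons l f) _ = _
    rw [Fin.append_right_cons]
    rfl

theorem starForm_comp_swap (θ : Fin n → E →L[ℝ] ℝ) {q k : ℕ} (h : q + k = n) (I : Fin q → Fin n)
    {a b : Fin q} (hab : a ≠ b) :
    starForm θ h (I ∘ Equiv.swap a b) = -starForm θ h I := by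
  subst h
  rw [starForm, starForm, ← smul_neg, ← Finset.sum_neg_distrib]
  congr 1
  refine Finset.sum_congr rfl fun f _ => ?_
  rw [← neg_smul]
  congr 1
  have hab' : Fin.castAdd k a ≠ Fin.castAdd k b := fun h => hab (Fin.castAdd_injective _ _ h)
  rw [← leviCivitaSymbol_comp_swap _ hab']
  congr 1
  funext c
  refine Fin.addCases (fun c => ?_) (fun c => ?_) c
  · have : Equiv.swap (Fin.castAdd k a) (Fin.castAdd k b) (Fin.castAdd k c) =
        Fin.castAdd k (Equiv.swap a b c) :=
      ((Fin.castAdd_injective q k).swap_apply a b c)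
    simp [this]
  · have : Equiv.swap (Fin.castAdd k a) (Fin.castAdd k b) (Fin.natAdd q c) = Fin.natAdd q c := by
      apply Equiv.swap_apply_of_ne_of_ne <;>
      · intro h
        have := congrArg Fin.val h
        simp at this
        omega
    simp [this]

theorem starForm_snoc_snoc (θ : Fin n → E →L[ℝ] ℝ) {q k : ℕ} (h : q + 1 + 1 + k = n)
    (I : Fin q → Fin n) (l m : Fin n) :
    starForm θ h (Fin.snoc (Fin.snoc I l : Fin (q + 1) → Fin n) m : Fin (q + 1 + 1) → Fin n) =
      -starForm θ h
        (Fin.snoc (Fin.snoc I m : Fin (q + 1) → Fin n) l : Fin (q + 1 + 1) → Fin n) := by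
  have hab : (Fin.last q).castSucc ≠ Fin.last (q + 1) := (Fin.castSucc_lt_last _).ne
  rw [← starForm_comp_swap θ h _ hab]
  congr 1
  funext c
  refine Fin.lastCases ?_ (fun c => ?_) c
  · simp
  · refine Fin.lastCases ?_ (fun c => ?_) c
    · simp
    · have : Equiv.swap (Fin.last q).castSucc (Fin.last (q + 1)) c.castSucc.castSucc =
          c.castSucc.castSucc := by
        apply Equiv.swap_apply_of_ne_of_ne
        · intro h; exact (Fin.castSucc_lt_last c).ne (Fin.castSucc_injective _ h)
        · exact (Fin.castSucc_lt_last _).ne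
      simp [this]

theorem starForm_eq_sum_wedge (θ : Fin n → E →L[ℝ] ℝ) {q k : ℕ} (h : q + (k + 1) = n)
    (h' : q + 1 + k = n) (I : Fin q → Fin n) :
    ∑ l, wedge (θ l) (starForm θ h' (Fin.snoc I l : Fin (q + 1) → Fin n)) =
      (k + 1 : ℝ) • starForm θ h I := by
  rw [starForm_succ θ h h', smul_smul, mul_inv_cancel₀ (by positivity), one_smul]

theorem curryLeft_wedge_zero (α : E →L[ℝ] ℝ) (β : E [⋀^Fin 0]→L[ℝ] ℝ) (x : E) :
    (wedge α β).curryLeft x = α x • β := by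
  ext v
  rw [ContinuousAlternatingMap.curryLeft_apply_apply, wedge_apply]
  simp

theorem curryLeft_sum {ι : Type*} (s : Finset ι) {k : ℕ} (β : ι → E [⋀^Fin (k + 1)]→L[ℝ] ℝ)
    (x : E) : (∑ a ∈ s, β a).curryLeft x = ∑ a ∈ s, (β a).curryLeft x := by
  ext v
  simp [ContinuousAlternatingMap.curryLeft_apply_apply, ContinuousAlternatingMap.sum_apply]

theorem curryLeft_smul {k : ℕ} (c : ℝ) (β : E [⋀^Fin (k + 1)]→L[ℝ] ℝ)
    (x : E) : (c • β).curryLeft x = c • β.curryLeft x := by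
  ext v
  simp [ContinuousAlternatingMap.curryLeft_apply_apply]

/-- Induction through `starForm_succ`. In the inductive step the antiderivation rule gives the
expected sum once, directly, and k + 1 more times from the contracted inner factor: exchanging the
last two indices cancels the minus sign there. The total k + 2 cancels the normalization. -/
theorem curryLeft_starForm (θ : Fin n → E →L[ℝ] ℝ) {q k : ℕ} (h : q + (k + 1) = n)
    (h' : q + 1 + k = n) (I : Fin q → Fin n) (x : E) :
    (starForm θ h I).curryLeft x =
      ∑ l, θ l x • starForm θ h' (Fin.snoc I l : Fin (q + 1) → Fin n) := by
  induction k generalizing q with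
  | zero =>
    rw [starForm_succ θ h h', curryLeft_smul, curryLeft_sum]
    simp only [curryLeft_wedge_zero]
    simp
  | succ k ih =>
    rw [starForm_succ θ h h', curryLeft_smul, curryLeft_sum]
    have h'' : q + 1 + 1 + k = n := by omega
    simp only [curryLeft_wedge, ih h' h'', wedge_sum_right, wedge_smul_right]
    rw [Finset.sum_sub_distrib, Finset.sum_comm (f := fun l m => θ m x • _)]
    have h1 (m : Fin n) : ∑ l, θ m x • wedge (θ l) (starForm θ h'' (Fin.snoc
        (Fin.snoc I l : Fin (q + 1) → Fin n) m : Fin (q + 1 + 1) → Fin n)) =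
        -(θ m x • (k + 1 : ℝ) • starForm θ h' (Fin.snoc I m : Fin (q + 1) → Fin n)) := by
      rw [← starForm_eq_sum_wedge θ h' h'', Finset.smul_sum, ← Finset.sum_neg_distrib]
      refine Finset.sum_congr rfl fun l _ => ?_
      rw [starForm_snoc_snoc, wedge_neg_right, smul_neg]
    simp only [h1]
    rw [← Finset.sum_sub_distrib, Finset.smul_sum]
    refine Finset.sum_congr rfl fun l _ => ?_
    rw [sub_neg_eq_add, smul_comm (θ l x) (k + 1 : ℝ), add_smul_self, smul_smul]
    push_cast
    rw [inv_mul_cancel₀ (by positivity), one_smul]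

theorem wedge_wedgeProd_of_mem {k : ℕ} (α : Fin k → E →L[ℝ] ℝ) (a : Fin k) :
    wedge (α a) (wedgeProd k α) = 0 := by
  induction k with
  | zero => exact a.elim0
  | succ k ih =>
    rw [wedgeProd]
    refine Fin.cases ?_ (fun a => ?_) a
    · exact wedge_wedge_self _ _
    · rw [wedge_wedge_comm, ih (fun a => α a.succ) a, wedge_zero_right, neg_zero]

/-- With no free index, a nonzero ε forces every index to occur among the factors, so θ^p is
repeated. This holds although `E` may have dimension larger than `n`. -/
theorem wedge_starForm_zero (θ : Fin n → E →L[ℝ] ℝ) {k : ℕ} (h : 0 + k = n) (I : Fin 0 → Fin n)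
    (p : Fin n) : wedge (θ p) (starForm θ h I) = 0 := by
  simp only [starForm, wedge_smul_right, wedge_sum_right]
  rw [Finset.sum_eq_zero fun f _ => ?_, smul_zero]
  by_cases hf : ∃ a, f a = p
  · obtain ⟨a, rfl⟩ := hf
    rw [wedge_wedgeProd_of_mem (fun a => θ (f a)) a, smul_zero]
  · rw [leviCivitaSymbol_eq_zero, zero_smul]
    intro hs
    obtain ⟨a, ha⟩ := hs p
    subst h
    revert ha
    refine Fin.addCases (fun c => c.elim0) (fun c => ?_) a
    intro ha
    exact hf ⟨c, by rw [← ha]; exact (Fin.append_right I f c).symm⟩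

/-- `e` is a dual family of the family `θ` of linear forms. -/
def IsDualFamily (θ : Fin n → E →L[ℝ] ℝ) (e : Fin n → E) : Prop :=
  ∀ i j, θ i (e j) = if i = j then 1 else 0

theorem IsDualFamily.curryLeft_starForm {θ : Fin n → E →L[ℝ] ℝ} {e : Fin n → E}
    (he : IsDualFamily θ e) {q k : ℕ} (h : q + (k + 1) = n) (h' : q + 1 + k = n)
    (I : Fin q → Fin n) (l : Fin n) :
    (starForm θ h I).curryLeft (e l) = starForm θ h' (Fin.snoc I l : Fin (q + 1) → Fin n) := by
  rw [DiffGeom.curryLeft_starForm θ h h']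
  simp [he _ l]

/-- Since θ*_{Il} is the contraction of θ*_I with `e l`, the antiderivation rule reduces θ^p ∧
θ*_{Il} to a product with one index less. Iterated from `wedge_starForm_zero`, it yields the
contraction formulas with one to four indices. -/
theorem IsDualFamily.wedge_starForm_snoc {θ : Fin n → E →L[ℝ] ℝ} {e : Fin n → E}
    (he : IsDualFamily θ e) {q k : ℕ} (h : q + (k + 1) = n) (h' : q + 1 + k = n)
    (I : Fin q → Fin n) (p l : Fin n) :
    wedge (θ p) (starForm θ h' (Fin.snoc I l : Fin (q + 1) → Fin n)) =
      (if p = l then (1 : ℝ) else 0) • starForm θ h I -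
        (wedge (θ p) (starForm θ h I)).curryLeft (e l) := by
  rw [curryLeft_wedge, he, he.curryLeft_starForm h h']
  abel

/-- Contraction with `e l`, for `l` outside the range of `I`, appends `l` to the indices; after all
contractions the value is ε of a permutation. Applied with no free index, it allows division by the
value of the horizontal volume form. -/
theorem IsDualFamily.exists_starForm_apply_ne_zero {θ : Fin n → E →L[ℝ] ℝ} {e : Fin n → E}
    (he : IsDualFamily θ e) {q k : ℕ} (h : q + k = n) {I : Fin q → Fin n}
    (hI : Function.Injective I) : ∃ f : Fin k → Fin n, starForm θ h I (fun a => e (f a)) ≠ 0 := by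
  induction k generalizing q with
  | zero =>
    refine ⟨fun a => a.elim0, ?_⟩
    rw [starForm_zero]
    exact leviCivitaSymbol_ne_zero (hI.comp (Fin.cast_injective _))
  | succ k ih =>
    have h' : q + 1 + k = n := by omega
    obtain ⟨l, hl⟩ : ∃ l, l ∉ Set.range I := by
      by_contra! hc
      have := Fintype.card_le_of_surjective I hc
      simp at this
      omega
    obtain ⟨f, hf⟩ := ih h' (I := (Fin.snoc I l : Fin (q + 1) → Fin n))
      (Fin.snoc_injective_of_injective hI hl)
    rw [← he.curryLeft_starForm h h', ContinuousAlternatingMap.curryLeft_apply_apply] at hf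
    refine ⟨Matrix.vecCons l f, ?_⟩
    convert hf using 2
    funext a
    refine Fin.cases ?_ (fun a => ?_) a <;> simp

theorem wedgeProd_compContinuousLinearMap {E' : Type*} [NormedAddCommGroup E'] [NormedSpace ℝ E']
    (L : E' →L[ℝ] E) {k : ℕ} (α : Fin k → E →L[ℝ] ℝ) :
    (wedgeProd k α).compContinuousLinearMap L = wedgeProd k fun a => (α a).comp L := by
  induction k with
  | zero => rfl
  | succ k ih => rw [wedgeProd, wedgeProd, wedge_compContinuousLinearMap, ih]

theorem starForm_compContinuousLinearMap {E' : Type*} [NormedAddCommGroup E'] [NormedSpace ℝ E']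
    (L : E' →L[ℝ] E) (θ : Fin n → E →L[ℝ] ℝ) {q k : ℕ} (h : q + k = n) (I : Fin q → Fin n) :
    (starForm θ h I).compContinuousLinearMap L = starForm (fun i => (θ i).comp L) h I := by
  ext v
  simp only [starForm, ← wedgeProd_compContinuousLinearMap,
    ContinuousAlternatingMap.compContinuousLinearMap_apply, ContinuousAlternatingMap.smul_apply,
    ContinuousAlternatingMap.sum_apply]

theorem ContDiffAt.starForm {F : Type*} [NormedAddCommGroup F] [NormedSpace ℝ F]
    {N : WithTop ℕ∞} {θ : F → Fin n → E →L[ℝ] ℝ} {x : F}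
    (hθ : ∀ i, ContDiffAt ℝ N (fun u => θ u i) x) {q k : ℕ} (h : q + k = n) (I : Fin q → Fin n) :
    ContDiffAt ℝ N (fun u => starForm (θ u) h I) x := by
  induction k generalizing q with
  | zero => simp only [starForm_zero]; exact contDiffAt_const
  | succ k ih =>
    have h' : q + 1 + k = n := by omega
    simp only [starForm_succ _ h h']
    exact (ContDiffAt.sum fun l _ => ContDiffAt.wedge (hθ l) (ih h' _)).const_smul _

theorem extDeriv_sum {ι : Type*} {s : Finset ι} {k : ℕ} {β : ι → E → E [⋀^Fin k]→L[ℝ] ℝ} {x : E}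
    (hβ : ∀ a ∈ s, DifferentiableAt ℝ (β a) x) :
    extDeriv (fun u => ∑ a ∈ s, β a u) x = ∑ a ∈ s, extDeriv (β a) x := by
  simp only [extDeriv]
  rw [fderiv_fun_sum hβ]
  simp only [← ContinuousAlternatingMap.alternatizeUncurryFinCLM_apply, map_sum]

theorem extDeriv_const_smul (c : ℝ) {k : ℕ} (β : E → E [⋀^Fin k]→L[ℝ] ℝ) (x : E) :
    extDeriv (fun u => c • β u) x = c • extDeriv β x :=
  extDeriv_smul c β

/-- A 2-form commutes with a 1-form: in finite dimension `B` is a sum of products of two 1-forms,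
and moving `α` past two factors costs two signs. -/
theorem wedge_wedge2_comm [FiniteDimensional ℝ E] {k : ℕ} (α : E →L[ℝ] ℝ)
    (B : E →L[ℝ] E →L[ℝ] ℝ) (β : E [⋀^Fin k]→L[ℝ] ℝ) :
    wedge α (wedge2 B β) = wedge2 B (wedge α β) := by
  let b := Module.finBasis ℝ E
  have hB : B = ∑ i, (LinearMap.toContinuousLinearMap (b.coord i)).smulRight (B (b i)) := by
    ext1 u
    conv_lhs => rw [← b.sum_repr u, map_sum]
    simp only [map_smul, sum_apply, ContinuousLinearMap.smulRight_apply]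
    rfl
  rw [hB, wedge2_sum_left, wedge2_sum_left, wedge_sum_right]
  refine Finset.sum_congr rfl fun i _ => ?_
  rw [wedge2_smulRight, wedge2_smulRight, wedge_wedge_comm, wedge_wedge_comm α, wedge_neg_right,
    neg_neg]

theorem wedge2_smul_right {k : ℕ} (B : E →L[ℝ] E →L[ℝ] ℝ) (c : ℝ) (β : E [⋀^Fin k]→L[ℝ] ℝ) :
    wedge2 B (c • β) = c • wedge2 B β := by
  simp only [wedge2, map_smul, ContinuousLinearMap.smul_comp,
    ContinuousAlternatingMap.alternatizeUncurryFin_smul]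

theorem wedge2_add_right {k : ℕ} (B : E →L[ℝ] E →L[ℝ] ℝ) (β β' : E [⋀^Fin k]→L[ℝ] ℝ) :
    wedge2 B (β + β') = wedge2 B β + wedge2 B β' := by
  simp only [wedge2, map_add, ContinuousLinearMap.add_comp,
    ContinuousAlternatingMap.alternatizeUncurryFin_add]

theorem wedge2_neg_right {k : ℕ} (B : E →L[ℝ] E →L[ℝ] ℝ) (β : E [⋀^Fin k]→L[ℝ] ℝ) :
    wedge2 B (-β) = -wedge2 B β := by
  rw [← neg_one_smul ℝ, wedge2_smul_right, neg_one_smul]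

theorem wedge2_sum_right {ι : Type*} (s : Finset ι) {k : ℕ} (B : E →L[ℝ] E →L[ℝ] ℝ)
    (β : ι → E [⋀^Fin k]→L[ℝ] ℝ) : wedge2 B (∑ a ∈ s, β a) = ∑ a ∈ s, wedge2 B (β a) := by
  classical
  induction s using Finset.induction_on with
  | empty =>
    have := wedge2_smul_right B 0 (0 : E [⋀^Fin k]→L[ℝ] ℝ)
    rw [zero_smul, zero_smul] at this
    simpa using this
  | insert a s ha ih => rw [Finset.sum_insert ha, Finset.sum_insert ha, wedge2_add_right, ih]

/-- The counting is that of `curryLeft_starForm`: differentiating the explicit factor θ^l gives the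
sum once, and the derivative of the inner form gives the remaining copies, the sign of the Leibniz
rule being absorbed by an exchange of the last two indices. -/
theorem extDeriv_starForm [FiniteDimensional ℝ E] {θ : E → Fin n → E →L[ℝ] ℝ} {x : E}
    (hθ : ∀ i, ContDiffAt ℝ 1 (fun u => θ u i) x) {q k : ℕ} (h : q + (k + 1) = n)
    (h' : q + 1 + k = n) (I : Fin q → Fin n) :
    extDeriv (fun u => starForm (θ u) h I) x =
      ∑ l, wedge2 (fderiv ℝ (fun u => θ u l) x)
        (starForm (θ x) h' (Fin.snoc I l : Fin (q + 1) → Fin n)) := by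
  have hd (l : Fin n) : DifferentiableAt ℝ (fun u => θ u l) x := (hθ l).differentiableAt one_ne_zero
  have hs {q k : ℕ} (h : q + k = n) (I : Fin q → Fin n) :
      DifferentiableAt ℝ (fun u => starForm (θ u) h I) x :=
    (ContDiffAt.starForm hθ h I).differentiableAt one_ne_zero
  induction k generalizing q with
  | zero =>
    simp only [starForm_succ _ h h']
    rw [extDeriv_const_smul, extDeriv_sum]
    · simp only [Nat.cast_zero, zero_add, inv_one, one_smul]
      refine Finset.sum_congr rfl fun l _ => ?_
      rw [extDeriv_wedge (hd l) (hs h' _)]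
      have : extDeriv (fun u => starForm (θ u) h' (Fin.snoc I l : Fin (q + 1) → Fin n)) x = 0 := by
        simp only [starForm_zero, extDeriv_constOfIsEmpty]
        ext v
        simp
      rw [this, wedge_zero_right, sub_zero]
    · intro l _
      exact ((ContDiffAt.wedge (hθ l) (ContDiffAt.starForm hθ h' _))).differentiableAt one_ne_zero
  | succ k ih =>
    have h'' : q + 1 + 1 + k = n := by omega
    simp only [starForm_succ _ h h']
    rw [extDeriv_const_smul, extDeriv_sum]
    · have h1 (l : Fin n) : extDeriv (fun u => wedge (θ u l)
          (starForm (θ u) h' (Fin.snoc I l : Fin (q + 1) → Fin n))) x =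
          wedge2 (fderiv ℝ (fun u => θ u l) x)
            (starForm (θ x) h' (Fin.snoc I l : Fin (q + 1) → Fin n)) +
          ∑ m, wedge2 (fderiv ℝ (fun u => θ u m) x) (wedge (θ x l)
            (starForm (θ x) h'' (Fin.snoc (Fin.snoc I m : Fin (q + 1) → Fin n) l :
              Fin (q + 1 + 1) → Fin n))) := by
        rw [extDeriv_wedge (hd l) (hs h' _), ih h' h'', wedge_sum_right, sub_eq_add_neg,
          ← Finset.sum_neg_distrib]
        congr 1
        refine Finset.sum_congr rfl fun m _ => ?_
        rw [wedge_wedge2_comm, starForm_snoc_snoc, wedge_neg_right, wedge2_neg_right, neg_neg]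
      simp only [h1, Finset.sum_add_distrib]
      rw [Finset.sum_comm (f := fun l m => wedge2 _ (wedge _ _)), ← Finset.sum_add_distrib,
        Finset.smul_sum]
      refine Finset.sum_congr rfl fun m _ => ?_
      rw [← wedge2_sum_right, starForm_eq_sum_wedge _ h' h'', wedge2_smul_right, add_smul_self,
        smul_smul]
      push_cast
      rw [inv_mul_cancel₀ (by positivity), one_smul]
    · intro l _
      exact ((ContDiffAt.wedge (hθ l) (ContDiffAt.starForm hθ h' _))).differentiableAt one_ne_zero

end StarForm
end DiffGeom
end

/-! ### Abstract structure equations and the exterior derivative of ϖ ∧ ϖ ∧ θ*. -/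

noncomputable section
namespace DiffGeom
open Set
section StructureEquations
set_option maxSynthPendingDepth 3

variable {E : Type*} [NormedAddCommGroup E] [NormedSpace ℝ E] {n : ℕ}

theorem curryLeft_sub {k : ℕ} (β γ : E [⋀^Fin (k + 1)]→L[ℝ] ℝ) (x : E) :
    (β - γ).curryLeft x = β.curryLeft x - γ.curryLeft x := by
  ext v
  simp [ContinuousAlternatingMap.curryLeft_apply_apply]

theorem curryLeft_add {k : ℕ} (β γ : E [⋀^Fin (k + 1)]→L[ℝ] ℝ) (x : E) :
    (β + γ).curryLeft x = β.curryLeft x + γ.curryLeft x := by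
  ext v
  simp [ContinuousAlternatingMap.curryLeft_apply_apply]

/-- The Kronecker symbol. -/
def delta (p q : Fin n) : ℝ := if p = q then 1 else 0

theorem snoc_zero (i : Fin n) (I : Fin 0 → Fin n) : (Fin.snoc I i : Fin 1 → Fin n) = ![i] := by
  funext a; fin_cases a; rfl

theorem snoc_one (i j : Fin n) : (Fin.snoc ![i] j : Fin 2 → Fin n) = ![i, j] := by
  funext a; fin_cases a <;> rfl

theorem snoc_two (i j k : Fin n) : (Fin.snoc ![i, j] k : Fin 3 → Fin n) = ![i, j, k] := by
  funext a; fin_cases a <;> rfl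

theorem snoc_three (i j k l : Fin n) :
    (Fin.snoc ![i, j, k] l : Fin 4 → Fin n) = ![i, j, k, l] := by
  funext a; fin_cases a <;> rfl

section Contraction

variable {θ : Fin n → E →L[ℝ] ℝ} {e : Fin n → E} (he : IsDualFamily θ e) {k : ℕ}
include he

theorem IsDualFamily.wedge_starForm_one (h0 : 0 + (k + 1) = n) (h1 : 1 + k = n) (p i : Fin n) :
    wedge (θ p) (starForm θ h1 ![i]) = delta p i • starForm θ h0 ![] := by
  rw [← snoc_zero i ![], he.wedge_starForm_snoc h0 h1, wedge_starForm_zero]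
  ext v
  simp [delta]

theorem IsDualFamily.wedge_starForm_two (h1 : 1 + (k + 1) = n) (h2 : 2 + k = n) (p i j : Fin n) :
    wedge (θ p) (starForm θ h2 ![i, j]) =
      delta p j • starForm θ h1 ![i] - delta p i • starForm θ h1 ![j] := by
  rw [← snoc_one, he.wedge_starForm_snoc h1 h2, he.wedge_starForm_one (by omega) h1,
    curryLeft_smul, he.curryLeft_starForm (by omega) h1, snoc_zero]
  rfl

theorem IsDualFamily.wedge_starForm_three (h2 : 2 + (k + 1) = n) (h3 : 3 + k = n)
    (p i j l : Fin n) :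
    wedge (θ p) (starForm θ h3 ![i, j, l]) =
      delta p l • starForm θ h2 ![i, j] - delta p j • starForm θ h2 ![i, l] +
        delta p i • starForm θ h2 ![j, l] := by
  rw [← snoc_two, he.wedge_starForm_snoc h2 h3, he.wedge_starForm_two (by omega) h2,
    curryLeft_sub, curryLeft_smul, curryLeft_smul, he.curryLeft_starForm (by omega) h2,
    he.curryLeft_starForm (by omega) h2, snoc_one, snoc_one, ← sub_add]
  rfl

theorem IsDualFamily.wedge_starForm_four (h3 : 3 + (k + 1) = n) (h4 : 4 + k = n)
    (p i j l m : Fin n) :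
    wedge (θ p) (starForm θ h4 ![i, j, l, m]) =
      delta p m • starForm θ h3 ![i, j, l] - delta p l • starForm θ h3 ![i, j, m] +
        delta p j • starForm θ h3 ![i, l, m] - delta p i • starForm θ h3 ![j, l, m] := by
  rw [← snoc_three, he.wedge_starForm_snoc h3 h4, he.wedge_starForm_three (by omega) h3,
    curryLeft_add, curryLeft_sub, curryLeft_smul, curryLeft_smul, curryLeft_smul,
    he.curryLeft_starForm (by omega) h3, he.curryLeft_starForm (by omega) h3,
    he.curryLeft_starForm (by omega) h3, snoc_two, snoc_two, snoc_two]
  rw [show (if p = m then (1 : ℝ) else 0) = delta p m from rfl]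
  abel

end Contraction

theorem starForm_swap_three_left (θ : Fin n → E →L[ℝ] ℝ) {k : ℕ} (h : 3 + k = n) (i j l : Fin n) :
    starForm θ h ![j, i, l] = -starForm θ h ![i, j, l] := by
  rw [← starForm_comp_swap θ h _ (a := 0) (b := 1) (by decide)]
  congr 1
  funext a; fin_cases a <;> rfl

theorem starForm_swap_three_right (θ : Fin n → E →L[ℝ] ℝ) {k : ℕ} (h : 3 + k = n) (i j l : Fin n) :
    starForm θ h ![i, l, j] = -starForm θ h ![i, j, l] := by
  rw [← starForm_comp_swap θ h _ (a := 1) (b := 2) (by decide)]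
  congr 1
  funext a; fin_cases a <;> rfl

theorem starForm_swap_four_middle (θ : Fin n → E →L[ℝ] ℝ) {k : ℕ} (h : 4 + k = n)
    (i j l m : Fin n) : starForm θ h ![i, l, j, m] = -starForm θ h ![i, j, l, m] := by
  rw [← starForm_comp_swap θ h _ (a := 1) (b := 2) (by decide)]
  congr 1
  funext a; fin_cases a <;> rfl

/-- The bilinear form `∑ c_{pq} θ^p ⊗ θ^q`. -/
def quadForm (θ : Fin n → E →L[ℝ] ℝ) (c : Fin n → Fin n → ℝ) : E →L[ℝ] E →L[ℝ] ℝ :=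
  ∑ p, ∑ q, c p q • (θ p).smulRight (θ q)

theorem wedge2_quadForm (θ : Fin n → E →L[ℝ] ℝ) (c : Fin n → Fin n → ℝ) {k : ℕ}
    (β : E [⋀^Fin k]→L[ℝ] ℝ) :
    wedge2 (quadForm θ c) β = ∑ p, ∑ q, c p q • wedge (θ p) (wedge (θ q) β) := by
  simp only [quadForm, wedge2_sum_left, wedge2_smul_left, wedge2_smulRight]

theorem quadForm_apply (θ : Fin n → E →L[ℝ] ℝ) (c : Fin n → Fin n → ℝ) (u v : E) :
    quadForm θ c u v = ∑ p, ∑ q, c p q * (θ p u * θ q v) := by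
  simp only [quadForm, sum_apply, smul_apply, ContinuousLinearMap.smulRight_apply, smul_eq_mul]

/-- The coframe `(θ^i, ϖ^i_j)`, given by smooth `1`-forms around `x`, satisfies at `x` the
structure equations `dθ^i = 1/2 T^i_{pq} θ^p ∧ θ^q - ϖ^i_j ∧ θ^j` and
`dϖ^i_j = 1/2 R^i_{jpq} θ^p ∧ θ^q - ϖ^i_k ∧ ϖ^k_j`; here `(e_i)` is the family of the horizontal
vectors which are dual to `θ`. -/
structure StructureEquations (s : ℕ) (θ : E → Fin n → E →L[ℝ] ℝ)
    (ϖ : E → Fin n → Fin n → E →L[ℝ] ℝ) (x : E) (T : Fin n → Fin n → Fin n → ℝ)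
    (R : Fin n → Fin n → Fin n → Fin n → ℝ) (e : Fin n → E) : Prop where
  contDiffAt_solder (i : Fin n) : ContDiffAt ℝ 1 (fun u => θ u i) x
  contDiffAt_connection (i j : Fin n) : ContDiffAt ℝ 1 (fun u => ϖ u i j) x
  skew (i j : Fin n) : eta n s i • ϖ x i j + eta n s j • ϖ x j i = 0
  dual : IsDualFamily (θ x) e
  horizontal (i j l : Fin n) : ϖ x i j (e l) = 0
  exists_vertical (Y : Fin n → Fin n → ℝ) (hY : ∀ i j, Y i j = -Y j i) :
    ∃ ξ : E, (∀ i, θ x i ξ = 0) ∧ ∀ i j, ϖ x i j ξ = Y i j * eta n s j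
  torsion_antisymm (i p q : Fin n) : T i p q = -T i q p
  curvature_antisymm (i j p q : Fin n) : R i j p q = -R i j q p
  curvature_skew (i j p q : Fin n) : eta n s i * R i j p q = -(eta n s j * R j i p q)
  fderiv_solder (i : Fin n) (u v : E) :
    fderiv ℝ (fun z => θ z i) x u v - fderiv ℝ (fun z => θ z i) x v u =
      ∑ p, ∑ q, T i p q * (θ x p u * θ x q v) -
        ∑ j, (ϖ x i j u * θ x j v - ϖ x i j v * θ x j u)
  fderiv_connection (i j : Fin n) (u v : E) :
    fderiv ℝ (fun z => ϖ z i j) x u v - fderiv ℝ (fun z => ϖ z i j) x v u =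
      ∑ p, ∑ q, R i j p q * (θ x p u * θ x q v) -
        ∑ k, (ϖ x i k u * ϖ x k j v - ϖ x i k v * ϖ x k j u)

/-- The `(n-2)`-form `σ_i` of a coframe. -/
def sigmaForm (s : ℕ) (θ : Fin n → E →L[ℝ] ℝ) (ϖ : Fin n → Fin n → E →L[ℝ] ℝ) {k : ℕ}
    (h : 3 + k = n) (i : Fin n) : E [⋀^Fin (k + 1)]→L[ℝ] ℝ :=
  -(1 / 2 : ℝ) • ∑ j, ∑ l, wedge (eta n s l • ϖ j l) (starForm θ h ![i, j, l])

/-- The `(n-1)`-form `τ_i` of a coframe. -/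
def tauForm (s : ℕ) (θ : Fin n → E →L[ℝ] ℝ) (ϖ : Fin n → Fin n → E →L[ℝ] ℝ) {k : ℕ}
    (h : 3 + k = n) (i : Fin n) : E [⋀^Fin (k + 1 + 1)]→L[ℝ] ℝ :=
  -(1 / 2 : ℝ) •
    (∑ j, ∑ l, ∑ m, wedge (ϖ j i) (wedge (eta n s m • ϖ l m) (starForm θ h ![j, l, m])) +
      ∑ j, ∑ l, ∑ m, wedge (ϖ j m) (wedge (eta n s l • ϖ m l) (starForm θ h ![i, j, l])))

/-- The factor 1/2 compensates the double counting of the pairs (p, q): for antisymmetric `c`, the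
2-form 1/2 c_{pq} θ^p ∧ θ^q takes the value c_{pq} θ^p(u) θ^q(v). -/
theorem quadForm_sub_flip (θ : Fin n → E →L[ℝ] ℝ) {c : Fin n → Fin n → ℝ}
    (hc : ∀ p q, c p q = -c q p) (u v : E) :
    quadForm θ (fun p q => 1 / 2 * c p q) u v - quadForm θ (fun p q => 1 / 2 * c p q) v u =
      ∑ p, ∑ q, c p q * (θ p u * θ q v) := by
  rw [quadForm_apply, quadForm_apply, Finset.sum_comm (f := fun p q => _ * (θ p v * θ q u)),
    ← Finset.sum_sub_distrib]
  refine Finset.sum_congr rfl fun p _ => ?_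
  rw [← Finset.sum_sub_distrib]
  refine Finset.sum_congr rfl fun q _ => ?_
  rw [hc q p]
  ring

namespace StructureEquations

variable {s : ℕ} {θ : E → Fin n → E →L[ℝ] ℝ} {ϖ : E → Fin n → Fin n → E →L[ℝ] ℝ} {x : E}
  {T : Fin n → Fin n → Fin n → ℝ} {R : Fin n → Fin n → Fin n → Fin n → ℝ} {e : Fin n → E}
  (H : StructureEquations s θ ϖ x T R e) {k : ℕ}
include H

theorem wedge2_fderiv_solder (i : Fin n) (β : E [⋀^Fin k]→L[ℝ] ℝ) :
    wedge2 (fderiv ℝ (fun z => θ z i) x) β =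
      wedge2 (quadForm (θ x) fun p q => 1 / 2 * T i p q) β -
        ∑ j, wedge (ϖ x i j) (wedge (θ x j) β) := by
  simp only [← wedge2_smulRight]
  rw [← wedge2_sum_left, ← wedge2_sub_left]
  refine wedge2_congr (fun u v => ?_) β
  rw [H.fderiv_solder, ← quadForm_sub_flip _ (H.torsion_antisymm i)]
  simp only [sub_apply, sum_apply, ContinuousLinearMap.smulRight_apply, smul_apply, smul_eq_mul,
    Finset.sum_sub_distrib]
  ring

theorem wedge2_fderiv_connection (i j : Fin n) (β : E [⋀^Fin k]→L[ℝ] ℝ) :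
    wedge2 (fderiv ℝ (fun z => ϖ z i j) x) β =
      wedge2 (quadForm (θ x) fun p q => 1 / 2 * R i j p q) β -
        ∑ l, wedge (ϖ x i l) (wedge (ϖ x l j) β) := by
  simp only [← wedge2_smulRight]
  rw [← wedge2_sum_left, ← wedge2_sub_left]
  refine wedge2_congr (fun u v => ?_) β
  rw [H.fderiv_connection, ← quadForm_sub_flip _ (H.curvature_antisymm i j)]
  simp only [sub_apply, sum_apply, ContinuousLinearMap.smulRight_apply, smul_apply, smul_eq_mul,
    Finset.sum_sub_distrib]
  ring

omit H in
/-- The `(n-2)`-form `Θ^l ∧ θ*_{ijkl}`. -/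
def torsionStar (θ : Fin n → E →L[ℝ] ℝ) (T : Fin n → Fin n → Fin n → ℝ) (h4 : 4 + k = n)
    (a b c : Fin n) : E [⋀^Fin (k + 1 + 1)]→L[ℝ] ℝ :=
  ∑ l, wedge2 (quadForm θ fun p q => 1 / 2 * T l p q) (starForm θ h4 ![a, b, c, l])

variable [FiniteDimensional ℝ E]

theorem extDeriv_starForm (h3 : 3 + (k + 1) = n) (h4 : 4 + k = n) (a b c : Fin n) :
    extDeriv (fun u => starForm (θ u) h3 ![a, b, c]) x =
      torsionStar (θ x) T h4 a b c -
        ∑ l, ∑ m, wedge (ϖ x l m) (wedge (θ x m) (starForm (θ x) h4 ![a, b, c, l])) := by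
  rw [DiffGeom.extDeriv_starForm H.contDiffAt_solder h3 h4, torsionStar,
    ← Finset.sum_sub_distrib]
  refine Finset.sum_congr rfl fun l _ => ?_
  rw [H.wedge2_fderiv_solder, snoc_three]

/-- The terms are graded by the number of connection forms: one with the curvature, two with the
torsion, three otherwise. Evaluation on a suitable number of vertical vectors separates the grades.
-/
theorem extDeriv_wedge_wedge_starForm (h3 : 3 + (k + 1) = n) (h4 : 4 + k = n)
    (i j p q a b c : Fin n) :
    extDeriv (fun u => wedge (ϖ u i j) (wedge (ϖ u p q) (starForm (θ u) h3 ![a, b, c]))) x =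
      wedge (ϖ x p q) (wedge2 (quadForm (θ x) fun p q => 1 / 2 * R i j p q)
          (starForm (θ x) h3 ![a, b, c])) -
        wedge (ϖ x i j) (wedge2 (quadForm (θ x) fun r t => 1 / 2 * R p q r t)
          (starForm (θ x) h3 ![a, b, c])) +
        wedge (ϖ x i j) (wedge (ϖ x p q) (torsionStar (θ x) T h4 a b c)) -
        ∑ m, wedge (ϖ x i m) (wedge (ϖ x m j)
          (wedge (ϖ x p q) (starForm (θ x) h3 ![a, b, c]))) +
        ∑ m, wedge (ϖ x i j) (wedge (ϖ x p m) (wedge (ϖ x m q) (starForm (θ x) h3 ![a, b, c]))) -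
        ∑ l, ∑ m, wedge (ϖ x i j) (wedge (ϖ x p q)
          (wedge (ϖ x l m) (wedge (θ x m) (starForm (θ x) h4 ![a, b, c, l])))) := by
  have hs := ContDiffAt.starForm H.contDiffAt_solder h3 ![a, b, c]
  have hd (i j : Fin n) := (H.contDiffAt_connection i j).differentiableAt one_ne_zero
  rw [extDeriv_wedge (hd i j)
    ((ContDiffAt.wedge (H.contDiffAt_connection p q) hs).differentiableAt one_ne_zero),
    extDeriv_wedge (hd p q) (hs.differentiableAt one_ne_zero), H.wedge2_fderiv_connection,
    H.wedge2_fderiv_connection, H.extDeriv_starForm h3 h4, ← wedge_wedge2_comm]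
  simp only [wedge_sub_right, wedge_sum_right]
  abel

end StructureEquations

end StructureEquations
end DiffGeom
end

/-! ### Evaluation on vertical vectors and the linear algebra of elementary rotations. -/

noncomputable section
namespace DiffGeom
open Set
section FieldEquations
set_option maxSynthPendingDepth 3

variable {E : Type*} [NormedAddCommGroup E] [NormedSpace ℝ E] {n : ℕ}

/-- This and the next two lemmas are used with connection forms as α, β and horizontal vectors in
`v`. A connection form must absorb one of the leading vectors, so a product with more connection
forms than leading vectors vanishes. -/
theorem wedge_apply_cons_cons (α : E →L[ℝ] ℝ) {k : ℕ} (β : E [⋀^Fin (k + 1)]→L[ℝ] ℝ) (y z : E)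
    (v : Fin k → E) (h : ∀ a, α (v a) = 0) :
    wedge α β (Matrix.vecCons y (Matrix.vecCons z v)) =
      α y * β (Matrix.vecCons z v) - α z * β (Matrix.vecCons y v) := by
  rw [← ContinuousAlternatingMap.curryLeft_apply_apply, curryLeft_wedge]
  simp only [ContinuousAlternatingMap.sub_apply, ContinuousAlternatingMap.smul_apply, smul_eq_mul]
  rw [wedge_apply_cons_eq_of_forall _ _ _ _ h, ContinuousAlternatingMap.curryLeft_apply_apply]

theorem wedge_wedge_apply_cons (α β : E →L[ℝ] ℝ) {k : ℕ} (γ : E [⋀^Fin k]→L[ℝ] ℝ) (y : E)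
    (v : Fin (k + 1) → E) (hα : ∀ a, α (v a) = 0) (hβ : ∀ a, β (v a) = 0) :
    wedge α (wedge β γ) (Matrix.vecCons y v) = 0 := by
  rw [wedge_apply_cons_eq_of_forall _ _ _ _ hα, wedge_apply_eq_zero_of_forall _ _ _ hβ, mul_zero]

theorem wedge_wedge_apply_cons_cons (α β : E →L[ℝ] ℝ) {k : ℕ} (γ : E [⋀^Fin k]→L[ℝ] ℝ) (y z : E)
    (v : Fin k → E) (hα : ∀ a, α (v a) = 0) (hβ : ∀ a, β (v a) = 0) :
    wedge α (wedge β γ) (Matrix.vecCons y (Matrix.vecCons z v)) =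
      (α y * β z - α z * β y) * γ v := by
  rw [wedge_apply_cons_cons _ _ _ _ _ hα, wedge_apply_cons_eq_of_forall _ _ _ _ hβ,
    wedge_apply_cons_eq_of_forall _ _ _ _ hβ]
  ring

theorem wedge_apply_comp_eq_zero (α : E →L[ℝ] ℝ) {k : ℕ} {γ : E [⋀^Fin k]→L[ℝ] ℝ} {e : Fin n → E}
    (hγ : ∀ f : Fin k → Fin n, γ (fun a => e (f a)) = 0) (f : Fin (k + 1) → Fin n) :
    wedge α γ (fun a => e (f a)) = 0 := by
  rw [wedge_apply]
  refine Finset.sum_eq_zero fun i _ => ?_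
  rw [show Fin.removeNth i (fun a => e (f a)) = fun a => e (i.removeNth f a) from rfl, hγ]
  ring

theorem curryLeft_wedge2_quadForm_starForm (θ : Fin n → E →L[ℝ] ℝ) (c : Fin n → Fin n → ℝ)
    {q k : ℕ} (h : q + (k + 1) = n) (I : Fin q → Fin n) {ξ : E} (hξ : ∀ i, θ i ξ = 0) :
    (wedge2 (quadForm θ c) (starForm θ h I)).curryLeft ξ = 0 := by
  rw [wedge2_quadForm, curryLeft_sum]
  refine Finset.sum_eq_zero fun p _ => ?_
  rw [curryLeft_sum]
  refine Finset.sum_eq_zero fun q _ => ?_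
  rw [curryLeft_smul, curryLeft_wedge, curryLeft_wedge, curryLeft_starForm θ h (by omega)]
  simp [hξ, wedge_zero_right]

theorem sum_sum_ite_ite (a b : Fin n) (f : Fin n → Fin n → ℝ) :
    (∑ p, ∑ q, if p = a then if q = b then f p q else 0 else 0) = f a b := by
  rw [Finset.sum_eq_single a (fun p _ hp => by simp [hp]) (by simp)]
  simp

section Contraction

variable {θ : Fin n → E →L[ℝ] ℝ} {e : Fin n → E} (he : IsDualFamily θ e) {k : ℕ}
include he

theorem IsDualFamily.wedge2_starForm_three {c : Fin n → Fin n → ℝ} (hc : ∀ p q, c p q = -c q p)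
    (h1 : 1 + (k + 1 + 1) = n) (h3 : 3 + k = n) (i j l : Fin n) :
    wedge2 (quadForm θ fun p q => 1 / 2 * c p q) (starForm θ h3 ![i, j, l]) =
      c j l • starForm θ h1 ![i] - c i l • starForm θ h1 ![j] + c i j • starForm θ h1 ![l] := by
  rw [wedge2_quadForm]
  simp only [he.wedge_starForm_three (k := k) (by omega) h3, wedge_add_right, wedge_sub_right,
    wedge_smul_right, he.wedge_starForm_two (k := k + 1) h1 (by omega)]
  ext v
  simp only [ContinuousAlternatingMap.sum_apply, ContinuousAlternatingMap.smul_apply,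
    ContinuousAlternatingMap.add_apply, ContinuousAlternatingMap.sub_apply, smul_eq_mul, delta]
  simp only [mul_add, mul_sub, ite_mul, mul_ite, zero_mul, mul_zero, one_mul,
    Finset.sum_add_distrib, Finset.sum_sub_distrib, sum_sum_ite_ite]
  rw [hc l j, hc l i, hc j i]
  ring

theorem IsDualFamily.wedge2_starForm_four {c : Fin n → Fin n → ℝ} (hc : ∀ p q, c p q = -c q p)
    (h2 : 2 + (k + 1 + 1) = n) (h4 : 4 + k = n) (i j l m : Fin n) :
    wedge2 (quadForm θ fun p q => 1 / 2 * c p q) (starForm θ h4 ![i, j, l, m]) =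
      c l m • starForm θ h2 ![i, j] - c j m • starForm θ h2 ![i, l] +
        c i m • starForm θ h2 ![j, l] + c j l • starForm θ h2 ![i, m] -
        c i l • starForm θ h2 ![j, m] + c i j • starForm θ h2 ![l, m] := by
  rw [wedge2_quadForm]
  simp only [he.wedge_starForm_four (k := k) (by omega) h4, wedge_add_right, wedge_sub_right,
    wedge_smul_right, he.wedge_starForm_three (k := k + 1) h2 (by omega)]
  ext v
  simp only [ContinuousAlternatingMap.sum_apply, ContinuousAlternatingMap.smul_apply,
    ContinuousAlternatingMap.add_apply, ContinuousAlternatingMap.sub_apply, smul_eq_mul, delta]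
  simp only [mul_add, mul_sub, ite_mul, mul_ite, zero_mul, mul_zero, one_mul,
    Finset.sum_add_distrib, Finset.sum_sub_distrib, sum_sum_ite_ite]
  rw [hc m l, hc m j, hc m i, hc l j, hc l i, hc j i]
  ring

end Contraction

/-- The skew-symmetric matrix with entries `1` at `(a, b)` and `-1` at `(b, a)`. -/
def skewUnit (a b i j : Fin n) : ℝ := delta i a * delta j b - delta i b * delta j a

theorem skewUnit_antisymm (a b i j : Fin n) : skewUnit a b i j = -skewUnit a b j i := by
  unfold skewUnit; ring

theorem sum_delta_mul (a : Fin n) (f : Fin n → ℝ) : ∑ i, delta i a * f i = f a := by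
  simp [delta]

theorem sum_sum_skewUnit_mul (a b : Fin n) (f : Fin n → Fin n → ℝ) :
    ∑ i, ∑ j, skewUnit a b i j * f i j = f a b - f b a := by
  simp only [skewUnit, sub_mul, Finset.sum_sub_distrib, mul_assoc, ← Finset.mul_sum, sum_delta_mul]

theorem delta_mul_delta_eq_zero {a b : Fin n} (hab : a ≠ b) (m : Fin n) :
    delta m a * delta m b = 0 := by
  unfold delta
  split_ifs with h1 h2
  · exact absurd (h1.symm.trans h2) hab
  all_goals simp

theorem skewUnit_mul_skewUnit_eq_zero {a i b c : Fin n} (hab : a ≠ b) (hac : a ≠ c) (hib : i ≠ b)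
    (hic : i ≠ c) (j m l : Fin n) : skewUnit a i j m * skewUnit b c m l = 0 := by
  unfold skewUnit
  linear_combination (delta j a * delta l c) * delta_mul_delta_eq_zero hib m -
    (delta j a * delta l b) * delta_mul_delta_eq_zero hic m -
    (delta j i * delta l c) * delta_mul_delta_eq_zero hab m +
    (delta j i * delta l b) * delta_mul_delta_eq_zero hac m

theorem skewUnit_right_of_ne {a i : Fin n} (hai : a ≠ i) (j : Fin n) :
    skewUnit a i j i = delta j a := by
  unfold skewUnit delta
  simp [hai.symm]

theorem skewUnit_eq_zero_of_ne {b c i : Fin n} (hib : i ≠ b) (hic : i ≠ c) (j : Fin n) :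
    skewUnit b c j i = 0 := by
  unfold skewUnit delta
  simp [hib, hic]

/-- In the application, `Q a b c` is the value of Θ^l ∧ θ*_{abcl} on horizontal vectors, and `h` is
dτ_i on two vertical vectors, up to the factor −1/2. The second sum consists of products of
elementary matrices with disjoint index pairs and vanishes. In the first sum the entry with second
index `i` selects j = a, and the rotation (b, c) leaves η_i (Q a b c − Q a c b) = 2 η_i Q a b c. -/
theorem eq_zero_of_skewUnit_pair (η : Fin n → ℝ) (hη : ∀ i, η i * η i = 1)
    (Q : Fin n → Fin n → Fin n → ℝ) {a b c i : Fin n} (hQ : Q a c b = -Q a b c)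
    (hai : a ≠ i) (hab : a ≠ b) (hac : a ≠ c) (hib : i ≠ b) (hic : i ≠ c)
    (h : ∑ j, ∑ l, ∑ m, η m * ((skewUnit a i j i * η i * (skewUnit b c l m * η m) -
          skewUnit b c j i * η i * (skewUnit a i l m * η m)) * Q j l m) +
        ∑ j, ∑ l, ∑ m, η l * ((skewUnit a i j m * η m * (skewUnit b c m l * η l) -
          skewUnit b c j m * η m * (skewUnit a i m l * η l)) * Q i j l) = 0) :
    Q a b c = 0 := by
  have h1 : ∑ j, ∑ l, ∑ m, η l * ((skewUnit a i j m * η m * (skewUnit b c m l * η l) -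
          skewUnit b c j m * η m * (skewUnit a i m l * η l)) * Q i j l) = 0 := by
    refine Finset.sum_eq_zero fun j _ => Finset.sum_eq_zero fun l _ =>
      Finset.sum_eq_zero fun m _ => ?_
    linear_combination (η l * η m * η l * Q i j l) *
        skewUnit_mul_skewUnit_eq_zero hab hac hib hic j m l -
      (η l * η m * η l * Q i j l) *
        skewUnit_mul_skewUnit_eq_zero hab.symm hib.symm hac.symm hic.symm j m l
  have h2 : ∑ j, ∑ l, ∑ m, η m * ((skewUnit a i j i * η i * (skewUnit b c l m * η m) -
          skewUnit b c j i * η i * (skewUnit a i l m * η m)) * Q j l m) =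
      ∑ j, delta j a * (η i * ∑ l, ∑ m, skewUnit b c l m * Q j l m) := by
    refine Finset.sum_congr rfl fun j _ => ?_
    rw [skewUnit_right_of_ne hai, skewUnit_eq_zero_of_ne hib hic, Finset.mul_sum, Finset.mul_sum]
    refine Finset.sum_congr rfl fun l _ => ?_
    rw [Finset.mul_sum, Finset.mul_sum]
    refine Finset.sum_congr rfl fun m _ => ?_
    linear_combination (delta j a * η i * skewUnit b c l m * Q j l m) * hη m
  rw [h1, h2, add_zero, sum_delta_mul, sum_sum_skewUnit_mul, hQ] at h
  have h3 : η i ≠ 0 := fun h0 => by simpa [h0] using hη i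
  have := (mul_eq_zero.1 h).resolve_left h3
  linarith

/-- In the application, `F i j a b c` is the value of Ω^{ij} ∧ θ*_{abc} on horizontal vectors, and
`h` is dτ_i on one vertical vector, the rotation (a, i), again up to the factor −1/2. One term is
−η_i times the desired sum; all the others cancel by antisymmetry. -/
theorem sum_eq_zero_of_skewUnit (η : Fin n → ℝ) (hη : ∀ i, η i * η i = 1)
    (F : Fin n → Fin n → Fin n → Fin n → Fin n → ℝ) (hF : ∀ i j a b c, F i j a b c = -F j i a b c)
    (hl : ∀ i j a b c, F i j b a c = -F i j a b c) (hr : ∀ i j a b c, F i j a c b = -F i j a b c)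
    {a i : Fin n} (hai : a ≠ i)
    (h : ∑ j, ∑ l, ∑ m, η m * (skewUnit a i l m * η m * (η i * F j i j l m) -
          skewUnit a i j i * η i * (η m * F l m j l m)) +
        ∑ j, ∑ l, ∑ m, η l * (skewUnit a i m l * η l * (η m * F j m i j l) -
          skewUnit a i j m * η m * (η l * F m l i j l)) = 0) :
    ∑ l, ∑ m, F l m a l m = 0 := by
  have hd (i j a b : Fin n) : F i j a b a = 0 := by
    have h1 := hl i j a b a
    have h2 := hr i j b a a
    have h3 := hr i j a a b
    have h4 := hl i j a a b
    linarith
  have h1 : ∑ j, ∑ l, ∑ m, η m * (skewUnit a i l m * η m * (η i * F j i j l m) -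
          skewUnit a i j i * η i * (η m * F l m j l m)) =
      ∑ j, η i * (F j i j a i - F j i j i a) - η i * ∑ l, ∑ m, F l m a l m := by
    rw [← sum_delta_mul a fun j => η i * ∑ l, ∑ m, F l m j l m, ← Finset.sum_sub_distrib]
    refine Finset.sum_congr rfl fun j _ => ?_
    rw [← sum_sum_skewUnit_mul a i fun l m => F j i j l m, skewUnit_right_of_ne hai]
    simp only [Finset.mul_sum, ← Finset.sum_sub_distrib]
    refine Finset.sum_congr rfl fun l _ => Finset.sum_congr rfl fun m _ => ?_
    linear_combination (skewUnit a i l m * η i * F j i j l m -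
      delta j a * η i * F l m j l m) * hη m
  have h2 : ∑ j, ∑ l, ∑ m, η l * (skewUnit a i m l * η l * (η m * F j m i j l) -
          skewUnit a i j m * η m * (η l * F m l i j l)) =
      -(∑ j, η i * F j i i j a) - ∑ l, η i * F i l i a l := by
    have h3 (j : Fin n) : ∑ l, ∑ m, η l * (skewUnit a i m l * η l * (η m * F j m i j l)) =
        -(η i * F j i i j a) := by
      rw [Finset.sum_comm]
      have := sum_sum_skewUnit_mul a i fun m l => η m * F j m i j l
      rw [hd j a i j] at this
      rw [show -(η i * F j i i j a) = η a * 0 - η i * F j i i j a by ring, ← this]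
      refine Finset.sum_congr rfl fun m _ => Finset.sum_congr rfl fun l _ => ?_
      linear_combination (skewUnit a i m l * η m * F j m i j l) * hη l
    have h4 : ∑ j, ∑ l, ∑ m, η l * (skewUnit a i j m * η m * (η l * F m l i j l)) =
        ∑ l, η i * F i l i a l := by
      rw [Finset.sum_comm]
      refine Finset.sum_congr rfl fun l _ => ?_
      have := sum_sum_skewUnit_mul a i fun j m => η m * F m l i j l
      have h5 : F a l i i l = 0 := by
        have := hl a l i i l
        linarith
      rw [h5] at this
      rw [show η i * F i l i a l = η i * F i l i a l - η a * 0 by ring, ← this]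
      refine Finset.sum_congr rfl fun j _ => Finset.sum_congr rfl fun m _ => ?_
      linear_combination (skewUnit a i j m * η m * F m l i j l) * hη l
    simp only [mul_sub, Finset.sum_sub_distrib, h4]
    rw [Finset.sum_congr rfl fun j _ => h3 j, Finset.sum_neg_distrib]
  -- By the antisymmetries every summand is a multiple of η_i F j i j i a, with coefficients −2, +1
  -- and +1.
  have h6 : ∑ j, η i * (F j i j a i - F j i j i a) - ∑ j, η i * F j i i j a -
      ∑ l, η i * F i l i a l = 0 := by
    rw [← Finset.sum_sub_distrib, ← Finset.sum_sub_distrib]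
    refine Finset.sum_eq_zero fun j _ => ?_
    rw [hr j i j i a, hF i j, hr j i i j a, hl j i i j a]
    ring
  have h7 : η i * ∑ l, ∑ m, F l m a l m = 0 := by
    rw [h1, h2] at h
    linarith
  have h8 : η i ≠ 0 := fun h0 => by simpa [h0] using hη i
  exact (mul_eq_zero.1 h7).resolve_left h8

end FieldEquations
end DiffGeom
end

/-! ### Closedness of τ and the vacuum equations for an abstract coframe. -/

noncomputable section
namespace DiffGeom
open Set
section VacuumEquations
set_option maxSynthPendingDepth 3

variable {E : Type*} [NormedAddCommGroup E] [NormedSpace ℝ E] {n : ℕ}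

theorem sum_sum_sum_swap {V : Type*} [AddCommMonoid V] (f : Fin n → Fin n → Fin n → V) :
    ∑ j, ∑ l, ∑ m, f m l j = ∑ j, ∑ l, ∑ m, f j l m := by
  rw [Finset.sum_comm]
  simp only [Finset.sum_comm (f := fun j m => f m _ j)]
  rw [Finset.sum_comm]

theorem sum_sum_sum_rotate {V : Type*} [AddCommMonoid V] (f : Fin n → Fin n → Fin n → V) :
    ∑ j, ∑ l, ∑ m, f m j l = ∑ j, ∑ l, ∑ m, f j l m := by
  rw [← sum_sum_sum_swap]
  exact Finset.sum_congr rfl fun j _ => Finset.sum_comm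

namespace StructureEquations

variable {s : ℕ} {θ : E → Fin n → E →L[ℝ] ℝ} {ϖ : E → Fin n → Fin n → E →L[ℝ] ℝ} {x : E}
  {T : Fin n → Fin n → Fin n → ℝ} {R : Fin n → Fin n → Fin n → Fin n → ℝ} {e : Fin n → E}
  (H : StructureEquations s θ ϖ x T R e) {k : ℕ}
include H

theorem differentiableAt_wedge_wedge_starForm (h3 : 3 + k = n) (i j p q : Fin n)
    (I : Fin 3 → Fin n) :
    DifferentiableAt ℝ (fun u => wedge (ϖ u i j) (wedge (ϖ u p q) (starForm (θ u) h3 I))) x :=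
  (ContDiffAt.wedge (H.contDiffAt_connection i j) (ContDiffAt.wedge (H.contDiffAt_connection p q)
    (ContDiffAt.starForm H.contDiffAt_solder h3 I))).differentiableAt one_ne_zero

theorem extDeriv_tauForm (h3 : 3 + k = n) (i : Fin n) :
    extDeriv (fun u => tauForm s (θ u) (ϖ u) h3 i) x = -(1 / 2 : ℝ) •
      (∑ j, ∑ l, ∑ m, eta n s m • extDeriv (fun u =>
          wedge (ϖ u j i) (wedge (ϖ u l m) (starForm (θ u) h3 ![j, l, m]))) x +
        ∑ j, ∑ l, ∑ m, eta n s l • extDeriv (fun u =>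
          wedge (ϖ u j m) (wedge (ϖ u m l) (starForm (θ u) h3 ![i, j, l]))) x) := by
  have hd (c : ℝ) (i j p q : Fin n) (I : Fin 3 → Fin n) : DifferentiableAt ℝ (fun u =>
      c • wedge (ϖ u i j) (wedge (ϖ u p q) (starForm (θ u) h3 I))) x :=
    (H.differentiableAt_wedge_wedge_starForm h3 i j p q I).const_smul c
  simp only [tauForm, wedge_smul_left, wedge_smul_right]
  rw [extDeriv_const_smul, extDeriv_fun_add]
  · congr 2
    · rw [extDeriv_sum fun j _ => DifferentiableAt.fun_sum fun l _ =>
        DifferentiableAt.fun_sum fun m _ => hd _ _ _ _ _ _]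
      refine Finset.sum_congr rfl fun j _ => ?_
      rw [extDeriv_sum fun l _ => DifferentiableAt.fun_sum fun m _ => hd _ _ _ _ _ _]
      refine Finset.sum_congr rfl fun l _ => ?_
      rw [extDeriv_sum fun m _ => hd _ _ _ _ _ _]
      exact Finset.sum_congr rfl fun m _ => extDeriv_const_smul _ _ _
    · rw [extDeriv_sum fun j _ => DifferentiableAt.fun_sum fun l _ =>
        DifferentiableAt.fun_sum fun m _ => hd _ _ _ _ _ _]
      refine Finset.sum_congr rfl fun j _ => ?_
      rw [extDeriv_sum fun l _ => DifferentiableAt.fun_sum fun m _ => hd _ _ _ _ _ _]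
      refine Finset.sum_congr rfl fun l _ => ?_
      rw [extDeriv_sum fun m _ => hd _ _ _ _ _ _]
      exact Finset.sum_congr rfl fun m _ => extDeriv_const_smul _ _ _
  · exact DifferentiableAt.fun_sum fun j _ => DifferentiableAt.fun_sum fun l _ =>
        DifferentiableAt.fun_sum fun m _ => hd _ _ _ _ _ _
  · exact DifferentiableAt.fun_sum fun j _ => DifferentiableAt.fun_sum fun l _ =>
        DifferentiableAt.fun_sum fun m _ => hd _ _ _ _ _ _

variable [FiniteDimensional ℝ E]

/-- Only the grade with two connection forms survives. In a curvature term one of the vertical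
vectors would enter a form built from θ alone; a term with three connection forms has too few
vertical vectors. -/
theorem extDeriv_wedge_wedge_starForm_apply_cons_cons (h3 : 3 + (k + 1) = n) (h4 : 4 + k = n)
    (i j p q a b c : Fin n) {y z : E} (hy : ∀ i, θ x i y = 0) (hz : ∀ i, θ x i z = 0)
    (f : Fin (k + 2) → Fin n) :
    extDeriv (fun u => wedge (ϖ u i j) (wedge (ϖ u p q) (starForm (θ u) h3 ![a, b, c]))) x
        (Matrix.vecCons y (Matrix.vecCons z fun d => e (f d))) =
      (ϖ x i j y * ϖ x p q z - ϖ x i j z * ϖ x p q y) *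
        torsionStar (θ x) T h4 a b c fun d => e (f d) := by
  have hh (i j : Fin n) (d : Fin (k + 2)) : ϖ x i j (e (f d)) = 0 := H.horizontal i j _
  have hW (c' : Fin n → Fin n → ℝ) (i j : Fin n) : wedge (ϖ x i j)
      (wedge2 (quadForm (θ x) c') (starForm (θ x) h3 ![a, b, c]))
        (Matrix.vecCons y (Matrix.vecCons z fun d => e (f d))) = 0 := by
    rw [wedge_apply_cons_cons _ _ _ _ _ (hh i j), ← ContinuousAlternatingMap.curryLeft_apply_apply,
      ← ContinuousAlternatingMap.curryLeft_apply_apply,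
      curryLeft_wedge2_quadForm_starForm _ _ h3 _ hy,
      curryLeft_wedge2_quadForm_starForm _ _ h3 _ hz]
    simp
  have h3w (i j p q r t : Fin n) (γ : E [⋀^Fin (k + 1)]→L[ℝ] ℝ) :
      wedge (ϖ x i j) (wedge (ϖ x p q) (wedge (ϖ x r t) γ))
        (Matrix.vecCons y (Matrix.vecCons z fun d => e (f d))) = 0 := by
    rw [wedge_apply_cons_cons _ _ _ _ _ (hh i j), wedge_wedge_apply_cons _ _ _ _ _ (hh p q) (hh r t),
      wedge_wedge_apply_cons _ _ _ _ _ (hh p q) (hh r t)]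
    ring
  rw [H.extDeriv_wedge_wedge_starForm h3 h4]
  simp only [ContinuousAlternatingMap.add_apply, ContinuousAlternatingMap.sub_apply,
    ContinuousAlternatingMap.sum_apply, hW, h3w, Finset.sum_const_zero]
  rw [wedge_wedge_apply_cons_cons _ _ _ _ _ _ (hh i j) (hh p q)]
  ring

/-- With a single leading vector every term with at least two connection forms vanishes. The torsion
drops out too, so the Einstein equation can be obtained independently of the vanishing of the
torsion. -/
theorem extDeriv_wedge_wedge_starForm_apply_cons (h3 : 3 + (k + 1) = n) (h4 : 4 + k = n)
    (i j p q a b c : Fin n) (y : E) (f : Fin (k + 3) → Fin n) :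
    extDeriv (fun u => wedge (ϖ u i j) (wedge (ϖ u p q) (starForm (θ u) h3 ![a, b, c]))) x
        (Matrix.vecCons y fun d => e (f d)) =
      ϖ x p q y * wedge2 (quadForm (θ x) fun r t => 1 / 2 * R i j r t)
          (starForm (θ x) h3 ![a, b, c]) (fun d => e (f d)) -
        ϖ x i j y * wedge2 (quadForm (θ x) fun r t => 1 / 2 * R p q r t)
          (starForm (θ x) h3 ![a, b, c]) (fun d => e (f d)) := by
  have hh (i j : Fin n) (d : Fin (k + 3)) : ϖ x i j (e (f d)) = 0 := H.horizontal i j _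
  have h2w (i j p q : Fin n) (γ : E [⋀^Fin (k + 2)]→L[ℝ] ℝ) :
      wedge (ϖ x i j) (wedge (ϖ x p q) γ) (Matrix.vecCons y fun d => e (f d)) = 0 :=
    wedge_wedge_apply_cons _ _ _ _ _ (hh i j) (hh p q)
  rw [H.extDeriv_wedge_wedge_starForm h3 h4]
  simp only [ContinuousAlternatingMap.add_apply, ContinuousAlternatingMap.sub_apply,
    ContinuousAlternatingMap.sum_apply, h2w, Finset.sum_const_zero]
  rw [wedge_apply_cons_eq_of_forall _ _ _ _ (hh p q), wedge_apply_cons_eq_of_forall _ _ _ _ (hh i j)]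
  ring

omit H [FiniteDimensional ℝ E] in
theorem exists_ne_of_four_le (hn : 4 ≤ n) (a b c : Fin n) : ∃ i : Fin n, i ≠ a ∧ i ≠ b ∧ i ≠ c := by
  by_contra! h
  have h1 : (Finset.univ : Finset (Fin n)) ⊆ {a, b, c} := by
    intro i _
    simp only [Finset.mem_insert, Finset.mem_singleton]
    by_cases ha : i = a
    · exact Or.inl ha
    by_cases hb : i = b
    · exact Or.inr (Or.inl hb)
    · exact Or.inr (Or.inr (h i ha hb))
  have h2 := Finset.card_le_card h1
  have h3 : Finset.card ({a, b, c} : Finset (Fin n)) ≤ 3 := Finset.card_le_three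
  rw [Finset.card_univ, Fintype.card_fin] at h2
  omega

omit H [FiniteDimensional ℝ E] in
theorem torsionStar_swap (h4 : 4 + k = n) (θ : Fin n → E →L[ℝ] ℝ) (a b c : Fin n) :
    torsionStar θ T h4 a c b = -torsionStar θ T h4 a b c := by
  rw [torsionStar, torsionStar, ← Finset.sum_neg_distrib]
  exact Finset.sum_congr rfl fun l _ => by rw [starForm_swap_four_middle, wedge2_neg_right]

theorem torsionStar_apply_eq_zero (h3 : 3 + (k + 1) = n) (h4 : 4 + k = n)
    (hτ : ∀ i, extDeriv (fun u => tauForm s (θ u) (ϖ u) h3 i) x = 0) {a b c : Fin n}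
    (hab : a ≠ b) (hac : a ≠ c) (f : Fin (k + 2) → Fin n) :
    torsionStar (θ x) T h4 a b c (fun d => e (f d)) = 0 := by
  -- The fourth index makes the pairs (a, i) and (b, c) disjoint; dτ_i is tested on the vertical
  -- vectors `y` and `z` of the corresponding elementary matrices.
  obtain ⟨i, hia, hib, hic⟩ := exists_ne_of_four_le (by omega) a b c
  obtain ⟨y, hy, hy'⟩ := H.exists_vertical _ (skewUnit_antisymm a i)
  obtain ⟨z, hz, hz'⟩ := H.exists_vertical _ (skewUnit_antisymm b c)
  refine eq_zero_of_skewUnit_pair (eta n s) eta_mul_self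
    (fun a b c => torsionStar (θ x) T h4 a b c fun d => e (f d)) ?_ hia.symm hab hac hib hic ?_
  · rw [torsionStar_swap h4]; rfl
  · have h := congrArg (fun β => β (Matrix.vecCons y (Matrix.vecCons z fun d => e (f d)))) (hτ i)
    rw [H.extDeriv_tauForm h3] at h
    simp only [ContinuousAlternatingMap.smul_apply, ContinuousAlternatingMap.add_apply,
      ContinuousAlternatingMap.sum_apply, smul_eq_mul,
      H.extDeriv_wedge_wedge_starForm_apply_cons_cons h3 h4 _ _ _ _ _ _ _ hy hz, hy', hz'] at h
    exact (mul_eq_zero.1 h).resolve_left (by norm_num)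

omit [FiniteDimensional ℝ E] in
-- The form Θ^l ∧ θ*_{abcl} is a combination of the θ*_{ij}. Multiplication by θ^t and then by θ^r
-- turns it into a multiple of the horizontal volume form, whose coefficient is the sum displayed
-- here.
theorem sum_torsion_eq_zero (h4 : 4 + k = n) {a b c : Fin n}
    (h : ∀ f : Fin (k + 2) → Fin n, torsionStar (θ x) T h4 a b c (fun d => e (f d)) = 0)
    (r t : Fin n) :
    ∑ l, (T l b c * (delta t l * delta r a - delta t a * delta r l) -
      T l a c * (delta t l * delta r b - delta t b * delta r l) +
      T l a b * (delta t l * delta r c - delta t c * delta r l) +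
      T l c l * (delta t b * delta r a - delta t a * delta r b) -
      T l b l * (delta t c * delta r a - delta t a * delta r c) +
      T l a l * (delta t c * delta r b - delta t b * delta r c)) = 0 := by
  have h2 : 2 + (k + 1 + 1) = n := by omega
  have h0 : 0 + (k + 1 + 1 + 1 + 1) = n := by omega
  have h1 := fun f => wedge_apply_comp_eq_zero (θ x r)
    (wedge_apply_comp_eq_zero (θ x t) h) f
  obtain ⟨f, hf⟩ := H.dual.exists_starForm_apply_ne_zero h0 (I := ![]) (fun a => a.elim0)
  have h5 := h1 f
  simp only [torsionStar, H.dual.wedge2_starForm_four (H.torsion_antisymm _) h2 h4,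
    wedge_sum_right, wedge_add_right, wedge_sub_right, wedge_smul_right,
    H.dual.wedge_starForm_two (k := k + 2) (by omega) h2,
    H.dual.wedge_starForm_one (k := k + 3) h0 (by omega)] at h5
  simp only [ContinuousAlternatingMap.smul_apply, ContinuousAlternatingMap.add_apply,
      ContinuousAlternatingMap.sub_apply,
      ContinuousAlternatingMap.sum_apply, smul_eq_mul] at h5
  refine (mul_eq_zero.1 (Eq.trans ?_ h5)).resolve_right hf
  rw [Finset.sum_mul]
  exact Finset.sum_congr rfl fun l _ => by ring

theorem torsion_eq_zero (h3 : 3 + (k + 1) = n) (h4 : 4 + k = n)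
    (hτ : ∀ i, extDeriv (fun u => tauForm s (θ u) (ϖ u) h3 i) x = 0) (l a b : Fin n) :
    T l a b = 0 := by
  have hsum {a b c : Fin n} (hab : a ≠ b) (hac : a ≠ c) (r t : Fin n) :=
    H.sum_torsion_eq_zero h4 (fun f => H.torsionStar_apply_eq_zero h3 h4 hτ hab hac f) r t
  have hn : 4 ≤ n := by omega
  have hdiag (l a : Fin n) : T l a a = 0 := by
    have := H.torsion_antisymm l a a
    linarith
  -- For pairwise distinct upper and lower indices, a fourth index `c` and the choice r = c, t = m
  -- leave a single product of Kronecker symbols.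
  have h1 {m a b : Fin n} (hab : a ≠ b) (hma : m ≠ a) (hmb : m ≠ b) : T m a b = 0 := by
    obtain ⟨c, hca, hcb, hcm⟩ := exists_ne_of_four_le hn a b m
    have := hsum hab hca.symm c m
    simp only [delta, hca, hcb, hma, hmb, hcm.symm, if_false, if_true, mul_zero, mul_one, sub_zero,
      zero_mul, add_zero] at this
    simpa using this
  have h2 {a b c : Fin n} (hab : a ≠ b) (hac : a ≠ c) (hbc : b ≠ c) :
      ∑ l, T l c l = T a c a + T b c b := by
    have := hsum hab hac a b
    simp only [delta, hab, hab.symm, hac, hbc, if_false, if_true, mul_zero, mul_one, sub_zero,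
      zero_mul, zero_sub, add_zero] at this
    simp [Finset.sum_add_distrib] at this
    rw [H.torsion_antisymm b b c, H.torsion_antisymm a a c] at this
    linarith
  -- By `h2` and a further index `d`, the component T^b_{cb} is the same for all b ≠ c. The trace is
  -- then n − 1 times this value, while `h2` makes it twice the value; hence n − 3 times the value
  -- is zero.
  have h3' {a c : Fin n} (hac : a ≠ c) : T a c a = 0 := by
    have h5 {b : Fin n} (hbc : b ≠ c) : T b c b = T a c a := by
      by_cases hab : a = b
      · rw [hab]
      obtain ⟨d, hda, hdb, hdc⟩ := exists_ne_of_four_le hn a b c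
      have := h2 hda hdc hac
      have := h2 hdb hdc hbc
      linarith
    obtain ⟨b, hba, hbc, -⟩ := exists_ne_of_four_le hn a c c
    have h6 := h2 hba.symm hac hbc
    have h7 : ∑ l, T l c l = ∑ l, (T a c a - if l = c then T a c a else 0) := by
      refine Finset.sum_congr rfl fun l _ => ?_
      by_cases hl : l = c
      · rw [if_pos hl, hl, hdiag]; ring
      · rw [if_neg hl, h5 hl]; ring
    rw [h7, h5 hbc, Finset.sum_sub_distrib] at h6
    simp at h6
    have h8 : ((n : ℝ) - 3) * T a c a = 0 := by linarith
    have h9 : (4 : ℝ) ≤ n := by exact_mod_cast hn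
    exact (mul_eq_zero.1 h8).resolve_left (by linarith)
  by_cases hab : a = b
  · rw [hab, hdiag]
  by_cases hlb : l = b
  · rw [hlb]; exact h3' (Ne.symm hab)
  by_cases hla : l = a
  · rw [H.torsion_antisymm, hla, h3' hab, neg_zero]
  exact h1 hab hla hlb

omit [FiniteDimensional ℝ E] in
theorem curvature_skew_right (l m p q : Fin n) :
    eta n s m * R l m p q = -(eta n s l * R m l p q) := by
  linear_combination (eta n s l * eta n s m) * H.curvature_skew l m p q -
    (eta n s m * R l m p q) * eta_mul_self (s := s) l -
    (eta n s l * R m l p q) * eta_mul_self (s := s) m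

omit [FiniteDimensional ℝ E] in
-- Full contraction leaves three traces of the curvature: the scalar curvature along θ*_a and two
-- Ricci terms. The latter agree by skewness in each pair of indices, without any Bianchi identity;
-- together they form −2 times the Einstein tensor with one index raised.
theorem wedge2_curvature_starForm (h1 : 1 + (k + 1 + 1) = n) (h3 : 3 + k = n) (a : Fin n) :
    ∑ l, ∑ m, eta n s m • wedge2 (quadForm (θ x) fun p q => 1 / 2 * R l m p q)
        (starForm (θ x) h3 ![a, l, m]) =
      ∑ p, (-2 * (∑ j, eta n s p * R j p j a -
        1 / 2 * delta p a * ∑ j, ∑ l, eta n s l * R j l j l)) • starForm (θ x) h1 ![p] := by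
  simp only [H.dual.wedge2_starForm_three (H.curvature_antisymm _ _) h1 h3]
  ext v
  simp only [ContinuousAlternatingMap.sum_apply, ContinuousAlternatingMap.smul_apply,
    ContinuousAlternatingMap.add_apply, ContinuousAlternatingMap.sub_apply, smul_eq_mul]
  set S : Fin n → ℝ := fun p => starForm (θ x) h1 ![p] v with hS
  have h2 : ∑ p, (-2 * (∑ j, eta n s p * R j p j a -
      1 / 2 * delta p a * ∑ j, ∑ l, eta n s l * R j l j l)) * S p =
      ∑ l, ∑ m, eta n s m * (R l m l m * S a) - ∑ l, ∑ m, eta n s l * (R m l m a * S l) -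
        ∑ l, ∑ m, eta n s m * (R l m l a * S m) := by
    rw [Finset.sum_comm (f := fun l m => eta n s m * (R l m l a * S m))]
    have h4 : ∑ p, delta p a * ((∑ j, ∑ l, eta n s l * R j l j l) * S p) =
        ∑ l, ∑ m, eta n s m * (R l m l m * S a) := by
      rw [sum_delta_mul, Finset.sum_mul]
      refine Finset.sum_congr rfl fun l _ => ?_
      rw [Finset.sum_mul]
      exact Finset.sum_congr rfl fun m _ => by ring
    rw [← h4, ← Finset.sum_sub_distrib, ← Finset.sum_sub_distrib]
    refine Finset.sum_congr rfl fun p _ => ?_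
    have h5 : ∑ m, eta n s p * (R m p m a * S p) = (∑ j, eta n s p * R j p j a) * S p := by
      rw [Finset.sum_mul]
      exact Finset.sum_congr rfl fun m _ => by ring
    rw [h5]
    ring
  rw [h2, ← Finset.sum_sub_distrib, ← Finset.sum_sub_distrib]
  refine Finset.sum_congr rfl fun l _ => ?_
  rw [← Finset.sum_sub_distrib, ← Finset.sum_sub_distrib]
  refine Finset.sum_congr rfl fun m _ => ?_
  linear_combination (-S l) * H.curvature_skew_right l m a m +
    S l * eta n s l * H.curvature_antisymm m l a m + eta n s m * S m * H.curvature_antisymm l m a l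

theorem einstein_eq_zero (h3 : 3 + (k + 1) = n) (h4 : 4 + k = n)
    (hτ : ∀ i, extDeriv (fun u => tauForm s (θ u) (ϖ u) h3 i) x = 0) (a p : Fin n) :
    ∑ j, eta n s p * R j p j a - 1 / 2 * delta p a * ∑ j, ∑ l, eta n s l * R j l j l = 0 := by
  have h0 : 0 + (k + 1 + 1 + 1 + 1) = n := by omega
  have h1 : 1 + (k + 1 + 1 + 1) = n := by omega
  have hW (f : Fin (k + 3) → Fin n) : (∑ l, ∑ m, eta n s m •
      wedge2 (quadForm (θ x) fun p q => 1 / 2 * R l m p q) (starForm (θ x) h3 ![a, l, m]))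
        (fun d => e (f d)) = 0 := by
    obtain ⟨i, hia, -, -⟩ := exists_ne_of_four_le (by omega : 4 ≤ n) a a a
    obtain ⟨y, hy, hy'⟩ := H.exists_vertical _ (skewUnit_antisymm a i)
    have h := congrArg (fun β => β (Matrix.vecCons y fun d => e (f d))) (hτ i)
    rw [H.extDeriv_tauForm h3] at h
    simp only [ContinuousAlternatingMap.smul_apply, ContinuousAlternatingMap.add_apply,
      ContinuousAlternatingMap.sum_apply, smul_eq_mul,
      H.extDeriv_wedge_wedge_starForm_apply_cons h3 h4, hy'] at h
    have h' := (mul_eq_zero.1 h).resolve_left (by norm_num)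
    simp only [ContinuousAlternatingMap.sum_apply, ContinuousAlternatingMap.smul_apply, smul_eq_mul]
    let F (i j a b c : Fin n) : ℝ := eta n s j * wedge2
      (quadForm (θ x) fun p q => 1 / 2 * R i j p q) (starForm (θ x) h3 ![a, b, c])
        (fun d => e (f d))
    have hF (i j a b c : Fin n) : wedge2
      (quadForm (θ x) fun p q => 1 / 2 * R i j p q) (starForm (θ x) h3 ![a, b, c])
        (fun d => e (f d)) = eta n s j * F i j a b c := by
      rw [← mul_assoc, eta_mul_self, one_mul]
    refine sum_eq_zero_of_skewUnit (eta n s) eta_mul_self F ?_ ?_ ?_ hia.symm ?_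
    · intro i j a b c
      simp only [F, wedge2_quadForm, ContinuousAlternatingMap.sum_apply,
        ContinuousAlternatingMap.smul_apply, smul_eq_mul, Finset.mul_sum, ← Finset.sum_neg_distrib]
      refine Finset.sum_congr rfl fun p _ => Finset.sum_congr rfl fun q _ => ?_
      linear_combination (1 / 2 * (wedge (θ x p) (wedge (θ x q) (starForm (θ x) h3 ![a, b, c])))
        (fun d => e (f d))) * H.curvature_skew_right i j p q
    · intro i j a b c
      simp only [F]
      rw [starForm_swap_three_left, wedge2_neg_right, ContinuousAlternatingMap.neg_apply, mul_neg]
    · intro i j a b c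
      simp only [F]
      rw [starForm_swap_three_right, wedge2_neg_right, ContinuousAlternatingMap.neg_apply, mul_neg]
    · simp only [hF] at h'
      exact h'
  rw [H.wedge2_curvature_starForm h1 h3] at hW
  obtain ⟨f, hf⟩ := H.dual.exists_starForm_apply_ne_zero h0 (I := ![]) (fun a => a.elim0)
  -- Multiplication by θ^p extracts the coefficient of θ*_p, as a factor of the horizontal volume
  -- form.
  have h5 := wedge_apply_comp_eq_zero (θ x p) hW f
  simp only [wedge_sum_right, wedge_smul_right, H.dual.wedge_starForm_one h0 h1,
    ContinuousAlternatingMap.sum_apply, ContinuousAlternatingMap.smul_apply, smul_eq_mul,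
    ← mul_assoc, ← Finset.sum_mul] at h5
  have h6 := (mul_eq_zero.1 h5).resolve_right hf
  simp only [mul_comm _ (delta p _)] at h6
  have h7 (f : Fin n → ℝ) : ∑ i, delta p i * f i = f p := by simp [delta]
  rw [h7] at h6
  have h8 := (mul_eq_zero.1 h6).resolve_left (by norm_num)
  exact h8

theorem extDeriv_starForm_of_torsion_eq_zero (h3 : 3 + (k + 1) = n) (h4 : 4 + k = n)
    (hT : ∀ i p q, T i p q = 0) (a b c : Fin n) :
    extDeriv (fun u => starForm (θ u) h3 ![a, b, c]) x =
      ∑ l, (wedge (ϖ x l c) (starForm (θ x) h3 ![a, b, l]) -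
        wedge (ϖ x l b) (starForm (θ x) h3 ![a, c, l]) +
        wedge (ϖ x l a) (starForm (θ x) h3 ![b, c, l])) := by
  rw [H.extDeriv_starForm h3 h4]
  -- The contraction of θ^m with the last index of θ*_{abcl} gives the trace term ϖ^l_l ∧ θ*_{abc},
  -- which disappears because ϖ is skew.
  have h0 (l : Fin n) : ϖ x l l = 0 := by
    have h1 := H.skew l l
    rw [← add_smul] at h1
    refine (smul_eq_zero.1 h1).resolve_left ?_
    unfold eta; split_ifs <;> norm_num
  have h1 : torsionStar (θ x) T h4 a b c = 0 := by
    simp [torsionStar, wedge2_quadForm, hT]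
  rw [h1, zero_sub, ← Finset.sum_neg_distrib]
  refine Finset.sum_congr rfl fun l _ => ?_
  have h2 (m i : Fin n) (γ : E [⋀^Fin (k + 1)]→L[ℝ] ℝ) : wedge (ϖ x l m) (delta m i • γ) =
      if m = i then wedge (ϖ x l i) γ else 0 := by
    unfold delta
    split_ifs with h
    · rw [h, one_smul]
    · rw [zero_smul, wedge_zero_right]
  simp only [H.dual.wedge_starForm_four h3 h4, wedge_add_right, wedge_sub_right, h2,
    Finset.sum_add_distrib, Finset.sum_sub_distrib, Finset.sum_ite_eq', Finset.mem_univ, if_true,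
    h0, wedge_zero_left]
  abel

/-- Without torsion θ* is covariantly constant, so differentiating ω^{jk} ∧ θ*_{ijk} gives Ω^{jk} ∧
θ*_{ijk}, which vanishes by the Einstein equation, and terms quadratic in ω, which are matched with
those of τ_i. -/
theorem extDeriv_sigmaForm_eq (h3 : 3 + (k + 1) = n) (h4 : 4 + k = n)
    (hT : ∀ i p q, T i p q = 0)
    (hR : ∀ a p, ∑ j, eta n s p * R j p j a -
      1 / 2 * delta p a * ∑ j, ∑ l, eta n s l * R j l j l = 0) (i : Fin n) :
    extDeriv (fun u => sigmaForm s (θ u) (ϖ u) h3 i) x = tauForm s (θ x) (ϖ x) h3 i := by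
  have hd (c : ℝ) (j l : Fin n) (I : Fin 3 → Fin n) : DifferentiableAt ℝ (fun u =>
      c • wedge (ϖ u j l) (starForm (θ u) h3 I)) x :=
    ((ContDiffAt.wedge (H.contDiffAt_connection j l)
    (ContDiffAt.starForm H.contDiffAt_solder h3 I)).differentiableAt one_ne_zero).const_smul c
  have hdω (j l : Fin n) := (H.contDiffAt_connection j l).differentiableAt one_ne_zero
  have hds (I : Fin 3 → Fin n) :=
    (ContDiffAt.starForm H.contDiffAt_solder h3 I).differentiableAt one_ne_zero
  have hη (j l : Fin n) : eta n s l • ϖ x j l = -(eta n s j • ϖ x l j) := by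
    have h1 := congrArg (fun α => (eta n s j * eta n s l) • α) (H.skew j l)
    simp only [smul_add, smul_smul, smul_zero] at h1
    rw [eq_neg_iff_add_eq_zero, ← h1]
    congr 2
    · linear_combination (-eta n s l) * eta_mul_self (s := s) j
    · linear_combination (-eta n s j) * eta_mul_self (s := s) l
  have hη' (j l : Fin n) (γ : E [⋀^Fin (k + 1)]→L[ℝ] ℝ) :
      eta n s l • wedge (ϖ x j l) γ = -(eta n s j • wedge (ϖ x l j) γ) := by
    rw [← wedge_smul_left, hη, ← wedge_smul_left, ← wedgeCLM_apply, ← wedgeCLM_apply, map_neg]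
    rfl
  set S : Fin n → Fin n → Fin n → E [⋀^Fin (k + 1)]→L[ℝ] ℝ := fun a b c =>
    starForm (θ x) h3 ![a, b, c] with hS
  have hterm (j l : Fin n) : extDeriv (fun u => wedge (ϖ u j l) (starForm (θ u) h3 ![i, j, l])) x =
      wedge2 (quadForm (θ x) fun p q => 1 / 2 * R j l p q) (S i j l) -
        ∑ m, wedge (ϖ x j m) (wedge (ϖ x m l) (S i j l)) -
        ∑ m, (wedge (ϖ x j l) (wedge (ϖ x m l) (S i j m)) -
          wedge (ϖ x j l) (wedge (ϖ x m j) (S i l m)) +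
          wedge (ϖ x j l) (wedge (ϖ x m i) (S j l m))) := by
    rw [extDeriv_wedge (hdω j l) (hds _), H.wedge2_fderiv_connection,
      H.extDeriv_starForm_of_torsion_eq_zero h3 h4 hT]
    simp only [wedge_sum_right, wedge_add_right, wedge_sub_right, hS]
  -- After relabelling, the second sum of τ_i appears with coefficients −1 (from dω), +1 (from `hA`)
  -- and +1 (from `hB`), in total once. The first sum of τ_i comes from `hC` alone.
  have hA : ∑ j, ∑ l, eta n s l • ∑ m, wedge (ϖ x j l) (wedge (ϖ x m l) (S i j m)) =
      -∑ j, ∑ l, ∑ m, eta n s l • wedge (ϖ x j m) (wedge (ϖ x m l) (S i j l)) := by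
    rw [← Finset.sum_neg_distrib]
    refine Finset.sum_congr rfl fun j _ => ?_
    rw [Finset.sum_comm, ← Finset.sum_neg_distrib]
    refine Finset.sum_congr rfl fun l _ => ?_
    rw [Finset.smul_sum, ← Finset.sum_neg_distrib]
    refine Finset.sum_congr rfl fun m _ => ?_
    rw [← wedge_smul_right, hη', wedge_neg_right, wedge_smul_right]
  have hB : ∑ j, ∑ l, eta n s l • ∑ m, wedge (ϖ x j l) (wedge (ϖ x m j) (S i l m)) =
      ∑ j, ∑ l, ∑ m, eta n s l • wedge (ϖ x j m) (wedge (ϖ x m l) (S i j l)) := by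
    rw [← sum_sum_sum_swap]
    refine Finset.sum_congr rfl fun j _ => Finset.sum_congr rfl fun l _ => ?_
    rw [Finset.smul_sum]
    refine Finset.sum_congr rfl fun m _ => ?_
    rw [wedge_wedge_comm, hS]
    simp only
    rw [starForm_swap_three_right, wedge_neg_right, wedge_neg_right, neg_neg]
  have hC : ∑ j, ∑ l, eta n s l • ∑ m, wedge (ϖ x j l) (wedge (ϖ x m i) (S j l m)) =
      -∑ j, ∑ l, ∑ m, eta n s m • wedge (ϖ x j i) (wedge (ϖ x l m) (S j l m)) := by
    rw [← sum_sum_sum_rotate, ← Finset.sum_neg_distrib]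
    refine Finset.sum_congr rfl fun j _ => ?_
    rw [← Finset.sum_neg_distrib]
    refine Finset.sum_congr rfl fun l _ => ?_
    rw [Finset.smul_sum, ← Finset.sum_neg_distrib]
    refine Finset.sum_congr rfl fun m _ => ?_
    rw [wedge_wedge_comm, smul_neg, hS]
    simp only
    rw [starForm_swap_three_right (θ x) h3 j m l, starForm_swap_three_left (θ x) h3 m j l, neg_neg]
  have hE : ∑ j, ∑ l, eta n s l • wedge2 (quadForm (θ x) fun p q => 1 / 2 * R j l p q) (S i j l)
      = 0 := by
    rw [H.wedge2_curvature_starForm (k := k + 1) (by omega) h3]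
    exact Finset.sum_eq_zero fun p _ => by rw [hR, mul_zero, zero_smul]
  simp only [sigmaForm, tauForm, wedge_smul_left, wedge_smul_right]
  rw [extDeriv_const_smul, extDeriv_sum fun j _ => DifferentiableAt.fun_sum fun l _ => hd _ _ _ _]
  congr 1
  have h1 (j : Fin n) : extDeriv (fun u => ∑ l, eta n s l • wedge (ϖ u j l)
      (starForm (θ u) h3 ![i, j, l])) x = ∑ l, eta n s l •
        extDeriv (fun u => wedge (ϖ u j l) (starForm (θ u) h3 ![i, j, l])) x := by
    rw [extDeriv_sum fun l _ => hd _ _ _ _]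
    exact Finset.sum_congr rfl fun l _ => extDeriv_const_smul _ _ _
  simp only [h1, hterm, smul_sub, smul_add, Finset.sum_sub_distrib, Finset.sum_add_distrib, hA, hB,
    hC, hE]
  rw [show ∑ j, ∑ l, eta n s l • ∑ m, wedge (ϖ x j m) (wedge (ϖ x m l) (S i j l)) =
    ∑ j, ∑ l, ∑ m, eta n s l • wedge (ϖ x j m) (wedge (ϖ x m l) (S i j l)) by
      simp only [Finset.smul_sum]]
  abel

end StructureEquations

end VacuumEquations
end DiffGeom
end

/-! ### A metric connection on the frame bundle in local coordinates. -/

noncomputable section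
namespace DiffGeom
open Set
section LocalConnection
set_option maxSynthPendingDepth 3
open Filter Topology

variable {E : Type*} [NormedAddCommGroup E] [NormedSpace ℝ E] {n s : ℕ}

/-- The operator-valued form with the matrix `(ϖ^i_j)`. -/
def connForm (ϖ : Fin n → Fin n → E →L[ℝ] ℝ) : E →L[ℝ] Model n →L[ℝ] Model n :=
  ∑ i, ∑ j, (ϖ i j).smulRight (Matrix.toEuclideanCLM (𝕜 := ℝ) (Matrix.single i j 1))

theorem toEuclideanCLM_apply (X : Matrix (Fin n) (Fin n) ℝ) (x : Model n) (i : Fin n) :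
    Matrix.toEuclideanCLM (𝕜 := ℝ) X x i = ∑ j, X i j * x j := by
  simp [Matrix.ofLp_toEuclideanCLM, Matrix.mulVec, dotProduct]

theorem toEuclideanCLM_stdVec (X : Matrix (Fin n) (Fin n) ℝ) (i j : Fin n) :
    Matrix.toEuclideanCLM (𝕜 := ℝ) X (stdVec n j) i = X i j := by
  simp [toEuclideanCLM_apply]

theorem connForm_apply (ϖ : Fin n → Fin n → E →L[ℝ] ℝ) (v : E) :
    connForm ϖ v = Matrix.toEuclideanCLM (𝕜 := ℝ) (Matrix.of fun i j => ϖ i j v) := by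
  have h := Matrix.matrix_eq_sum_single (Matrix.of fun i j => ϖ i j v)
  conv_rhs => rw [h]
  simp only [connForm, sum_apply, ContinuousLinearMap.smulRight_apply, map_sum, Matrix.of_apply]
  refine Finset.sum_congr rfl fun i _ => Finset.sum_congr rfl fun j _ => ?_
  rw [← map_smul, Matrix.smul_single]
  simp

theorem connForm_apply_apply (ϖ : Fin n → Fin n → E →L[ℝ] ℝ) (v : E) (x : Model n) (i : Fin n) :
    connForm ϖ v x i = ∑ j, ϖ i j v * x j := by
  rw [connForm_apply, toEuclideanCLM_apply]; rfl

theorem _root_.ContDiffAt.connForm {ϖ : E → Fin n → Fin n → E →L[ℝ] ℝ} {u : E} {k : WithTop ℕ∞}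
    (h : ∀ i j, ContDiffAt ℝ k (fun u => ϖ u i j) u) :
    ContDiffAt ℝ k (fun u => DiffGeom.connForm (ϖ u)) u := by
  unfold DiffGeom.connForm
  refine ContDiffAt.sum fun i _ => ContDiffAt.sum fun j _ => ?_
  exact (h i j).smulRight contDiffAt_const

/-- A connection on the bundle of frames in local coordinates: `Y` is the base point, `B` the matrix
of the frame, `ϖ` the connection form and `G` the matrix of the metric. -/
structure IsAdaptedAt (s : ℕ) (Y : E → Model n) (B : E → Model n →L[ℝ] Model n)
    (ϖ : E → Fin n → Fin n → E →L[ℝ] ℝ) (G : Model n → Matrix (Fin n) (Fin n) ℝ) (u : E) :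
    Prop where
  contDiffAt_base : ContDiffAt ℝ 4 Y u
  contDiffAt_frame : ContDiffAt ℝ 4 B u
  contDiffAt_form (i j) : ContDiffAt ℝ 4 (fun u => ϖ u i j) u
  isInvertible : (B u).IsInvertible
  skew (i j) : eta n s i • ϖ u i j + eta n s j • ϖ u j i = 0
  gram (i j) : ∑ μ, ∑ ν, G (Y u) μ ν * B u (stdVec n i) μ * B u (stdVec n j) ν =
    etaMatrix n s i j
  eq_zero (v) : fderiv ℝ Y u v = 0 → fderiv ℝ B u v = 0 → v = 0
  vertical (v) : fderiv ℝ Y u v = 0 → ∃ X : Matrix (Fin n) (Fin n) ℝ, (∀ i j, ϖ u i j v = X i j) ∧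
    ∃ γ : ℝ → E, γ 0 = u ∧ HasDerivAt γ v 0 ∧ ∀ᶠ t in 𝓝 (0 : ℝ),
      IsUnit (NormedSpace.exp (t • X)).det ∧
      B (γ t) = (B u).comp (Matrix.toEuclideanCLM (𝕜 := ℝ) (NormedSpace.exp (t • X))) ∧
      ∀ w, ∃ w', fderiv ℝ Y (γ t) w' = fderiv ℝ Y u w ∧
        fderiv ℝ B (γ t) w' =
          (fderiv ℝ B u w).comp (Matrix.toEuclideanCLM (𝕜 := ℝ) (NormedSpace.exp (t • X))) ∧
        ∀ i j, ϖ (γ t) i j w' =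
          ((NormedSpace.exp (t • X))⁻¹ * (Matrix.of fun k l => ϖ u k l w) *
            NormedSpace.exp (t • X)) i j

/-- The map `v ↦ (DY v, (ϖ^i_j v)_{j < i})`. -/
def splitting (Y : E → Model n) (ϖ : E → Fin n → Fin n → E →L[ℝ] ℝ) (u : E) : E →L[ℝ] OModel n :=
  (fderiv ℝ Y u).prod (ContinuousLinearMap.pi fun p => ϖ u p.1.1 p.1.2)

/-- The horizontal lift of the vectors of the base. -/
def horizontalLift (Y : E → Model n) (ϖ : E → Fin n → Fin n → E →L[ℝ] ℝ) (u : E) :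
    Model n →L[ℝ] E :=
  (splitting Y ϖ u).inverse.comp (ContinuousLinearMap.inl ℝ _ _)

/-- The coefficients of the covariant derivative in the coordinates of the base. -/
def baseForm (Y : E → Model n) (B : E → Model n →L[ℝ] Model n)
    (ϖ : E → Fin n → Fin n → E →L[ℝ] ℝ) (u : E) : Model n →L[ℝ] Model n →L[ℝ] Model n :=
  -(((ContinuousLinearMap.compL ℝ (Model n) (Model n) (Model n)).flip (B u).inverse).comp
    ((fderiv ℝ B u).comp (horizontalLift Y ϖ u)))

theorem toEuclideanCLM_exp (X : Matrix (Fin n) (Fin n) ℝ) :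
    Matrix.toEuclideanCLM (𝕜 := ℝ) (NormedSpace.exp X) =
      NormedSpace.exp (Matrix.toEuclideanCLM (𝕜 := ℝ) X) := by
  let _ : NormedRing (Matrix (Fin n) (Fin n) ℝ) := Matrix.linftyOpNormedRing
  let _ : NormedAlgebra ℝ (Matrix (Fin n) (Fin n) ℝ) := Matrix.linftyOpNormedAlgebra
  let _ : NormedAlgebra ℚ (Matrix (Fin n) (Fin n) ℝ) := NormedAlgebra.restrictScalars ℚ ℝ _
  have : CompleteSpace (Matrix (Fin n) (Fin n) ℝ) := FiniteDimensional.complete ℝ _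
  have hL : Continuous (Matrix.toEuclideanCLM (𝕜 := ℝ) (n := Fin n)) :=
    LinearMap.continuous_of_finiteDimensional
      (Matrix.toEuclideanCLM (𝕜 := ℝ) (n := Fin n)).toAlgEquiv.toLinearMap
  exact NormedSpace.map_exp (Matrix.toEuclideanCLM (𝕜 := ℝ) (n := Fin n)) hL X

theorem hasDerivAt_exp_smul (X : Matrix (Fin n) (Fin n) ℝ) :
    HasDerivAt (fun t : ℝ => Matrix.toEuclideanCLM (𝕜 := ℝ) (NormedSpace.exp (t • X)))
      (Matrix.toEuclideanCLM (𝕜 := ℝ) X) 0 := by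
  simp_rw [toEuclideanCLM_exp, map_smul]
  have := hasDerivAt_exp_smul_const (𝕂 := ℝ) (Matrix.toEuclideanCLM (𝕜 := ℝ) X) (0 : ℝ)
  rwa [zero_smul, NormedSpace.exp_zero, one_mul] at this

namespace IsAdaptedAt

variable {Y : E → Model n} {B : E → Model n →L[ℝ] Model n}
  {ϖ : E → Fin n → Fin n → E →L[ℝ] ℝ} {G : Model n → Matrix (Fin n) (Fin n) ℝ} {u : E}

theorem fderiv_frame_of_vertical (H : IsAdaptedAt s Y B ϖ G u) {v : E}
    (hv : fderiv ℝ Y u v = 0) : fderiv ℝ B u v = (B u).comp (connForm (ϖ u) v) := by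
  obtain ⟨X, hX, γ, h0, hγ, ht⟩ := H.vertical v hv
  have h1 : HasDerivAt (fun t => B (γ t)) (fderiv ℝ B u v) 0 := by
    have hB := (H.contDiffAt_frame.differentiableAt (by norm_num)).hasFDerivAt
    rw [← h0] at hB ⊢
    exact hB.comp_hasDerivAt 0 hγ
  have h2 : HasDerivAt (fun t => B (γ t))
      ((B u).comp (Matrix.toEuclideanCLM (𝕜 := ℝ) X)) 0 := by
    have h3 := ((ContinuousLinearMap.compL ℝ (Model n) (Model n) (Model n) (B u)).hasFDerivAt).comp_hasDerivAt
      (0 : ℝ) (hasDerivAt_exp_smul X)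
    refine h3.congr_of_eventuallyEq ?_
    filter_upwards [ht] with t ht
    exact ht.2.1
  rw [h1.unique h2, connForm_apply]
  congr 2
  ext i j
  exact (hX i j).symm

theorem form_eq_zero (H : IsAdaptedAt s Y B ϖ G u) (v : E)
    (h2 : ∀ i j, j < i → ϖ u i j v = 0) (i j : Fin n) : ϖ u i j v = 0 := by
  have h3 (i j : Fin n) : eta n s i * ϖ u i j v + eta n s j * ϖ u j i v = 0 :=
    congrArg (fun L => L v) (H.skew i j)
  have hη (i : Fin n) : eta n s i ≠ 0 := fun h => by
    have := eta_mul_self (s := s) i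
    rw [h] at this; norm_num at this
  rcases lt_trichotomy i j with h | h | h
  · have := h3 i j
    rw [h2 j i h, mul_zero, add_zero] at this
    exact (mul_eq_zero.1 this).resolve_left (hη i)
  · subst h
    have := h3 i i
    have : eta n s i * ϖ u i i v = 0 := by linarith
    exact (mul_eq_zero.1 this).resolve_left (hη i)
  · exact h2 i j h

/-- A vertical vector annihilated by ϖ does not move the frame matrix either, and (Y, B) is an
immersion. -/
theorem injective_splitting (H : IsAdaptedAt s Y B ϖ G u) :
    Function.Injective (splitting Y ϖ u) := by
  rw [injective_iff_map_eq_zero]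
  intro v hv
  have h1 : fderiv ℝ Y u v = 0 := congrArg Prod.fst hv
  have h4 := H.form_eq_zero v fun i j hij => congrFun (congrArg Prod.snd hv) ⟨(i, j), hij⟩
  refine H.eq_zero v h1 ?_
  rw [H.fderiv_frame_of_vertical h1]
  have : connForm (ϖ u) v = 0 := by
    rw [connForm_apply]
    have h5 : (Matrix.of fun i j => ϖ u i j v) = 0 := by ext i j; exact h4 i j
    rw [h5, map_zero]
  rw [this, ContinuousLinearMap.comp_zero]

variable [FiniteDimensional ℝ E]

theorem isInvertible_splitting (H : IsAdaptedAt s Y B ϖ G u)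
    (hE : Module.finrank ℝ E = Module.finrank ℝ (OModel n)) :
    (splitting Y ϖ u).IsInvertible :=
  ⟨(LinearEquiv.ofInjectiveOfFinrankEq (splitting Y ϖ u : E →ₗ[ℝ] OModel n)
    H.injective_splitting hE).toContinuousLinearEquiv, by ext v <;> rfl⟩

section
variable (hE : Module.finrank ℝ E = Module.finrank ℝ (OModel n)) (H : IsAdaptedAt s Y B ϖ G u)
include hE H

theorem splitting_horizontalLift (x : Model n) :
    splitting Y ϖ u (horizontalLift Y ϖ u x) = (x, 0) :=
  (H.isInvertible_splitting hE).self_apply_inverse _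

theorem fderiv_base_horizontalLift (x : Model n) :
    fderiv ℝ Y u (horizontalLift Y ϖ u x) = x :=
  congrArg Prod.fst (H.splitting_horizontalLift hE x)

theorem contDiffAt_horizontalLift : ContDiffAt ℝ 3 (horizontalLift Y ϖ) u := by
  have h1 : ContDiffAt ℝ 3 (splitting Y ϖ) u := by
    have hY : ContDiffAt ℝ 3 (fderiv ℝ Y) u := H.contDiffAt_base.fderiv_right (by norm_num)
    have h2 : splitting Y ϖ = fun u => (ContinuousLinearMap.inl ℝ (Model n) _).comp (fderiv ℝ Y u) +
        ∑ p, (ϖ u p.1.1 p.1.2).smulRight ((0, Pi.single p 1) : OModel n) := by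
      funext u
      ext v
      · simp [splitting, Prod.fst_sum]
      · simp [splitting, Prod.snd_sum, Pi.single_apply]
    rw [h2]
    refine (contDiffAt_const.clm_comp hY).add (ContDiffAt.sum fun p _ => ?_)
    exact ((H.contDiffAt_form _ _).of_le (by norm_num)).smulRight contDiffAt_const
  have h3 : ContDiffAt ℝ 3 (fun u => (splitting Y ϖ u).inverse) u :=
    ((H.isInvertible_splitting hE).contDiffAt_map_inverse).comp u h1
  exact h3.clm_comp contDiffAt_const

theorem contDiffAt_baseForm : ContDiffAt ℝ 3 (baseForm Y B ϖ) u := by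
  have hB : ContDiffAt ℝ 3 (fderiv ℝ B) u := H.contDiffAt_frame.fderiv_right (by norm_num)
  have hA : ContDiffAt ℝ 3 (fun u => (B u).inverse) u :=
    (H.isInvertible.contDiffAt_map_inverse).comp u (H.contDiffAt_frame.of_le (by norm_num))
  have h := H.contDiffAt_horizontalLift hE
  refine ContDiffAt.neg (ContDiffAt.clm_comp ?_ (hB.clm_comp h))
  exact ContDiffAt.comp u
    (ContinuousLinearMap.compL ℝ (Model n) (Model n) (Model n)).flip.contDiff.contDiffAt hA

theorem connForm_horizontalLift (x : Model n) : connForm (ϖ u) (horizontalLift Y ϖ u x) = 0 := by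
  have h := H.form_eq_zero (horizontalLift Y ϖ u x) fun i j hij =>
    congrFun (congrArg Prod.snd (H.splitting_horizontalLift hE x)) ⟨(i, j), hij⟩
  rw [connForm_apply]
  have h5 : (Matrix.of fun i j => ϖ u i j (horizontalLift Y ϖ u x)) = 0 := by ext i j; exact h i j
  rw [h5, map_zero]

/-- The identity for which `baseForm` is designed. Once the horizontal lift of DY v is subtracted
from `v`, a vertical vector remains, along which DB is B ϖ; on the lift itself DB is −Γ B by
definition of Γ. -/
theorem fderiv_frame (v : E) : fderiv ℝ B u v =
    (B u).comp (connForm (ϖ u) v) - (baseForm Y B ϖ u (fderiv ℝ Y u v)).comp (B u) := by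
  set x := fderiv ℝ Y u v with hx
  have h1 : fderiv ℝ Y u (v - horizontalLift Y ϖ u x) = 0 := by
    rw [map_sub, H.fderiv_base_horizontalLift hE, sub_self]
  have h2 := H.fderiv_frame_of_vertical h1
  rw [map_sub, map_sub, H.connForm_horizontalLift hE, sub_zero] at h2
  have h3 : (baseForm Y B ϖ u x).comp (B u) = - fderiv ℝ B u (horizontalLift Y ϖ u x) := by
    ext1 z
    simp [baseForm, H.isInvertible.inverse_apply_self]
  rw [h3, ← h2]
  abel

end
end IsAdaptedAt
end LocalConnection
end DiffGeom
end

/-! ### The structure equations in operator form. -/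

noncomputable section
namespace DiffGeom
open Set
section LocalCurvature
set_option maxSynthPendingDepth 3
open Filter Topology

variable {E : Type*} [NormedAddCommGroup E] [NormedSpace ℝ E] [FiniteDimensional ℝ E] {n s : ℕ}

/-- The solder form in local coordinates. -/
def solderForm (Y : E → Model n) (B : E → Model n →L[ℝ] Model n) (u : E) : E →L[ℝ] Model n :=
  (B u).inverse.comp (fderiv ℝ Y u)

variable {Y : E → Model n} {B : E → Model n →L[ℝ] Model n}
  {ϖ : E → Fin n → Fin n → E →L[ℝ] ℝ} {G : Model n → Matrix (Fin n) (Fin n) ℝ} {u : E}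

namespace IsAdaptedAt

omit [FiniteDimensional ℝ E] in
theorem frame_solderForm (H : IsAdaptedAt s Y B ϖ G u) (v : E) :
    B u (solderForm Y B u v) = fderiv ℝ Y u v :=
  H.isInvertible.self_apply_inverse _

omit [FiniteDimensional ℝ E] in
theorem contDiffAt_solderForm (H : IsAdaptedAt s Y B ϖ G u) : ContDiffAt ℝ 3 (solderForm Y B) u :=
  ((H.isInvertible.contDiffAt_map_inverse).comp u (H.contDiffAt_frame.of_le (by norm_num))).clm_comp
    (H.contDiffAt_base.fderiv_right (by norm_num))

section
variable (hE : Module.finrank ℝ E = Module.finrank ℝ (OModel n))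
  (hH : ∀ᶠ u in 𝓝 u, IsAdaptedAt s Y B ϖ G u)
include hE hH

/-- Right translation by k = exp(tX) takes a horizontal lift at `u` to a vector at `γ t` with the
same projection. That vector is still horizontal, since its connection value is a conjugate of zero.
The translation multiplies both B and DB by k on the right, so k cancels in DB ∘ B⁻¹: Γ is constant
along the curve. -/
theorem fderiv_baseForm_of_vertical {v : E} (hv : fderiv ℝ Y u v = 0) :
    fderiv ℝ (baseForm Y B ϖ) u v = 0 := by
  have H := hH.self_of_nhds
  obtain ⟨X, hX, γ, h0, hγ, ht⟩ := H.vertical v hv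
  have h1 : HasDerivAt (fun t => baseForm Y B ϖ (γ t)) (fderiv ℝ (baseForm Y B ϖ) u v) 0 := by
    have hB := ((H.contDiffAt_baseForm hE).differentiableAt (by norm_num)).hasFDerivAt
    rw [← h0] at hB ⊢
    exact hB.comp_hasDerivAt 0 hγ
  have hγc : Tendsto γ (𝓝 0) (𝓝 u) := by
    have := hγ.continuousAt.tendsto
    rwa [h0] at this
  refine h1.unique ((hasDerivAt_const (0 : ℝ) (baseForm Y B ϖ u)).congr_of_eventuallyEq ?_)
  filter_upwards [ht, hγc.eventually hH] with t ht hHt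
  obtain ⟨hdet, hB, hw⟩ := ht
  refine ContinuousLinearMap.ext fun x => ?_
  set k := NormedSpace.exp (t • X) with hk
  set K := Matrix.toEuclideanCLM (𝕜 := ℝ) k with hK
  obtain ⟨w', hY', hB', hϖ'⟩ := hw (horizontalLift Y ϖ u x)
  rw [H.fderiv_base_horizontalLift hE] at hY'
  have e1 := hHt.fderiv_frame hE w'
  have e2 := H.fderiv_frame hE (horizontalLift Y ϖ u x)
  rw [H.fderiv_base_horizontalLift hE, H.connForm_horizontalLift hE] at e2
  have e3 : connForm (ϖ (γ t)) w' = 0 := by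
    have h3 := H.connForm_horizontalLift hE x
    rw [connForm_apply] at h3 ⊢
    have h4 : (Matrix.of fun k l => ϖ u k l (horizontalLift Y ϖ u x)) = 0 := by
      simpa using h3
    have h5 : (Matrix.of fun i j => ϖ (γ t) i j w') = 0 := by
      ext i j
      have := hϖ' i j
      rw [h4] at this
      simpa using this
    rw [h5, map_zero]
  rw [hB', hY', e3, hB, e2] at e1
  have hKK : K * Matrix.toEuclideanCLM (𝕜 := ℝ) k⁻¹ = 1 := by
    rw [hK, ← map_mul, Matrix.mul_nonsing_inv _ hdet, map_one]
  have hBB : B u * (B u).inverse = 1 := H.isInvertible.self_comp_inverse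
  change (B u * 0 - baseForm Y B ϖ u x * B u) * K =
    B u * K * 0 - baseForm Y B ϖ (γ t) x * (B u * K) at e1
  have e4 := congrArg (fun Z => Z * (Matrix.toEuclideanCLM (𝕜 := ℝ) k⁻¹) * (B u).inverse) e1
  simp only [mul_zero, zero_sub, neg_mul, mul_assoc, neg_inj] at e4
  rw [← mul_assoc K, hKK, one_mul, hBB, mul_one, mul_one] at e4
  exact e4.symm

/-- Differentiate B θ = DY and antisymmetrize: the second derivative of Y cancels. The torsion is
the antisymmetric part of Γ, read in the frame. -/
theorem fderiv_solderForm (v w : E) :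
    fderiv ℝ (solderForm Y B) u w v - fderiv ℝ (solderForm Y B) u v w =
      (B u).inverse (baseForm Y B ϖ u (fderiv ℝ Y u w) (fderiv ℝ Y u v) -
        baseForm Y B ϖ u (fderiv ℝ Y u v) (fderiv ℝ Y u w)) -
      (connForm (ϖ u) w (solderForm Y B u v) - connForm (ϖ u) v (solderForm Y B u w)) := by
  have H := hH.self_of_nhds
  have hB := (H.contDiffAt_frame.differentiableAt (by norm_num)).hasFDerivAt
  have hθ := (H.contDiffAt_solderForm.differentiableAt (by norm_num)).hasFDerivAt
  have hY : DifferentiableAt ℝ (fderiv ℝ Y) u :=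
    ContDiffAt.differentiableAt (H.contDiffAt_base.fderiv_right (m := 3) (by norm_num)) (by norm_num)
  have hsymm : fderiv ℝ (fderiv ℝ Y) u w v = fderiv ℝ (fderiv ℝ Y) u v w :=
    H.contDiffAt_base.isSymmSndFDerivAt (by rw [minSmoothness_of_isRCLikeNormedField]; norm_num) w v
  have key (v w : E) : fderiv ℝ (fderiv ℝ Y) u w v =
      B u (fderiv ℝ (solderForm Y B) u w v) + fderiv ℝ B u w (solderForm Y B u v) := by
    have h1 := hB.clm_apply (hθ.clm_apply (hasFDerivAt_const v u))
    have h2 := hY.hasFDerivAt.clm_apply (hasFDerivAt_const v u)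
    have h3 := h2.congr_of_eventuallyEq
      (f₁ := fun u => B u (solderForm Y B u v)) (hH.mono fun u H => H.frame_solderForm v)
    have h4 := congrArg (fun L => L w) (h3.unique h1)
    simpa using h4
  have k1 := key v w
  have k2 := key w v
  rw [hsymm, k2, H.fderiv_frame hE, H.fderiv_frame hE] at k1
  apply H.isInvertible.injective
  simp only [map_sub, H.isInvertible.self_apply_inverse]
  simp only [sub_apply, ContinuousLinearMap.comp_apply,
    H.frame_solderForm] at k1
  generalize B u (fderiv ℝ (solderForm Y B) u w v) = a at *
  generalize B u (fderiv ℝ (solderForm Y B) u v w) = b at *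
  rw [← sub_eq_zero] at k1 ⊢
  rw [← neg_eq_zero, ← k1]
  abel

/-- Differentiate DB = B ϖ − Γ(DY) B and antisymmetrize: the second derivatives of B and Y cancel,
and the curvature dΓ + Γ ∧ Γ remains, conjugated by B. -/
theorem fderiv_connForm (v w : E) :
    fderiv ℝ (fun u => connForm (ϖ u)) u w v - fderiv ℝ (fun u => connForm (ϖ u)) u v w =
      (B u).inverse * (fderiv ℝ (baseForm Y B ϖ) u w (fderiv ℝ Y u v) -
        fderiv ℝ (baseForm Y B ϖ) u v (fderiv ℝ Y u w) +
        (baseForm Y B ϖ u (fderiv ℝ Y u w) * baseForm Y B ϖ u (fderiv ℝ Y u v) -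
        baseForm Y B ϖ u (fderiv ℝ Y u v) * baseForm Y B ϖ u (fderiv ℝ Y u w))) * B u -
      (connForm (ϖ u) w * connForm (ϖ u) v - connForm (ϖ u) v * connForm (ϖ u) w) := by
  have H := hH.self_of_nhds
  have hB := (H.contDiffAt_frame.differentiableAt (by norm_num)).hasFDerivAt
  have hB2 : DifferentiableAt ℝ (fderiv ℝ B) u :=
    ContDiffAt.differentiableAt (H.contDiffAt_frame.fderiv_right (m := 3) (by norm_num)) (by norm_num)
  have hY : DifferentiableAt ℝ (fderiv ℝ Y) u :=
    ContDiffAt.differentiableAt (H.contDiffAt_base.fderiv_right (m := 3) (by norm_num)) (by norm_num)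
  have hC := ((H.contDiffAt_baseForm hE).differentiableAt (by norm_num)).hasFDerivAt
  have hW := ((ContDiffAt.connForm H.contDiffAt_form).differentiableAt (by norm_num)).hasFDerivAt
  have hsymm : fderiv ℝ (fderiv ℝ Y) u w v = fderiv ℝ (fderiv ℝ Y) u v w :=
    H.contDiffAt_base.isSymmSndFDerivAt (by rw [minSmoothness_of_isRCLikeNormedField]; norm_num) w v
  have hsymmB : fderiv ℝ (fderiv ℝ B) u w v = fderiv ℝ (fderiv ℝ B) u v w :=
    H.contDiffAt_frame.isSymmSndFDerivAt (by rw [minSmoothness_of_isRCLikeNormedField]; norm_num) w v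
  have key (v w : E) : fderiv ℝ (fderiv ℝ B) u w v =
      B u * (fderiv ℝ (fun u => connForm (ϖ u)) u w v) + fderiv ℝ B u w * connForm (ϖ u) v -
      (baseForm Y B ϖ u (fderiv ℝ Y u v) * fderiv ℝ B u w +
       (fderiv ℝ (baseForm Y B ϖ) u w (fderiv ℝ Y u v) +
        baseForm Y B ϖ u (fderiv ℝ (fderiv ℝ Y) u w v)) * B u) := by
    have h1 := (hB.clm_comp (hW.clm_apply (hasFDerivAt_const v u))).sub
      ((hC.clm_apply (hY.hasFDerivAt.clm_apply (hasFDerivAt_const v u))).clm_comp hB)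
    have h2 := hB2.hasFDerivAt.clm_apply (hasFDerivAt_const v u)
    have h3 := h1.congr_of_eventuallyEq
      (f₁ := fun u => fderiv ℝ B u v) (hH.mono fun u H => H.fderiv_frame hE v)
    have h4 := congrArg (fun L => L w) (h2.unique h3)
    refine Eq.trans ?_ (h4.trans ?_)
    · simp
    · ext1 x
      simp
      abel
  have k1 := key v w
  have k2 := key w v
  rw [hsymmB, k2, hsymm, H.fderiv_frame hE, H.fderiv_frame hE] at k1
  have hAB : (B u).inverse * B u = 1 := H.isInvertible.inverse_comp_self
  have e (Z : Model n →L[ℝ] Model n) : Z = (B u).inverse * (B u * Z) := by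
    rw [← mul_assoc, hAB, one_mul]
  have hBA : B u * (B u).inverse = 1 := H.isInvertible.self_comp_inverse
  rw [e (_ - _), e (connForm (ϖ u) w * _ - _), mul_assoc, ← mul_sub]
  congr 1
  simp only [← ContinuousLinearMap.mul_def] at k1
  rw [← sub_eq_zero] at k1 ⊢
  rw [← neg_eq_zero, ← k1]
  noncomm_ring
end
end IsAdaptedAt
end LocalCurvature
end DiffGeom
end

/-! ### The structure equations in components. -/

noncomputable section
namespace DiffGeom
open Set
section LocalStructureEquations
set_option maxSynthPendingDepth 3
open Filter Topology

variable {E : Type*} [NormedAddCommGroup E] [NormedSpace ℝ E] {n s : ℕ}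

theorem sum_smul_stdVec (x : Model n) : ∑ i, x i • stdVec n i = x := by
  have := (EuclideanSpace.basisFun (Fin n) ℝ).sum_repr x
  simpa using this

theorem bilinear_eq_sum (f : Model n → Model n → ℝ) (h1 : ∀ y, IsLinearMap ℝ fun x => f x y)
    (h2 : ∀ x, IsLinearMap ℝ (f x)) (x y : Model n) :
    f x y = ∑ p, ∑ q, f (stdVec n p) (stdVec n q) * (x p * y q) := by
  let L : Model n →ₗ[ℝ] Model n →ₗ[ℝ] ℝ := LinearMap.mk₂ ℝ f (fun a b y => (h1 y).map_add a b)
    (fun c a y => (h1 y).map_smul c a) (fun x => (h2 x).map_add) (fun c x => (h2 x).map_smul c)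
  have h : L x y = L (∑ p, x p • stdVec n p) (∑ q, y q • stdVec n q) := by
    rw [sum_smul_stdVec, sum_smul_stdVec]
  change L x y = ∑ p, ∑ q, L (stdVec n p) (stdVec n q) * (x p * y q)
  rw [h]
  simp only [map_sum, map_smul, LinearMap.sum_apply, LinearMap.smul_apply, smul_eq_mul]
  rw [Finset.sum_comm]
  refine Finset.sum_congr rfl fun p _ => ?_
  rw [Finset.mul_sum]
  exact Finset.sum_congr rfl fun q _ => by ring

/-- The components of the solder form in local coordinates. -/
def solderCoord (Y : E → Model n) (B : E → Model n →L[ℝ] Model n) (u : E) (i : Fin n) : E →L[ℝ] ℝ :=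
  (EuclideanSpace.proj i).comp (solderForm Y B u)

/-- The components of the torsion. -/
def torsionCoeff (Y : E → Model n) (B : E → Model n →L[ℝ] Model n)
    (ϖ : E → Fin n → Fin n → E →L[ℝ] ℝ) (u : E) (i p q : Fin n) : ℝ :=
  (B u).inverse (baseForm Y B ϖ u (B u (stdVec n p)) (B u (stdVec n q)) -
    baseForm Y B ϖ u (B u (stdVec n q)) (B u (stdVec n p))) i

/-- The curvature in the coordinates of the base. -/
def baseCurvature (Y : E → Model n) (B : E → Model n →L[ℝ] Model n)
    (ϖ : E → Fin n → Fin n → E →L[ℝ] ℝ) (u : E) (x y : Model n) : Model n →L[ℝ] Model n :=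
  fderiv ℝ (baseForm Y B ϖ) u (horizontalLift Y ϖ u x) y -
    fderiv ℝ (baseForm Y B ϖ) u (horizontalLift Y ϖ u y) x +
    (baseForm Y B ϖ u x * baseForm Y B ϖ u y - baseForm Y B ϖ u y * baseForm Y B ϖ u x)

/-- The components of the curvature. -/
def curvatureCoeff (Y : E → Model n) (B : E → Model n →L[ℝ] Model n)
    (ϖ : E → Fin n → Fin n → E →L[ℝ] ℝ) (u : E) (i j p q : Fin n) : ℝ :=
  (B u).inverse (baseCurvature Y B ϖ u (B u (stdVec n p)) (B u (stdVec n q))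
    (B u (stdVec n j))) i

variable {Y : E → Model n} {B : E → Model n →L[ℝ] Model n}
  {ϖ : E → Fin n → Fin n → E →L[ℝ] ℝ} {G : Model n → Matrix (Fin n) (Fin n) ℝ} {u : E}

theorem baseCurvature_antisymm (x y : Model n) :
    baseCurvature Y B ϖ u x y = -baseCurvature Y B ϖ u y x := by
  unfold baseCurvature
  abel

namespace IsAdaptedAt

variable [FiniteDimensional ℝ E]

section
variable (hE : Module.finrank ℝ E = Module.finrank ℝ (OModel n))
include hE

theorem form_horizontalLift (H : IsAdaptedAt s Y B ϖ G u) (x : Model n) (i j : Fin n) :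
    ϖ u i j (horizontalLift Y ϖ u x) = 0 := by
  have h := H.connForm_horizontalLift hE x
  have h2 := toEuclideanCLM_stdVec (Matrix.of fun i j => ϖ u i j (horizontalLift Y ϖ u x)) i j
  rw [← connForm_apply, h] at h2
  exact h2.symm

theorem exists_vertical (H : IsAdaptedAt s Y B ϖ G u) (Z : Fin n → Fin n → ℝ)
    (hZ : ∀ i j, Z i j = -Z j i) :
    ∃ v, fderiv ℝ Y u v = 0 ∧ ∀ i j, ϖ u i j v = Z i j * eta n s j := by
  obtain ⟨v, hv⟩ := (H.isInvertible_splitting hE).surjective (0, fun p => Z p.1.1 p.1.2 * eta n s p.1.2)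
  refine ⟨v, congrArg Prod.fst hv, fun i j => ?_⟩
  have h2 (i j : Fin n) (hij : j < i) : ϖ u i j v = Z i j * eta n s j :=
    congrFun (congrArg Prod.snd hv) ⟨(i, j), hij⟩
  have h3 (i j : Fin n) : eta n s i * ϖ u i j v + eta n s j * ϖ u j i v = 0 :=
    congrArg (fun L => L v) (H.skew i j)
  have hη (i : Fin n) : eta n s i ≠ 0 := fun h => by
    have := eta_mul_self (s := s) i
    rw [h] at this; norm_num at this
  rcases lt_trichotomy i j with h | h | h
  · have h4 := h3 i j
    rw [h2 j i h, hZ j i] at h4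
    apply mul_left_cancel₀ (hη i)
    linear_combination h4
  · subst h
    have h4 := h3 i i
    have h5 := hZ i i
    have h6 : Z i i = 0 := by linarith
    rw [h6, zero_mul]
    apply mul_left_cancel₀ (hη i)
    linarith
  · exact h2 i j h

variable (hH : ∀ᶠ u in 𝓝 u, IsAdaptedAt s Y B ϖ G u)
include hH

/-- Since Γ is constant along vertical directions, DΓ sees only the horizontal part of `v`. This is
what makes the curvature quadratic in the solder forms. -/
theorem fderiv_baseForm_eq (v : E) : fderiv ℝ (baseForm Y B ϖ) u v =
    fderiv ℝ (baseForm Y B ϖ) u (horizontalLift Y ϖ u (fderiv ℝ Y u v)) := by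
  have H := hH.self_of_nhds
  rw [← sub_eq_zero, ← map_sub]
  refine IsAdaptedAt.fderiv_baseForm_of_vertical hE hH ?_
  rw [map_sub, H.fderiv_base_horizontalLift hE, sub_self]

theorem fderiv_solderCoord (i : Fin n) (v w : E) :
    fderiv ℝ (fun u => solderCoord Y B u i) u v w - fderiv ℝ (fun u => solderCoord Y B u i) u w v =
      ∑ p, ∑ q, torsionCoeff Y B ϖ u i p q * (solderCoord Y B u p v * solderCoord Y B u q w) -
      ∑ j, (ϖ u i j v * solderCoord Y B u j w - ϖ u i j w * solderCoord Y B u j v) := by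
  have H := hH.self_of_nhds
  have hθ := (H.contDiffAt_solderForm.differentiableAt (by norm_num)).hasFDerivAt
  have h1 : HasFDerivAt (fun u => solderCoord Y B u i)
      ((ContinuousLinearMap.compL ℝ E (Model n) ℝ (EuclideanSpace.proj i)).comp
        (fderiv ℝ (solderForm Y B) u)) u :=
    (ContinuousLinearMap.compL ℝ E (Model n) ℝ (EuclideanSpace.proj i)).hasFDerivAt.comp u hθ
  rw [h1.fderiv]
  have h2 := congrArg (fun x : Model n => x i) (IsAdaptedAt.fderiv_solderForm hE hH w v)
  refine Eq.trans ?_ (h2.trans ?_)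
  · rfl
  · rw [PiLp.sub_apply, PiLp.sub_apply, connForm_apply_apply, connForm_apply_apply,
      ← Finset.sum_sub_distrib]
    congr 1
    rw [← H.frame_solderForm v, ← H.frame_solderForm w]
    refine bilinear_eq_sum (fun x y => (B u).inverse (baseForm Y B ϖ u (B u x) (B u y) -
      baseForm Y B ϖ u (B u y) (B u x)) i) (fun y => ⟨fun a b => ?_, fun c a => ?_⟩)
      (fun x => ⟨fun a b => ?_, fun c a => ?_⟩) _ _ <;> simp <;> ring

theorem fderiv_form (i j : Fin n) (v w : E) :
    fderiv ℝ (fun u => ϖ u i j) u v w - fderiv ℝ (fun u => ϖ u i j) u w v =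
      ∑ p, ∑ q, curvatureCoeff Y B ϖ u i j p q * (solderCoord Y B u p v * solderCoord Y B u q w) -
      ∑ k, (ϖ u i k v * ϖ u k j w - ϖ u i k w * ϖ u k j v) := by
  have H := hH.self_of_nhds
  have hW := ((ContDiffAt.connForm H.contDiffAt_form).differentiableAt (by norm_num)).hasFDerivAt
  have hϖ (v w : E) : fderiv ℝ (fun u => ϖ u i j) u v w =
      fderiv ℝ (fun u => connForm (ϖ u)) u v w (stdVec n j) i := by
    have h1 := (hW.clm_apply (hasFDerivAt_const w u)).clm_apply (hasFDerivAt_const (stdVec n j) u)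
    have h2 := (EuclideanSpace.proj i : Model n →L[ℝ] ℝ).hasFDerivAt.comp u h1
    have h3 := ((H.contDiffAt_form i j).differentiableAt (by norm_num)).hasFDerivAt.clm_apply
      (hasFDerivAt_const w u)
    have h4 : (EuclideanSpace.proj i : Model n →L[ℝ] ℝ) ∘
        (fun u => connForm (ϖ u) w (stdVec n j)) = fun u => ϖ u i j w := by
      funext u
      change connForm (ϖ u) w (stdVec n j) i = _
      rw [connForm_apply, toEuclideanCLM_stdVec]; rfl
    rw [h4] at h2
    have h5 := congrArg (fun L => L v) (h3.unique h2)
    simpa using h5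
  rw [hϖ, hϖ]
  have h2 := congrArg (fun x => x (stdVec n j) i) (IsAdaptedAt.fderiv_connForm hE hH w v)
  refine Eq.trans ?_ (h2.trans ?_)
  · rfl
  · have h3 (v w : E) : (connForm (ϖ u) v * connForm (ϖ u) w) (stdVec n j) i =
        ∑ k, ϖ u i k v * ϖ u k j w := by
      rw [ContinuousLinearMap.mul_def, ContinuousLinearMap.comp_apply, connForm_apply_apply]
      refine Finset.sum_congr rfl fun k _ => ?_
      rw [connForm_apply, toEuclideanCLM_stdVec]; rfl
    have h4 : (connForm (ϖ u) v * connForm (ϖ u) w - connForm (ϖ u) w * connForm (ϖ u) v)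
        (stdVec n j) i = ∑ k, (ϖ u i k v * ϖ u k j w - ϖ u i k w * ϖ u k j v) := by
      rw [sub_apply, PiLp.sub_apply, h3, h3, Finset.sum_sub_distrib]
    rw [sub_apply, PiLp.sub_apply, h4]
    congr 1
    rw [IsAdaptedAt.fderiv_baseForm_eq hE hH v, IsAdaptedAt.fderiv_baseForm_eq hE hH w,
      ← H.frame_solderForm v, ← H.frame_solderForm w]
    refine bilinear_eq_sum (fun x y => (B u).inverse (baseCurvature Y B ϖ u (B u x) (B u y)
      (B u (stdVec n j))) i) (fun y => ⟨fun a b => ?_, fun c a => ?_⟩)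
      (fun x => ⟨fun a b => ?_, fun c a => ?_⟩) _ _ <;> simp [baseCurvature] <;> ring

theorem structureEquations : StructureEquations s (solderCoord Y B) ϖ u (torsionCoeff Y B ϖ u)
    (curvatureCoeff Y B ϖ u) (fun l => horizontalLift Y ϖ u (B u (stdVec n l))) := by
  have H := hH.self_of_nhds
  have hdual (i l : Fin n) : solderCoord Y B u i (horizontalLift Y ϖ u (B u (stdVec n l))) =
      if i = l then 1 else 0 := by
    simp only [solderCoord, solderForm, ContinuousLinearMap.comp_apply]
    rw [H.fderiv_base_horizontalLift hE, H.isInvertible.inverse_apply_self]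
    simp
  refine
  { contDiffAt_solder := fun i => ?_
    contDiffAt_connection := fun i j => (H.contDiffAt_form i j).of_le (by norm_num)
    skew := H.skew
    dual := hdual
    horizontal := fun i j l => H.form_horizontalLift hE _ i j
    exists_vertical := fun Z hZ => ?_
    torsion_antisymm := fun i p q => ?_
    curvature_antisymm := fun i j p q => ?_
    curvature_skew := fun i j p q => ?_
    fderiv_solder := IsAdaptedAt.fderiv_solderCoord hE hH
    fderiv_connection := IsAdaptedAt.fderiv_form hE hH }
  · exact contDiffAt_const.clm_comp (H.contDiffAt_solderForm.of_le (by norm_num))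
  · obtain ⟨v, hv, h⟩ := H.exists_vertical hE Z hZ
    exact ⟨v, fun i => by simp [solderCoord, solderForm, hv], h⟩
  · simp [torsionCoeff]
  · rw [curvatureCoeff, curvatureCoeff, baseCurvature_antisymm]
    simp
  -- The skewness of ϖ holds near `u` and can be differentiated. On horizontal lifts the second
  -- structure equation has no quadratic terms in ϖ, so the skewness passes to the curvature
  -- components.
  · have h1 (v w : E) : eta n s i * fderiv ℝ (fun u => ϖ u i j) u v w =
        -(eta n s j * fderiv ℝ (fun u => ϖ u j i) u v w) := by
      have hd (i j : Fin n) := ((H.contDiffAt_form i j).differentiableAt (by norm_num)).hasFDerivAt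
      have h2 := ((hd i j).const_smul (eta n s i)).add ((hd j i).const_smul (eta n s j))
      have h3 := (hasFDerivAt_const (𝕜 := ℝ) (0 : E →L[ℝ] ℝ) u).congr_of_eventuallyEq
        (hH.mono fun u H => H.skew i j)
      have h4 := congrArg (fun L => L v w) (h2.unique h3)
      simp only [add_apply, smul_apply, smul_eq_mul, zero_apply] at h4
      linarith
    have h2 (i j : Fin n) := IsAdaptedAt.fderiv_form hE hH i j
      (horizontalLift Y ϖ u (B u (stdVec n p))) (horizontalLift Y ϖ u (B u (stdVec n q)))
    have h3 (i j : Fin n) : ∑ p', ∑ q', curvatureCoeff Y B ϖ u i j p' q' *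
        (solderCoord Y B u p' (horizontalLift Y ϖ u (B u (stdVec n p))) *
          solderCoord Y B u q' (horizontalLift Y ϖ u (B u (stdVec n q)))) =
        curvatureCoeff Y B ϖ u i j p q := by
      simp [hdual]
    simp only [h3, H.form_horizontalLift hE, mul_zero, sub_zero, Finset.sum_const_zero] at h2
    rw [← h2, ← h2]
    linear_combination h1 (horizontalLift Y ϖ u (B u (stdVec n p)))
      (horizontalLift Y ϖ u (B u (stdVec n q))) - h1 (horizontalLift Y ϖ u (B u (stdVec n q)))
      (horizontalLift Y ϖ u (B u (stdVec n p)))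
end
end IsAdaptedAt
end LocalStructureEquations
end DiffGeom
end

/-! ### The metric in a moving frame and its compatibility with the connection. -/

noncomputable section
namespace DiffGeom
open Set
section LocalEinstein
set_option maxSynthPendingDepth 3
open Filter Topology

variable {E : Type*} [NormedAddCommGroup E] [NormedSpace ℝ E] [FiniteDimensional ℝ E] {n s : ℕ}

theorem toEuclideanCLM_symm_apply (L : Model n →L[ℝ] Model n) (i j : Fin n) :
    (Matrix.toEuclideanCLM (𝕜 := ℝ)).symm L i j = L (stdVec n j) i := by
  have h := toEuclideanCLM_stdVec ((Matrix.toEuclideanCLM (𝕜 := ℝ)).symm L) i j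
  rw [StarAlgEquiv.apply_symm_apply] at h
  exact h.symm

/-- The matrix of the frame. -/
def frameMatrix (B : E → Model n →L[ℝ] Model n) (u : E) : Matrix (Fin n) (Fin n) ℝ :=
  (Matrix.toEuclideanCLM (𝕜 := ℝ)).symm (B u)

/-- The matrix of the coframe. -/
def coframeMatrix (B : E → Model n →L[ℝ] Model n) (u : E) : Matrix (Fin n) (Fin n) ℝ :=
  (Matrix.toEuclideanCLM (𝕜 := ℝ)).symm (B u).inverse

theorem etaMatrix_mul_self : etaMatrix n s * etaMatrix n s = 1 := by
  unfold etaMatrix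
  rw [Matrix.diagonal_mul_diagonal, ← Matrix.diagonal_one]
  congr 1
  funext i
  exact eta_mul_self i

variable {Y : E → Model n} {B : E → Model n →L[ℝ] Model n}
  {ϖ : E → Fin n → Fin n → E →L[ℝ] ℝ} {G : Model n → Matrix (Fin n) (Fin n) ℝ} {u : E}

namespace IsAdaptedAt

omit [FiniteDimensional ℝ E] in
theorem coframeMatrix_mul (H : IsAdaptedAt s Y B ϖ G u) :
    coframeMatrix B u * frameMatrix B u = 1 := by
  rw [coframeMatrix, frameMatrix, ← map_mul, ContinuousLinearMap.mul_def,
    H.isInvertible.inverse_comp_self]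
  exact map_one _

omit [FiniteDimensional ℝ E] in
theorem frameMatrix_mul (H : IsAdaptedAt s Y B ϖ G u) :
    frameMatrix B u * coframeMatrix B u = 1 :=
  mul_eq_one_comm.1 H.coframeMatrix_mul

omit [FiniteDimensional ℝ E] in
theorem transpose_mul_metric_mul (H : IsAdaptedAt s Y B ϖ G u) :
    (frameMatrix B u).transpose * G (Y u) * frameMatrix B u = etaMatrix n s := by
  ext i j
  rw [← H.gram i j]
  simp only [Matrix.mul_apply, Matrix.transpose_apply, frameMatrix, toEuclideanCLM_symm_apply,
    Finset.sum_mul]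
  rw [Finset.sum_comm]
  exact Finset.sum_congr rfl fun _ _ => Finset.sum_congr rfl fun _ _ => by ring

omit [FiniteDimensional ℝ E] in
theorem metric_eq (H : IsAdaptedAt s Y B ϖ G u) : G (Y u) =
    (coframeMatrix B u).transpose * etaMatrix n s * coframeMatrix B u := by
  have h := H.frameMatrix_mul
  have h' : (coframeMatrix B u).transpose * (frameMatrix B u).transpose = 1 := by
    rw [← Matrix.transpose_mul, h, Matrix.transpose_one]
  rw [← H.transpose_mul_metric_mul]
  simp only [Matrix.mul_assoc]
  rw [h, Matrix.mul_one, ← Matrix.mul_assoc, h', Matrix.one_mul]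

omit [FiniteDimensional ℝ E] in
theorem metric_inv (H : IsAdaptedAt s Y B ϖ G u) : (G (Y u))⁻¹ =
    frameMatrix B u * etaMatrix n s * (frameMatrix B u).transpose := by
  have h := H.coframeMatrix_mul
  have h' : (coframeMatrix B u).transpose * (frameMatrix B u).transpose = 1 := by
    rw [← Matrix.transpose_mul, H.frameMatrix_mul, Matrix.transpose_one]
  apply Matrix.inv_eq_right_inv
  rw [H.metric_eq]
  calc _ = (coframeMatrix B u).transpose * (etaMatrix n s * ((coframeMatrix B u * frameMatrix B u) *
        etaMatrix n s)) * (frameMatrix B u).transpose := by simp only [Matrix.mul_assoc]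
    _ = 1 := by rw [h, Matrix.one_mul, etaMatrix_mul_self, Matrix.mul_one, h']

omit [FiniteDimensional ℝ E] in
theorem metric_inv_mul (H : IsAdaptedAt s Y B ϖ G u) : (G (Y u))⁻¹ * G (Y u) = 1 := by
  apply Matrix.nonsing_inv_mul
  have h := H.transpose_mul_metric_mul
  have h2 : IsUnit (etaMatrix n s) := ⟨⟨_, _, etaMatrix_mul_self, etaMatrix_mul_self⟩, rfl⟩
  have h3 := (Matrix.isUnit_iff_isUnit_det _).1 h2
  rw [← h, Matrix.det_mul, Matrix.det_mul] at h3
  exact (isUnit_of_mul_isUnit_right (isUnit_of_mul_isUnit_left h3))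

omit [FiniteDimensional ℝ E] in
theorem metric_apply (H : IsAdaptedAt s Y B ϖ G u) (μ ν : Fin n) : G (Y u) μ ν =
    ∑ i, eta n s i * ((B u).inverse (stdVec n μ) i * (B u).inverse (stdVec n ν) i) := by
  rw [H.metric_eq, Matrix.mul_apply]
  refine Finset.sum_congr rfl fun i _ => ?_
  rw [etaMatrix, Matrix.mul_diagonal, Matrix.transpose_apply, coframeMatrix,
    toEuclideanCLM_symm_apply, toEuclideanCLM_symm_apply]
  ring

section
variable (hE : Module.finrank ℝ E = Module.finrank ℝ (OModel n))
include hE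

/-- The map z ↦ Y(u + lift z) has derivative the identity at 0, so the inverse function theorem
provides a local section. It is used to differentiate functions on the base that are known only
through their pullback by Y. -/
theorem exists_section (H : IsAdaptedAt s Y B ϖ G u) : ∃ σ : Model n → E,
    ContDiffAt ℝ 4 σ (Y u) ∧ σ (Y u) = u ∧ ∀ᶠ y in 𝓝 (Y u), Y (σ y) = y := by
  let f : Model n → Model n := fun z => Y (u + horizontalLift Y ϖ u z)
  have h0 : u + horizontalLift Y ϖ u 0 = u := by simp
  have hf0 : f 0 = Y u := by simp [f]
  have hf : ContDiffAt ℝ 4 f 0 := by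
    have hY := H.contDiffAt_base
    rw [← h0] at hY
    exact hY.comp (0 : Model n)
      (contDiffAt_const.add (horizontalLift Y ϖ u).contDiff.contDiffAt)
  have hf' : HasFDerivAt f ((ContinuousLinearEquiv.refl ℝ (Model n) :
      Model n ≃L[ℝ] Model n) : Model n →L[ℝ] Model n) 0 := by
    have hY := (H.contDiffAt_base.differentiableAt (by norm_num)).hasFDerivAt
    have hY' : HasFDerivAt Y (fderiv ℝ Y u) (u + horizontalLift Y ϖ u 0) := by rwa [h0]
    refine (hY'.comp (0 : Model n) ((horizontalLift Y ϖ u).hasFDerivAt.const_add u)).congr_fderiv ?_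
    ext1 z
    exact H.fderiv_base_horizontalLift hE z
  let φ := hf.localInverse hf' (by norm_num)
  have hφ : ContDiffAt ℝ 4 φ (Y u) := by
    have := hf.to_localInverse hf' (by norm_num)
    rwa [hf0] at this
  have hφ0 : φ (Y u) = 0 := by
    have := hf.localInverse_apply_image hf' (by norm_num)
    rwa [hf0] at this
  refine ⟨fun y => u + horizontalLift Y ϖ u (φ y), ?_, ?_, ?_⟩
  · exact contDiffAt_const.add ((horizontalLift Y ϖ u).contDiff.contDiffAt.comp _ hφ)
  · change u + horizontalLift Y ϖ u (φ (Y u)) = u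
    rw [hφ0, h0]
  · have := (hf.hasStrictFDerivAt' hf' (by norm_num)).eventually_right_inverse
    rw [hf0] at this
    exact this

theorem differentiableAt_of_comp_base (H : IsAdaptedAt s Y B ϖ G u) {f : Model n → ℝ} {φ : E → ℝ}
    (hφ : DifferentiableAt ℝ φ u) (h : ∀ᶠ u in 𝓝 u, f (Y u) = φ u) :
    DifferentiableAt ℝ f (Y u) := by
  obtain ⟨σ, hσ, h0, hY⟩ := H.exists_section hE
  have h1 : DifferentiableAt ℝ (φ ∘ σ) (Y u) := by
    rw [← h0] at hφ
    exact hφ.comp _ (hσ.differentiableAt (by norm_num))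
  refine h1.congr_of_eventuallyEq ?_
  have h2 : Tendsto σ (𝓝 (Y u)) (𝓝 u) := by
    have := hσ.continuousAt.tendsto
    rwa [h0] at this
  filter_upwards [hY, h2.eventually h] with y hy hy2
  rw [Function.comp, ← hy2, hy]

theorem fderiv_of_comp_base (H : IsAdaptedAt s Y B ϖ G u) {f : Model n → ℝ} {φ : E → ℝ}
    (hφ : DifferentiableAt ℝ φ u) (h : ∀ᶠ u in 𝓝 u, f (Y u) = φ u) (x : Model n) :
    fderiv ℝ f (Y u) x = fderiv ℝ φ u (horizontalLift Y ϖ u x) := by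
  have h1 := (H.differentiableAt_of_comp_base hE hφ h).hasFDerivAt.comp u
    (H.contDiffAt_base.differentiableAt (by norm_num)).hasFDerivAt
  have h2 := h1.unique (hφ.hasFDerivAt.congr_of_eventuallyEq h)
  have h3 := congrArg (fun L => L (horizontalLift Y ϖ u x)) h2
  rw [← h3, ContinuousLinearMap.comp_apply, H.fderiv_base_horizontalLift hE]

theorem fderiv_inverse_frame (H : IsAdaptedAt s Y B ϖ G u) (x y : Model n) :
    DifferentiableAt ℝ (fun u => (B u).inverse) u ∧
    fderiv ℝ (fun u => (B u).inverse) u (horizontalLift Y ϖ u x) y =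
      (B u).inverse (baseForm Y B ϖ u x y) := by
  have hA : DifferentiableAt ℝ (fun u => (B u).inverse) u :=
    ((H.isInvertible.contDiffAt_map_inverse (n := 4)).comp u H.contDiffAt_frame).differentiableAt
      (by norm_num)
  refine ⟨hA, ?_⟩
  have hB := (H.contDiffAt_frame.differentiableAt (by norm_num)).hasFDerivAt
  have h1 := hB.clm_apply (hA.hasFDerivAt.clm_apply (hasFDerivAt_const y u))
  have hinv : ∀ᶠ u' in 𝓝 u, (B u').IsInvertible := by
    obtain ⟨e, he⟩ := H.isInvertible
    have h2 := ContinuousLinearEquiv.nhds e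
    rw [he] at h2
    filter_upwards [H.contDiffAt_frame.continuousAt.tendsto.eventually h2] with u' hu'
    exact hu'
  have h3 := (hasFDerivAt_const (𝕜 := ℝ) y u).congr_of_eventuallyEq
    (f₁ := fun u => B u ((B u).inverse y)) (hinv.mono fun u' h => h.self_apply_inverse y)
  have h4 := congrArg (fun L => L (horizontalLift Y ϖ u x)) (h1.unique h3)
  have h5 := H.fderiv_frame hE (horizontalLift Y ϖ u x)
  rw [H.fderiv_base_horizontalLift hE, H.connForm_horizontalLift hE] at h5
  apply H.isInvertible.injective
  rw [H.isInvertible.self_apply_inverse]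
  simp [h5, H.isInvertible.self_apply_inverse] at h4
  rw [← sub_eq_zero, ← h4]
  abel

variable (hH : ∀ᶠ u in 𝓝 u, IsAdaptedAt s Y B ϖ G u)
include hH

/-- This is ∇g = 0. With β = B⁻¹ the metric is the sum of the η_i β^i ⊗ β^i, and along horizontal
lifts the derivative of B⁻¹ is B⁻¹ Γ. -/
theorem fderiv_metric (μ ν : Fin n) (x : Model n) :
    fderiv ℝ (fun y => G y μ ν) (Y u) x =
      ∑ l, (baseForm Y B ϖ u x (stdVec n μ) l * G (Y u) l ν +
        baseForm Y B ϖ u x (stdVec n ν) l * G (Y u) μ l) := by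
  have H := hH.self_of_nhds
  have hA := (H.fderiv_inverse_frame hE 0 0).1.hasFDerivAt
  have h1 (i μ : Fin n) := (EuclideanSpace.proj i : Model n →L[ℝ] ℝ).hasFDerivAt.comp u
    (hA.clm_apply (hasFDerivAt_const (stdVec n μ) u))
  have h2 := HasFDerivAt.fun_sum (u := Finset.univ) fun i _ =>
    ((h1 i μ).mul (h1 i ν)).const_mul (eta n s i)
  have h3 := H.fderiv_of_comp_base hE (f := fun y => G y μ ν) h2.differentiableAt
    (hH.mono fun u H => H.metric_apply μ ν) x
  rw [h3, h2.fderiv]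
  have h4 (i μ : Fin n) : (B u).inverse (baseForm Y B ϖ u x (stdVec n μ)) i =
      ∑ l, baseForm Y B ϖ u x (stdVec n μ) l * (B u).inverse (stdVec n l) i := by
    conv_lhs => rw [← sum_smul_stdVec (baseForm Y B ϖ u x (stdVec n μ))]
    simp
  simp only [H.metric_apply]
  simp [(H.fderiv_inverse_frame hE _ _).2, h4]
  simp only [Finset.mul_sum, ← Finset.sum_add_distrib]
  rw [Finset.sum_comm]
  exact Finset.sum_congr rfl fun _ _ => Finset.sum_congr rfl fun _ _ => by ring
end

end IsAdaptedAt
end LocalEinstein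
end DiffGeom
end

/-! ### Identification with the Christoffel symbols, the curvature and the Einstein tensor. -/

noncomputable section
namespace DiffGeom
open Set
section LeviCivita
set_option maxSynthPendingDepth 3
open Filter Topology

variable {E : Type*} [NormedAddCommGroup E] [NormedSpace ℝ E] [FiniteDimensional ℝ E] {n s : ℕ}
  {M : Type*} [TopologicalSpace M] [ChartedSpace (Model n) M] [IsManifold (𝓡 n) ∞ M]
  {g : PseudoRiemannianMetric n s M} {c : OpenPartialHomeomorph M (Model n)}
  {Y : E → Model n} {B : E → Model n →L[ℝ] Model n}
  {ϖ : E → Fin n → Fin n → E →L[ℝ] ℝ} {u : E}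

theorem coord_symm (y : Model n) (μ ν : Fin n) : g.coord c y μ ν = g.coord c y ν μ :=
  g.symm _ _ _

/-- The Ricci form in the coordinates of the base. -/
def baseRicci (Y : E → Model n) (B : E → Model n →L[ℝ] Model n)
    (ϖ : E → Fin n → Fin n → E →L[ℝ] ℝ) (u : E) : Matrix (Fin n) (Fin n) ℝ :=
  Matrix.of fun μ ν => ∑ l, baseCurvature Y B ϖ u (stdVec n l) (stdVec n ν) (stdVec n μ) l

omit [FiniteDimensional ℝ E] in
theorem isLinearMap_baseCurvature_left (y z : Model n) (i : Fin n) (L : Model n →L[ℝ] Model n) :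
    IsLinearMap ℝ fun x => L (baseCurvature Y B ϖ u x y z) i :=
  ⟨fun a b => by simp [baseCurvature]; ring, fun a b => by simp [baseCurvature]; ring⟩

omit [FiniteDimensional ℝ E] in
theorem isLinearMap_baseCurvature_right (x z : Model n) (i : Fin n) (L : Model n →L[ℝ] Model n) :
    IsLinearMap ℝ fun y => L (baseCurvature Y B ϖ u x y z) i :=
  ⟨fun a b => by simp [baseCurvature]; ring, fun a b => by simp [baseCurvature]; ring⟩

namespace IsAdaptedAt

omit [FiniteDimensional ℝ E] in
theorem baseForm_symm (H : IsAdaptedAt s Y B ϖ (g.coord c) u)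
    (hT : ∀ i p q, torsionCoeff Y B ϖ u i p q = 0) (x y : Model n) :
    baseForm Y B ϖ u x y = baseForm Y B ϖ u y x := by
  have h (x y : Model n) (i : Fin n) : (B u).inverse (baseForm Y B ϖ u (B u x) (B u y) -
      baseForm Y B ϖ u (B u y) (B u x)) i = 0 := by
    have := bilinear_eq_sum (fun x y => (B u).inverse (baseForm Y B ϖ u (B u x) (B u y) -
      baseForm Y B ϖ u (B u y) (B u x)) i) (fun y => ⟨fun a b => by simp; ring, fun c a => by simp; ring⟩)
      (fun x => ⟨fun a b => by simp; ring, fun c a => by simp; ring⟩) x y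
    refine this.trans (Finset.sum_eq_zero fun p _ => Finset.sum_eq_zero fun q _ => ?_)
    have h2 := hT i p q
    unfold torsionCoeff at h2
    rw [h2, zero_mul]
  have h1 := h ((B u).inverse x) ((B u).inverse y)
  rw [H.isInvertible.self_apply_inverse, H.isInvertible.self_apply_inverse] at h1
  have h2 : (B u).inverse (baseForm Y B ϖ u x y - baseForm Y B ϖ u y x) = 0 := by
    ext i; exact h1 i
  have h3 := congrArg (B u) h2
  rw [H.isInvertible.self_apply_inverse, map_zero] at h3
  exact sub_eq_zero.1 h3

section
variable (hE : Module.finrank ℝ E = Module.finrank ℝ (OModel n))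
  (hH : ∀ᶠ u in 𝓝 u, IsAdaptedAt s Y B ϖ (g.coord c) u)
include hE hH

/-- Koszul's argument: when ∂g is expressed through Γ by metric compatibility and Γ is symmetric,
the cyclic combination of derivatives collapses to 2 g_{ρκ} Γ^κ_{μν}. -/
theorem christoffel_eq (hT : ∀ i p q, torsionCoeff Y B ϖ u i p q = 0) (l μ ν : Fin n) :
    g.christoffel c (Y u) l μ ν = baseForm Y B ϖ u (stdVec n μ) (stdVec n ν) l := by
  have H := hH.self_of_nhds
  have hs := H.baseForm_symm hT
  have h1 (ρ : Fin n) : (fderiv ℝ (fun z => g.coord c z ν ρ) (Y u) (stdVec n μ) +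
      fderiv ℝ (fun z => g.coord c z μ ρ) (Y u) (stdVec n ν) -
      fderiv ℝ (fun z => g.coord c z μ ν) (Y u) (stdVec n ρ)) =
      2 * ∑ κ, g.coord c (Y u) ρ κ * baseForm Y B ϖ u (stdVec n μ) (stdVec n ν) κ := by
    rw [IsAdaptedAt.fderiv_metric hE hH, IsAdaptedAt.fderiv_metric hE hH,
      IsAdaptedAt.fderiv_metric hE hH, ← Finset.sum_add_distrib, ← Finset.sum_sub_distrib,
      Finset.mul_sum]
    refine Finset.sum_congr rfl fun κ _ => ?_
    rw [hs (stdVec n ν) (stdVec n μ), hs (stdVec n ρ) (stdVec n μ), hs (stdVec n ρ) (stdVec n ν),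
      coord_symm (c := c) (g := g) _ κ ρ, coord_symm (c := c) (g := g) _ ν κ]
    ring
  unfold PseudoRiemannianMetric.christoffel
  simp only [h1]
  have h2 : ∑ ρ, (g.coord c (Y u))⁻¹ l ρ * (2 * ∑ κ, g.coord c (Y u) ρ κ *
      baseForm Y B ϖ u (stdVec n μ) (stdVec n ν) κ) = 2 * ∑ κ,
      ((g.coord c (Y u))⁻¹ * g.coord c (Y u)) l κ *
        baseForm Y B ϖ u (stdVec n μ) (stdVec n ν) κ := by
    simp only [Matrix.mul_apply, Finset.mul_sum, Finset.sum_mul]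
    rw [Finset.sum_comm]
    exact Finset.sum_congr rfl fun _ _ => Finset.sum_congr rfl fun _ _ => by ring
  rw [h2, H.metric_inv_mul]
  simp [Matrix.one_apply]

variable (hT : ∀ᶠ u in 𝓝 u, ∀ i p q, torsionCoeff Y B ϖ u i p q = 0)
include hT

theorem riemann_eq (l ρ μ ν : Fin n) : g.riemann c (Y u) l ρ μ ν =
    baseCurvature Y B ϖ u (stdVec n μ) (stdVec n ν) (stdVec n ρ) l := by
  have H := hH.self_of_nhds
  have hs := H.baseForm_symm hT.self_of_nhds
  have hC := ((H.contDiffAt_baseForm hE).differentiableAt (by norm_num)).hasFDerivAt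
  -- The lower indices are exchanged, by symmetry of Γ, to match the order of arguments in
  -- `baseCurvature`. The identity is needed on a neighbourhood because it is going to be
  -- differentiated; hence torsion must vanish nearby and not only at `u`.
  have hΓ (l μ ν : Fin n) : ∀ᶠ u in 𝓝 u, g.christoffel c (Y u) l μ ν =
      baseForm Y B ϖ u (stdVec n ν) (stdVec n μ) l := by
    filter_upwards [hH.eventually_nhds, hT, hH] with u hu hTu Hu
    rw [christoffel_eq hE hu hTu, Hu.baseForm_symm hTu]
  have hd (l μ ν : Fin n) (x : Model n) :
      fderiv ℝ (fun z => g.christoffel c z l μ ν) (Y u) x =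
        fderiv ℝ (baseForm Y B ϖ) u (horizontalLift Y ϖ u x) (stdVec n ν) (stdVec n μ) l := by
    have h1 := (EuclideanSpace.proj l : Model n →L[ℝ] ℝ).hasFDerivAt.comp u
      ((hC.clm_apply (hasFDerivAt_const (stdVec n ν) u)).clm_apply
        (hasFDerivAt_const (stdVec n μ) u))
    rw [H.fderiv_of_comp_base hE h1.differentiableAt (hΓ l μ ν), h1.fderiv]
    simp
  have he (x y : Model n) : baseForm Y B ϖ u x y l =
      ∑ σ, baseForm Y B ϖ u x (stdVec n σ) l * y σ := by
    conv_lhs => rw [← sum_smul_stdVec y]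
    simp [mul_comm]
  unfold PseudoRiemannianMetric.riemann
  simp only [hd, fun l μ ν => (hΓ l μ ν).self_of_nhds]
  simp only [baseCurvature, add_apply, sub_apply, PiLp.add_apply, PiLp.sub_apply,
    ContinuousLinearMap.mul_def, ContinuousLinearMap.comp_apply]
  rw [he (stdVec n μ) (baseForm _ _ _ _ _ _), he (stdVec n ν) (baseForm _ _ _ _ _ _),
    ← Finset.sum_sub_distrib]

theorem ricci_eq : Matrix.of (g.ricci c (Y u)) = baseRicci Y B ϖ u := by
  ext μ ν
  change g.ricci c (Y u) μ ν = ∑ l, baseCurvature Y B ϖ u (stdVec n l) (stdVec n ν) (stdVec n μ) l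
  exact Finset.sum_congr rfl fun l _ => riemann_eq hE hH hT l μ l ν

/-- In the trace over the contravariant index and the first form index, B and B⁻¹ cancel; the two
remaining indices are transformed by the frame matrix. -/
theorem sum_curvatureCoeff (p a : Fin n) : ∑ j, curvatureCoeff Y B ϖ u j p j a =
    ((frameMatrix B u).transpose * Matrix.of (g.ricci c (Y u)) * frameMatrix B u) p a := by
  have H := hH.self_of_nhds
  rw [ricci_eq hE hH hT]
  have h1 (j : Fin n) : curvatureCoeff Y B ϖ u j p j a = ∑ l, frameMatrix B u l j *
      (B u).inverse (baseCurvature Y B ϖ u (stdVec n l) (B u (stdVec n a))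
        (B u (stdVec n p))) j := by
    have h := isLinearMap_baseCurvature_left (Y := Y) (B := B) (ϖ := ϖ) (u := u)
      (B u (stdVec n a)) (B u (stdVec n p)) j (B u).inverse
    have h2 := congrArg (h.mk' _) (sum_smul_stdVec (B u (stdVec n j)))
    rw [map_sum] at h2
    simp only [map_smul, smul_eq_mul] at h2
    refine h2.symm.trans (Finset.sum_congr rfl fun l _ => ?_)
    rw [frameMatrix, toEuclideanCLM_symm_apply]; rfl
  have h3 (z : Model n) (j : Fin n) : (B u).inverse z j = ∑ k, coframeMatrix B u j k * z k := by
    conv_lhs => rw [← sum_smul_stdVec z]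
    simp [coframeMatrix, toEuclideanCLM_symm_apply, mul_comm]
  have h4 (l : Fin n) : ∑ j, frameMatrix B u l j *
      (B u).inverse (baseCurvature Y B ϖ u (stdVec n l) (B u (stdVec n a))
        (B u (stdVec n p))) j = baseCurvature Y B ϖ u (stdVec n l) (B u (stdVec n a))
        (B u (stdVec n p)) l := by
    simp only [h3, Finset.mul_sum]
    rw [Finset.sum_comm]
    simp only [← mul_assoc, ← Finset.sum_mul]
    have : ∀ k, ∑ j, frameMatrix B u l j * coframeMatrix B u j k = (1 : Matrix (Fin n) (Fin n) ℝ) l k := by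
      intro k; rw [← H.frameMatrix_mul, Matrix.mul_apply]
    simp [this, Matrix.one_apply]
  have h5 (l : Fin n) : baseCurvature Y B ϖ u (stdVec n l) (B u (stdVec n a))
        (B u (stdVec n p)) l = ∑ μ, ∑ ν, baseCurvature Y B ϖ u (stdVec n l) (stdVec n ν)
          (stdVec n μ) l * (frameMatrix B u μ p * frameMatrix B u ν a) := by
    simp only [frameMatrix, toEuclideanCLM_symm_apply]
    exact bilinear_eq_sum (fun x y => baseCurvature Y B ϖ u (stdVec n l) y x l)
      (fun y => ⟨fun a b => by simp, fun c a => by simp⟩)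
      (fun x => isLinearMap_baseCurvature_right _ _ l (ContinuousLinearMap.id ℝ _)) _ _
  simp only [h1]
  rw [Finset.sum_comm]
  simp only [h4, h5]
  simp only [Matrix.mul_apply, Matrix.transpose_apply, baseRicci, Matrix.of_apply, Finset.sum_mul,
    Finset.mul_sum]
  rw [Finset.sum_comm]
  conv_rhs => rw [Finset.sum_comm]
  refine Finset.sum_congr rfl fun μ _ => ?_
  rw [Finset.sum_comm]
  exact Finset.sum_congr rfl fun _ _ => Finset.sum_congr rfl fun _ _ => by ring

theorem sum_eta_curvatureCoeff :
    ∑ j, ∑ l, eta n s l * curvatureCoeff Y B ϖ u j l j l = g.scalarCurvature c (Y u) := by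
  have H := hH.self_of_nhds
  rw [Finset.sum_comm]
  simp only [← Finset.mul_sum, sum_curvatureCoeff hE hH hT]
  unfold PseudoRiemannianMetric.scalarCurvature
  rw [H.metric_inv]
  simp only [Matrix.mul_apply, Matrix.transpose_apply, Matrix.of_apply, Finset.sum_mul,
    Finset.mul_sum, etaMatrix, Matrix.diagonal_apply]
  simp only [mul_ite, ite_mul, mul_zero, zero_mul, Finset.sum_ite_eq', Finset.mem_univ, if_true]
  rw [Finset.sum_comm]
  conv_rhs => rw [Finset.sum_comm]
  refine Finset.sum_congr rfl fun ν _ => ?_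
  rw [Finset.sum_comm]
  exact Finset.sum_congr rfl fun _ _ => Finset.sum_congr rfl fun _ _ => by ring

theorem einstein_eq (a p : Fin n) :
    ∑ j, eta n s p * curvatureCoeff Y B ϖ u j p j a -
        1 / 2 * delta p a * ∑ j, ∑ l, eta n s l * curvatureCoeff Y B ϖ u j l j l =
      eta n s p * ((frameMatrix B u).transpose * Matrix.of (g.einsteinTensor c (Y u)) *
        frameMatrix B u) p a := by
  have H := hH.self_of_nhds
  have h1 : Matrix.of (g.einsteinTensor c (Y u)) = Matrix.of (g.ricci c (Y u)) -
      ((1 / 2) * g.scalarCurvature c (Y u)) • g.coord c (Y u) := by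
    ext μ ν; rfl
  rw [h1, Matrix.mul_sub, Matrix.sub_mul, Matrix.mul_smul, Matrix.smul_mul,
    H.transpose_mul_metric_mul, sum_eta_curvatureCoeff hE hH hT, ← Finset.mul_sum,
    sum_curvatureCoeff hE hH hT, Matrix.sub_apply, Matrix.smul_apply, smul_eq_mul]
  have h2 : eta n s p * etaMatrix n s p a = delta p a := by
    unfold etaMatrix delta
    rw [Matrix.diagonal_apply]
    split_ifs
    · exact eta_mul_self p
    · exact mul_zero _
  rw [← h2]
  ring

theorem einsteinTensor_eq_zero_iff : (∀ μ ν, g.einsteinTensor c (Y u) μ ν = 0) ↔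
    ∀ a p, ∑ j, eta n s p * curvatureCoeff Y B ϖ u j p j a -
        1 / 2 * delta p a * ∑ j, ∑ l, eta n s l * curvatureCoeff Y B ϖ u j l j l = 0 := by
  have H := hH.self_of_nhds
  simp only [einstein_eq hE hH hT]
  constructor
  · intro h a p
    have h1 : Matrix.of (g.einsteinTensor c (Y u)) = 0 := by ext μ ν; exact h μ ν
    rw [h1]; simp
  · intro h μ ν
    have hη (i : Fin n) : eta n s i ≠ 0 := fun h => by
      have := eta_mul_self (s := s) i
      rw [h] at this; norm_num at this
    have h1 : (frameMatrix B u).transpose * Matrix.of (g.einsteinTensor c (Y u)) *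
        frameMatrix B u = 0 := by
      ext p a
      exact (mul_eq_zero.1 (h a p)).resolve_left (hη p)
    have h2 : (coframeMatrix B u).transpose * (frameMatrix B u).transpose = 1 := by
      rw [← Matrix.transpose_mul, H.frameMatrix_mul, Matrix.transpose_one]
    have h3 : Matrix.of (g.einsteinTensor c (Y u)) = 0 := by
      calc Matrix.of (g.einsteinTensor c (Y u)) =
          ((coframeMatrix B u).transpose * (frameMatrix B u).transpose) *
            Matrix.of (g.einsteinTensor c (Y u)) * (frameMatrix B u * coframeMatrix B u) := by
            rw [h2, H.frameMatrix_mul, Matrix.one_mul, Matrix.mul_one]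
        _ = (coframeMatrix B u).transpose * ((frameMatrix B u).transpose *
            Matrix.of (g.einsteinTensor c (Y u)) * frameMatrix B u) * coframeMatrix B u := by
            simp only [Matrix.mul_assoc]
        _ = 0 := by rw [h1]; simp
    exact congrFun (congrFun h3 μ) ν

end
end IsAdaptedAt
end LeviCivita
end DiffGeom
end

/-! ### Differentiability of maps into an embedded submanifold. -/

noncomputable section
namespace DiffGeom
open Set
section SubmanifoldMaps
set_option maxSynthPendingDepth 3
open Filter Topology

variable {EN HN N E V : Type*} [NormedAddCommGroup EN] [NormedSpace ℝ EN]
  [TopologicalSpace HN] {I : ModelWithCorners ℝ EN HN} [TopologicalSpace N] [ChartedSpace HN N]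
  [NormedAddCommGroup E] [NormedSpace ℝ E] [NormedAddCommGroup V] [NormedSpace ℝ V]

theorem SliceChart.coe_chart_symm {S : Set N} {p : S} (c : SliceChart I E V S p) {v : E}
    (hv : v ∈ c.chart.target) : (c.chart.symm v : N) = c.toOPH.symm (v, 0) := by
  have hv' : (v, (0 : V)) ∈ c.toOPH.target := hv
  simp [SliceChart.chart, hv']

theorem contMDiff_subtype_val {S : Set N} (c : ∀ p : S, SliceChart I E V S p) :
    letI := sliceChartedSpace c
    ContMDiff 𝓘(ℝ, E) I ∞ (Subtype.val : S → N) := by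
  let _ := sliceChartedSpace c
  have := sliceChartedSpace_isManifold c
  intro p
  have h1 : ContMDiffAt 𝓘(ℝ, E) 𝓘(ℝ, E) ∞ (c p).chart p :=
    contMDiffAt_extChartAt (I := 𝓘(ℝ, E)) (x := p)
  have h2 : ContMDiff 𝓘(ℝ, E) 𝓘(ℝ, E × V) ∞ (fun v : E => (v, (0 : V))) :=
    ContDiff.contMDiff (by fun_prop)
  have hp : p ∈ (c p).chart.source := (c p).mem_source
  have ht : (c p).chart p ∈ (c p).chart.target := (c p).chart.map_source hp
  have h3 : ContMDiffAt 𝓘(ℝ, E × V) I ∞ (c p).toOPH.symm ((c p).chart p, (0 : V)) :=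
    (c p).contMDiffOn_symm.contMDiffAt ((c p).toOPH.open_target.mem_nhds ht)
  refine (h3.comp p ((h2 _).comp p h1)).congr_of_eventuallyEq ?_
  filter_upwards [(c p).chart.open_source.mem_nhds hp] with q hq
  rw [Function.comp, Function.comp, ← (c p).coe_chart_symm ((c p).chart.map_source hq),
    (c p).chart.left_inv hq]

/-- In a slice chart `f` reads as the first component of the ambient chart applied to `f`, so
differentiability as a map into `N` is enough. -/
theorem mdifferentiableAt_of_coe {S : Set N} (c : ∀ p : S, SliceChart I E V S p)
    {E' H' N' : Type*} [NormedAddCommGroup E'] [NormedSpace ℝ E'] [TopologicalSpace H']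
    {I' : ModelWithCorners ℝ E' H'} [TopologicalSpace N'] [ChartedSpace H' N'] {f : N' → S} {x : N'}
    (hf : MDifferentiableAt I' I (fun y => (f y : N)) x) :
    letI := sliceChartedSpace c
    MDifferentiableAt I' 𝓘(ℝ, E) f x := by
  let _ := sliceChartedSpace c
  have := sliceChartedSpace_isManifold c
  have hc : ContinuousAt f x := by
    rw [Topology.IsInducing.subtypeVal.continuousAt_iff]
    exact hf.continuousAt
  rw [mdifferentiableAt_iff_target]
  refine ⟨hc, ?_⟩
  have h1 : MDifferentiableAt I 𝓘(ℝ, E × V) (c (f x)).toOPH (f x) :=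
    ((c (f x)).contMDiffOn.contMDiffAt ((c (f x)).toOPH.open_source.mem_nhds
      (c (f x)).mem_source)).mdifferentiableAt (by simp)
  have h2 : MDifferentiableAt 𝓘(ℝ, E × V) 𝓘(ℝ, E) Prod.fst ((c (f x)).toOPH (f x)) :=
    differentiableAt_fst.mdifferentiableAt
  have h3 : MDifferentiableAt I' 𝓘(ℝ, E × V) (fun y => (c (f x)).toOPH (f y)) x :=
    MDifferentiableAt.comp (g := (c (f x)).toOPH) (f := fun y => (f y : N)) x h1 hf
  exact MDifferentiableAt.comp (g := Prod.fst) (f := fun y => (c (f x)).toOPH (f y)) x h2 h3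

end SubmanifoldMaps

/-! ### Charts of the frame bundle: the base point and the frame matrix. -/

section FrameBundleMaps
set_option maxSynthPendingDepth 3
open Filter Topology Bundle

variable {n s : ℕ} {M : Type*} [TopologicalSpace M] [ChartedSpace (Model n) M]
  [IsManifold (𝓡 n) ∞ M] {g : PseudoRiemannianMetric n s M}

local notation "𝓙" => ModelWithCorners.prod (𝓡 n) 𝓘(ℝ, Model n →L[ℝ] Model n)

theorem contMDiff_coe_oframe :
    ContMDiff 𝓘(ℝ, OModel n) 𝓙 ∞ (Subtype.val : OFrame g → FrameHom n M) :=
  contMDiff_subtype_val fun r => (nonempty_sliceChart_orthonormalFrames g r).some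

theorem mdifferentiableAt_oframe {E' H' N' : Type*} [NormedAddCommGroup E'] [NormedSpace ℝ E']
    [TopologicalSpace H'] {I' : ModelWithCorners ℝ E' H'} [TopologicalSpace N']
    [ChartedSpace H' N'] {f : N' → OFrame g} {x : N'}
    (hf : MDifferentiableAt I' 𝓙 (fun y => (f y : FrameHom n M)) x) :
    MDifferentiableAt I' 𝓘(ℝ, OModel n) f x :=
  mdifferentiableAt_of_coe (fun r => (nonempty_sliceChart_orthonormalFrames g r).some) hf

theorem contMDiff_base : ContMDiff 𝓘(ℝ, OModel n) (𝓡 n) ∞ (OFrame.base : OFrame g → M) :=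
  (contMDiff_proj _).comp contMDiff_coe_oframe

theorem inCoordinates_frame {x₀ : M} (p : FrameHom n M) (hp : p.proj ∈ (chartAt (Model n) x₀).source) :
    ContinuousLinearMap.inCoordinates (Model n) (Trivial M (Model n)) (Model n)
      (fun x : M => TangentSpace (𝓡 n) x) x₀ p.proj x₀ p.proj p.2 =
    (mfderiv (𝓡 n) (𝓡 n) (chartAt (Model n) x₀) p.proj).comp p.2 := by
  have : IsManifold (𝓡 n) 1 M := IsManifold.of_le (n := ∞) (by simp)
  unfold ContinuousLinearMap.inCoordinates
  rw [TangentBundle.continuousLinearMapAt_trivializationAt hp]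
  ext1 v
  change mfderiv _ _ _ _ (p.2 (Trivialization.symmL ℝ (Trivial.trivialization M (Model n)) p.proj v)) = _
  rw [Trivial.symmL_trivialization]
  rfl

theorem extChartAt_frame (p₀ p : FrameHom n M) (hp : p.proj ∈ (chartAt (Model n) p₀.proj).source) :
    extChartAt 𝓙 p₀ p = (chartAt (Model n) p₀.proj p.proj,
      (mfderiv (𝓡 n) (𝓡 n) (chartAt (Model n) p₀.proj) p.proj).comp p.2) := by
  rw [FiberBundle.extChartAt]
  have h : trivializationAt (Model n →L[ℝ] Model n)
    (fun x : M => Trivial M (Model n) x →L[ℝ] TangentSpace (𝓡 n) x) p₀.proj p = _ :=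
    hom_trivializationAt_apply _ _ _
  change Prod.map _ _ (trivializationAt (Model n →L[ℝ] Model n)
    (fun x : M => Trivial M (Model n) x →L[ℝ] TangentSpace (𝓡 n) x) p₀.proj p) = _
  rw [h, inCoordinates_frame p hp]
  rfl

theorem mem_chart_source_frame (p₀ p : FrameHom n M)
    (hp : p.proj ∈ (chartAt (Model n) p₀.proj).source) :
    p ∈ (chartAt (ModelProd (Model n) (Model n →L[ℝ] Model n)) p₀).source := by
  rw [FiberBundle.chartedSpace_chartAt]
  simp only [mfld_simps]
  refine ⟨?_, ?_⟩
  · exact ⟨mem_univ _, hp⟩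
  · exact hp

/-- The matrix of a frame in a chart. -/
def frameCoord (c : OpenPartialHomeomorph M (Model n)) (p : FrameHom n M) : Model n →L[ℝ] Model n :=
  (mfderiv (𝓡 n) (𝓡 n) c p.proj).comp p.2

section charts
variable {c c' : OpenPartialHomeomorph M (Model n)} (hc : c ∈ IsManifold.maximalAtlas (𝓡 n) ∞ M)
  (hc' : c' ∈ IsManifold.maximalAtlas (𝓡 n) ∞ M)
include hc

omit [IsManifold (𝓡 n) ∞ M] in
theorem mdifferentiableAt_chart {x : M} (hx : x ∈ c.source) :
    MDifferentiableAt (𝓡 n) (𝓡 n) c x :=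
  (contMDiffAt_of_mem_maximalAtlas hc hx).mdifferentiableAt (by simp)

omit [IsManifold (𝓡 n) ∞ M] in
theorem contMDiffAt_chart_symm {y : Model n} (hy : y ∈ c.target) :
    ContMDiffAt (𝓡 n) (𝓡 n) ∞ c.symm y :=
  (contMDiffOn_symm_of_mem_maximalAtlas hc).contMDiffAt (c.open_target.mem_nhds hy)

omit [IsManifold (𝓡 n) ∞ M] in
theorem mdifferentiableAt_chart_symm {y : Model n} (hy : y ∈ c.target) :
    MDifferentiableAt (𝓡 n) (𝓡 n) c.symm y :=
  (contMDiffAt_chart_symm hc hy).mdifferentiableAt (by simp)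

omit [IsManifold (𝓡 n) ∞ M] in
theorem mfderiv_chart_symm_comp {x : M} (hx : x ∈ c.source) :
    (mfderiv (𝓡 n) (𝓡 n) c.symm (c x)).comp (mfderiv (𝓡 n) (𝓡 n) c x) =
      ContinuousLinearMap.id ℝ (TangentSpace (𝓡 n) x) := by
  rw [← mfderiv_comp x (mdifferentiableAt_chart_symm hc (c.map_source hx))
    (mdifferentiableAt_chart hc hx), ← mfderiv_id (I := 𝓡 n)]
  refine Filter.EventuallyEq.mfderiv_eq ?_
  filter_upwards [c.open_source.mem_nhds hx] with z hz
  exact c.left_inv hz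

omit [IsManifold (𝓡 n) ∞ M] in
theorem mfderiv_chart_comp_symm {y : Model n} (hy : y ∈ c.target) :
    (mfderiv (𝓡 n) (𝓡 n) c (c.symm y)).comp (mfderiv (𝓡 n) (𝓡 n) c.symm y) =
      ContinuousLinearMap.id ℝ (TangentSpace (𝓡 n) y) := by
  rw [← mfderiv_comp y (mdifferentiableAt_chart hc (c.map_target hy))
    (mdifferentiableAt_chart_symm hc hy), ← mfderiv_id (I := 𝓡 n)]
  refine Filter.EventuallyEq.mfderiv_eq ?_
  filter_upwards [c.open_target.mem_nhds hy] with z hz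
  exact c.right_inv hz

include hc'

omit [IsManifold (𝓡 n) ∞ M] in
theorem contDiffAt_chart_change {x : M} (hx : x ∈ c.source) (hx' : x ∈ c'.source) :
    ContDiffAt ℝ ∞ (c' ∘ c.symm) (c x) := by
  rw [← contMDiffAt_iff_contDiffAt]
  have h := contMDiffAt_of_mem_maximalAtlas hc' hx'
  rw [← c.left_inv hx] at h
  exact h.comp (c x) (contMDiffAt_chart_symm hc (c.map_source hx))

omit [IsManifold (𝓡 n) ∞ M] in
theorem frameCoord_change {p : FrameHom n M} (hx : p.proj ∈ c.source) (hx' : p.proj ∈ c'.source) :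
    frameCoord c' p = (fderiv ℝ (c' ∘ c.symm) (c p.proj)).comp (frameCoord c p) := by
  have h1 : mfderiv (𝓡 n) (𝓡 n) c' p.proj =
      (mfderiv (𝓡 n) (𝓡 n) (c' ∘ c.symm) (c p.proj)).comp (mfderiv (𝓡 n) (𝓡 n) c p.proj) := by
    have h2 : MDifferentiableAt (𝓡 n) (𝓡 n) (c' ∘ c.symm) (c p.proj) :=
      ((contDiffAt_chart_change hc hc' hx hx').differentiableAt (by simp)).mdifferentiableAt
    rw [← mfderiv_comp p.proj h2 (mdifferentiableAt_chart hc hx)]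
    refine Filter.EventuallyEq.mfderiv_eq ?_
    filter_upwards [c.open_source.mem_nhds hx] with z hz
    simp [c.left_inv hz]
  rw [mfderiv_eq_fderiv] at h1
  unfold frameCoord
  rw [h1]
  rfl
end charts

/-- The charts of O(M,g) are restrictions of ambient slice charts. A smooth extension is what later
shows that base point and frame matrix together form an immersion. -/
theorem exists_extend_chart (r₀ r : OFrame g) (hr : r ∈ (chartAt (OModel n) r₀).source) :
    ∃ K : FrameHom n M → OModel n, ContMDiffAt 𝓙 𝓘(ℝ, OModel n) ∞ K r.1 ∧
      ∀ q : OFrame g, K q.1 = chartAt (OModel n) r₀ q := by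
  let c := (nonempty_sliceChart_orthonormalFrames g r₀).some
  refine ⟨fun q => (c.toOPH q).1, ?_, fun q => rfl⟩
  have h1 : ContMDiffAt 𝓙 𝓘(ℝ, OModel n × ({p : Fin n × Fin n // p.1 ≤ p.2} → ℝ)) ∞ c.toOPH r.1 :=
    c.contMDiffOn.contMDiffAt (c.toOPH.open_source.mem_nhds hr)
  have h2 : ContMDiffAt 𝓘(ℝ, OModel n × ({p : Fin n × Fin n // p.1 ≤ p.2} → ℝ)) 𝓘(ℝ, OModel n) ∞
    Prod.fst (c.toOPH r.1) := contDiffAt_fst.contMDiffAt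
  exact ContMDiffAt.comp (g := Prod.fst) r.1 h2 h1

/-- The base point in a chart, as a function of the coordinates of a frame. -/
def localBase (c : OpenPartialHomeomorph M (Model n)) (r₀ : OFrame g) (u : OModel n) : Model n :=
  c ((chartAt (OModel n) r₀).symm u).base

/-- The matrix of a frame in a chart, as a function of the coordinates of the frame. -/
def localFrame (c : OpenPartialHomeomorph M (Model n)) (r₀ : OFrame g) (u : OModel n) :
    Model n →L[ℝ] Model n :=
  frameCoord c ((chartAt (OModel n) r₀).symm u).1

section local_charts
variable {r₀ : OFrame g} {u : OModel n} (hu : u ∈ (chartAt (OModel n) r₀).target)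
include hu

theorem contMDiffAt_oframe_symm :
    ContMDiffAt 𝓘(ℝ, OModel n) 𝓘(ℝ, OModel n) ∞ (chartAt (OModel n) r₀).symm u :=
  (contMDiffOn_extChartAt_symm (I := 𝓘(ℝ, OModel n)) (n := ∞) r₀).contMDiffAt
    (by simpa using (chartAt (OModel n) r₀).open_target.mem_nhds hu)

theorem eventually_mem_source {W : Set M} (hW : IsOpen W)
    (h : ((chartAt (OModel n) r₀).symm u).base ∈ W) :
    ∀ᶠ u in 𝓝 u, u ∈ (chartAt (OModel n) r₀).target ∧
      ((chartAt (OModel n) r₀).symm u).base ∈ W := by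
  refine Filter.Eventually.and ((chartAt (OModel n) r₀).open_target.mem_nhds hu) ?_
  have h1 : ContinuousAt (fun u => ((chartAt (OModel n) r₀).symm u).base) u :=
    (contMDiff_base.continuous.continuousAt).comp (contMDiffAt_oframe_symm hu).continuousAt
  exact h1.tendsto.eventually (hW.mem_nhds h)

theorem contDiffAt_extChartAt_frame (p₀ : FrameHom n M)
    (h : ((chartAt (OModel n) r₀).symm u).base ∈ (chartAt (Model n) p₀.proj).source) :
    ContDiffAt ℝ ∞ (fun u => (localBase (chartAt (Model n) p₀.proj) r₀ u,
      localFrame (chartAt (Model n) p₀.proj) r₀ u)) u := by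
  rw [← contMDiffAt_iff_contDiffAt]
  have h1 : ContMDiffAt 𝓙 𝓘(ℝ, Model n × (Model n →L[ℝ] Model n)) ∞ (extChartAt 𝓙 p₀)
      ((chartAt (OModel n) r₀).symm u : FrameHom n M) := by
    exact contMDiffAt_extChartAt' (mem_chart_source_frame p₀ _ h)
  have h2 := h1.comp u ((contMDiff_coe_oframe _).comp u (contMDiffAt_oframe_symm hu))
  refine h2.congr_of_eventuallyEq ?_
  filter_upwards [eventually_mem_source hu (chartAt (Model n) p₀.proj).open_source h] with u hu
  exact (extChartAt_frame p₀ _ hu.2).symm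

variable {c : OpenPartialHomeomorph M (Model n)} (hc : c ∈ IsManifold.maximalAtlas (𝓡 n) ∞ M)
  (h : ((chartAt (OModel n) r₀).symm u).base ∈ c.source)
include hc h

theorem contDiffAt_localBase : ContDiffAt ℝ ∞ (localBase c r₀) u := by
  rw [← contMDiffAt_iff_contDiffAt]
  exact (contMDiffAt_of_mem_maximalAtlas hc h).comp u
    ((contMDiff_base _).comp u (contMDiffAt_oframe_symm hu))

theorem localFrame_change {c' : OpenPartialHomeomorph M (Model n)}
    (hc' : c' ∈ IsManifold.maximalAtlas (𝓡 n) ∞ M)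
    (h' : ((chartAt (OModel n) r₀).symm u).base ∈ c'.source) :
    localFrame c' r₀ =ᶠ[𝓝 u] fun u =>
      (fderiv ℝ (c' ∘ c.symm) (localBase c r₀ u)).comp (localFrame c r₀ u) := by
  filter_upwards [eventually_mem_source hu (c.open_source.inter c'.open_source) ⟨h, h'⟩] with u hu
  exact frameCoord_change hc hc' hu.2.1 hu.2.2

/-- For the preferred chart at the base point, the frame matrix is a component of the ambient bundle
chart. For any other chart it is multiplied by the Jacobian of the coordinate change. -/
theorem contDiffAt_localFrame : ContDiffAt ℝ ∞ (localFrame c r₀) u := by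
  let x := ((chartAt (OModel n) r₀).symm u).base
  have hx := mem_chart_source (Model n) x
  have hc0 := IsManifold.chart_mem_maximalAtlas (I := 𝓡 n) (n := ∞) x
  have h0 := contDiffAt_extChartAt_frame hu ((chartAt (OModel n) r₀).symm u).1 hx
  have h1 := contDiffAt_chart_change hc0 hc hx h
  have h2 : ContDiffAt ℝ ∞ (fderiv ℝ (c ∘ (chartAt (Model n) x).symm)) (chartAt (Model n) x x) :=
    h1.fderiv_right (by simp)
  exact ((h2.comp u h0.fst).clm_comp h0.snd).congr_of_eventuallyEq
    (localFrame_change hu hc0 hx hc h)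

/-- In the preferred chart at the base point, (Y, B) is the ambient bundle chart of the frame.
Followed by the inverse of that chart and by the extension `K` of the chart of O(M,g), it is the
identity near `u`, so its derivative is injective. Passing from `c` to the preferred chart involves
only Jacobians of the coordinate change, so the vanishing of both derivatives is preserved. -/
theorem eq_zero_of_fderiv_local {v : OModel n} (hY : fderiv ℝ (localBase c r₀) u v = 0)
    (hB : fderiv ℝ (localFrame c r₀) u v = 0) : v = 0 := by
  let p := ((chartAt (OModel n) r₀).symm u).1
  let c₀ := chartAt (Model n) p.proj
  have hx : ((chartAt (OModel n) r₀).symm u).base ∈ c₀.source := mem_chart_source (Model n) p.proj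
  have hc₀ : c₀ ∈ IsManifold.maximalAtlas (𝓡 n) ∞ M :=
    IsManifold.chart_mem_maximalAtlas (I := 𝓡 n) (n := ∞) p.proj
  have h0 : ContDiffAt ℝ ∞ (fun u => (localBase c₀ r₀ u, localFrame c₀ r₀ u)) u :=
    contDiffAt_extChartAt_frame hu p hx
  have hdY := ((contDiffAt_localBase hu hc h).differentiableAt (by simp)).hasFDerivAt
  have hdB := ((contDiffAt_localFrame hu hc h).differentiableAt (by simp)).hasFDerivAt
  have h1 : ContDiffAt ℝ ∞ (c₀ ∘ c.symm) (localBase c r₀ u) := contDiffAt_chart_change hc hc₀ h hx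
  have h2 : ContDiffAt ℝ ∞ (fderiv ℝ (c₀ ∘ c.symm)) (localBase c r₀ u) :=
    h1.fderiv_right (by simp)
  have e1 : fderiv ℝ (localBase c₀ r₀) u v = 0 := by
    have h3 : localBase c₀ r₀ =ᶠ[𝓝 u] (c₀ ∘ c.symm) ∘ localBase c r₀ := by
      filter_upwards [eventually_mem_source hu c.open_source h] with u hu
      change c₀ _ = c₀ (c.symm (c _))
      rw [c.left_inv hu.2]
    rw [h3.fderiv_eq, ((h1.differentiableAt (by simp)).hasFDerivAt.comp u hdY).fderiv,
      ContinuousLinearMap.comp_apply, hY, map_zero]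
  have e2 : fderiv ℝ (localFrame c₀ r₀) u v = 0 := by
    have h5 := ((h2.differentiableAt (by simp)).hasFDerivAt.comp u hdY).clm_comp hdB
    rw [(localFrame_change hu hc h hc₀ hx).fderiv_eq]
    refine (congrArg (fun L => L v) h5.fderiv).trans ?_
    simp [hY, hB]
  obtain ⟨K, hK, hKφ⟩ := exists_extend_chart r₀ ((chartAt (OModel n) r₀).symm u)
    ((chartAt (OModel n) r₀).map_target hu)
  have hp : extChartAt 𝓙 p p = (localBase c₀ r₀ u, localFrame c₀ r₀ u) := extChartAt_frame p p hx
  have h6 : ContMDiffAt 𝓘(ℝ, Model n × (Model n →L[ℝ] Model n)) 𝓙 ∞ (extChartAt 𝓙 p).symm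
      (localBase c₀ r₀ u, localFrame c₀ r₀ u) := by
    rw [← hp]
    exact (contMDiffOn_extChartAt_symm p).contMDiffAt (extChartAt_target_mem_nhds p)
  have hps : (extChartAt 𝓙 p).symm (localBase c₀ r₀ u, localFrame c₀ r₀ u) = p := by
    rw [← hp]; exact extChartAt_to_inv p
  have h7 : ContDiffAt ℝ ∞ (fun z => K ((extChartAt 𝓙 p).symm z))
      (localBase c₀ r₀ u, localFrame c₀ r₀ u) := by
    rw [← contMDiffAt_iff_contDiffAt]
    refine ContMDiffAt.comp (g := K) _ ?_ h6
    rw [hps]; exact hK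
  have h8 := (h7.differentiableAt (by simp)).hasFDerivAt.comp u
    (h0.differentiableAt (by simp)).hasFDerivAt
  have h9 : (fun z => K ((extChartAt 𝓙 p).symm z)) ∘
      (fun u => (localBase c₀ r₀ u, localFrame c₀ r₀ u)) =ᶠ[𝓝 u] id := by
    filter_upwards [eventually_mem_source hu c₀.open_source hx] with u hu
    have h10 : (localBase c₀ r₀ u, localFrame c₀ r₀ u) =
      extChartAt 𝓙 p ((chartAt (OModel n) r₀).symm u).1 := (extChartAt_frame p _ hu.2).symm
    have h11 : ((chartAt (OModel n) r₀).symm u).1 ∈ (extChartAt 𝓙 p).source := by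
      rw [extChartAt_source]
      exact mem_chart_source_frame p _ hu.2
    simp only [Function.comp]
    rw [h10, (extChartAt 𝓙 p).left_inv h11, hKφ, (chartAt (OModel n) r₀).right_inv hu.1]
    rfl
  have h12 := congrArg (fun L => L v) (h8.unique ((hasFDerivAt_id u).congr_of_eventuallyEq h9))
  have h13 : fderiv ℝ (fun u => (localBase c₀ r₀ u, localFrame c₀ r₀ u)) u v = 0 := by
    rw [((h0.fst.differentiableAt (by simp)).fderiv_prodMk (h0.snd.differentiableAt (by simp)))]
    exact Prod.ext e1 e2
  rw [ContinuousLinearMap.comp_apply, h13, map_zero] at h12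
  exact h12.symm

end local_charts

end FrameBundleMaps
end DiffGeom
end

/-! ### Chart expressions of the connection form, the solder form and the metric. -/

noncomputable section
namespace DiffGeom
open Set
section LocalForms
set_option maxSynthPendingDepth 3
open Filter Topology Bundle

variable {n s : ℕ} {M : Type*} [TopologicalSpace M] [ChartedSpace (Model n) M]
  [IsManifold (𝓡 n) ∞ M] {g : PseudoRiemannianMetric n s M}

local notation "𝓙" => ModelWithCorners.prod (𝓡 n) 𝓘(ℝ, Model n →L[ℝ] Model n)

/-- The derivative of the inverse of the chart at `r₀`. -/
def chartFrame (r₀ : OFrame g) (u : OModel n) :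
    OModel n →L[ℝ] TangentSpace 𝓘(ℝ, OModel n) ((chartAt (OModel n) r₀).symm u) :=
  (mfderiv 𝓘(ℝ, OModel n) 𝓘(ℝ, OModel n) (chartAt (OModel n) r₀).symm u).comp
    (NormedSpace.fromTangentSpace (𝕜 := ℝ) u).symm.toContinuousLinearMap

/-- The connection form in a chart. -/
def localForm (A : MetricConnection g) (r₀ : OFrame g) (u : OModel n) (i j : Fin n) :
    OModel n →L[ℝ] ℝ :=
  (A.form ((chartAt (OModel n) r₀).symm u) i j).comp (chartFrame r₀ u)

/-- The solder form in a chart. -/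
def localSolder (r₀ : OFrame g) (u : OModel n) (i : Fin n) : OModel n →L[ℝ] ℝ :=
  (solder ((chartAt (OModel n) r₀).symm u) i).comp (chartFrame r₀ u)

variable {A : MetricConnection g} {r₀ : OFrame g} {u : OModel n}
  (hu : u ∈ (chartAt (OModel n) r₀).target)
include hu

theorem contDiffAt_localForm (i j : Fin n) : ContDiffAt ℝ ∞ (fun u => localForm A r₀ u i j) u := by
  have : IsManifold 𝓘(ℝ, OModel n) 1 (OFrame g) := IsManifold.of_le (n := ∞) (by simp)
  let e := trivializationAt (OModel n →L[ℝ] ℝ)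
    (fun r : OFrame g => TangentSpace 𝓘(ℝ, OModel n) r →L[ℝ] Trivial (OFrame g) ℝ r) r₀
  have hr := (chartAt (OModel n) r₀).map_target hu
  have h1 := (A.contMDiff i j).contMDiffAt (x := (chartAt (OModel n) r₀).symm u)
  let f : OFrame g → TotalSpace (OModel n →L[ℝ] ℝ)
      (fun r : OFrame g => TangentSpace 𝓘(ℝ, OModel n) r →L[ℝ] Trivial (OFrame g) ℝ r) :=
    fun r => TotalSpace.mk' _ r (A.form r i j)
  have he : f ((chartAt (OModel n) r₀).symm u) ∈ e.source := by
    rw [e.mem_source, hom_trivializationAt_baseSet]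
    exact ⟨hr, mem_univ _⟩
  have h1 := (e.contMDiffAt_iff (f := f) he).1 (A.contMDiff i j).contMDiffAt
  have h2 := (h1.2.comp u (contMDiffAt_oframe_symm hu)).contDiffAt
  refine h2.congr_of_eventuallyEq ?_
  filter_upwards [(chartAt (OModel n) r₀).open_target.mem_nhds hu] with u hu
  have h3 := hom_trivializationAt_apply (RingHom.id ℝ) r₀
    (TotalSpace.mk' (OModel n →L[ℝ] ℝ)
      (E := fun r : OFrame g => TangentSpace 𝓘(ℝ, OModel n) r →L[ℝ] Trivial (OFrame g) ℝ r)
      ((chartAt (OModel n) r₀).symm u) (A.form ((chartAt (OModel n) r₀).symm u) i j))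
  simp only [Function.comp, e, f]
  rw [h3]
  unfold ContinuousLinearMap.inCoordinates
  rw [TangentBundle.symmL_trivializationAt ((chartAt (OModel n) r₀).map_target hu)]
  simp only [ModelWithCorners.range_eq_univ, mfderivWithin_univ]
  refine ContinuousLinearMap.ext fun w => ?_
  let a : OModel n →L[ℝ] ℝ := A.form ((chartAt (OModel n) r₀).symm u) i j
  let D : OModel n → OModel n →L[ℝ] OModel n :=
    fun z => mfderiv 𝓘(ℝ, OModel n) 𝓘(ℝ, OModel n) (chartAt (OModel n) r₀).symm z
  have h4 : Trivialization.continuousLinearMapAt ℝ (trivializationAt ℝ (Trivial (OFrame g) ℝ) r₀)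
      ((chartAt (OModel n) r₀).symm u) = ContinuousLinearMap.id ℝ ℝ :=
    Trivial.continuousLinearMapAt_trivialization ℝ (OFrame g) ℝ _
  rw [h4]
  change a (D u w) = a (D (chartAt (OModel n) r₀ ((chartAt (OModel n) r₀).symm u)) w)
  rw [(chartAt (OModel n) r₀).right_inv hu]

theorem mfderiv_comp_chart_symm {N E' : Type*} [NormedAddCommGroup E'] [NormedSpace ℝ E']
    {H' : Type*} [TopologicalSpace H'] {I' : ModelWithCorners ℝ E' H'} [TopologicalSpace N]
    [ChartedSpace H' N] {f : OFrame g → N}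
    (hf : MDifferentiableAt 𝓘(ℝ, OModel n) I' f ((chartAt (OModel n) r₀).symm u)) (v : OModel n) :
    mfderiv 𝓘(ℝ, OModel n) I' (fun u => f ((chartAt (OModel n) r₀).symm u)) u v =
      mfderiv 𝓘(ℝ, OModel n) I' f ((chartAt (OModel n) r₀).symm u) (chartFrame r₀ u v) := by
  have h := (contMDiffAt_oframe_symm hu).mdifferentiableAt (by simp)
  have h2 := mfderiv_comp u hf h
  exact congrArg (fun L => L v) h2

variable {c : OpenPartialHomeomorph M (Model n)} (hc : c ∈ IsManifold.maximalAtlas (𝓡 n) ∞ M)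
  (h : ((chartAt (OModel n) r₀).symm u).base ∈ c.source)
include hc h

omit [IsManifold (𝓡 n) ∞ M] hu h in
theorem isInvertible_mfderiv_chart {x : M} (hx : x ∈ c.source) :
    (mfderiv (𝓡 n) (𝓡 n) c x).IsInvertible := by
  have h1 := mfderiv_chart_symm_comp hc hx
  have h2 := mfderiv_chart_comp_symm hc (c.map_source hx)
  rw [c.left_inv hx] at h2
  exact ContinuousLinearMap.IsInvertible.of_inverse h2 h1

omit hu in
theorem isInvertible_localFrame : (localFrame c r₀ u).IsInvertible :=
  ContinuousLinearMap.IsInvertible.comp (isInvertible_mfderiv_chart hc h)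
    (OFrame.frame_isInvertible _)

theorem fderiv_localBase (v : OModel n) : fderiv ℝ (localBase c r₀) u v =
    mfderiv (𝓡 n) (𝓡 n) c ((chartAt (OModel n) r₀).symm u).base
      (mfderiv 𝓘(ℝ, OModel n) (𝓡 n) OFrame.base ((chartAt (OModel n) r₀).symm u)
        (chartFrame r₀ u v)) := by
  have h1 : MDifferentiableAt 𝓘(ℝ, OModel n) (𝓡 n) (OFrame.base : OFrame g → M)
    ((chartAt (OModel n) r₀).symm u) := (contMDiff_base _).mdifferentiableAt (by simp)
  have h2 := mdifferentiableAt_chart hc h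
  have h3 := mfderiv_comp_chart_symm hu (h2.comp _ h1) v
  rw [mfderiv_comp _ h2 h1] at h3
  rw [← mfderiv_eq_fderiv]
  exact h3

/-- The derivative of the chart `c` occurs in both the frame matrix and DY, and cancels in B⁻¹ DY.
-/
theorem solderCoord_eq (i : Fin n) :
    solderCoord (localBase c r₀) (localFrame c r₀) u i = localSolder r₀ u i := by
  refine ContinuousLinearMap.ext fun v => ?_
  have h1 : (localFrame c r₀ u).inverse (fderiv ℝ (localBase c r₀) u v) =
      ((chartAt (OModel n) r₀).symm u).frame.inverse
      (mfderiv 𝓘(ℝ, OModel n) (𝓡 n) OFrame.base ((chartAt (OModel n) r₀).symm u)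
        (chartFrame r₀ u v)) := by
    apply (isInvertible_localFrame hc h).injective
    rw [(isInvertible_localFrame hc h).self_apply_inverse, fderiv_localBase hu hc h]
    change _ = mfderiv (𝓡 n) (𝓡 n) c ((chartAt (OModel n) r₀).symm u).base
      (((chartAt (OModel n) r₀).symm u).frame (((chartAt (OModel n) r₀).symm u).frame.inverse _))
    rw [(OFrame.frame_isInvertible _).self_apply_inverse]
  exact congrArg (fun x : Model n => x i) h1

omit hu h in
-- The coordinate frame of `c` is a smooth section of Hom(ℝⁿ, TM), and the components of the metric
-- are its scalar products `gram`.
theorem contDiffAt_coord {y : Model n} (hy : y ∈ c.target) (μ ν : Fin n) :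
    ContDiffAt ℝ ∞ (fun y => g.coord c y μ ν) y := by
  let f : Model n → FrameHom n M := fun y => ⟨c.symm y, (mfderiv (𝓡 n) (𝓡 n) c.symm y).comp
    (NormedSpace.fromTangentSpace (𝕜 := ℝ) y).symm.toContinuousLinearMap⟩
  have hc₀ : chartAt (Model n) (c.symm y) ∈ IsManifold.maximalAtlas (𝓡 n) ∞ M :=
    IsManifold.chart_mem_maximalAtlas (I := 𝓡 n) (n := ∞) _
  have hκ := contDiffAt_chart_change hc hc₀ (c.map_target hy) (mem_chart_source _ _)
  rw [c.right_inv hy] at hκ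
  have hf : ContMDiffAt (𝓡 n) 𝓙 ∞ f y := by
    rw [contMDiffAt_hom_bundle]
    refine ⟨contMDiffAt_chart_symm hc hy, ?_⟩
    have h1 : ContDiffAt ℝ ∞ (fderiv ℝ (chartAt (Model n) (c.symm y) ∘ c.symm)) y :=
      hκ.fderiv_right (by simp)
    refine h1.contMDiffAt.congr_of_eventuallyEq ?_
    have h2 := (contMDiffAt_chart_symm hc hy).continuousAt.tendsto.eventually
      ((chartAt (Model n) (c.symm y)).open_source.mem_nhds (mem_chart_source _ _))
    filter_upwards [h2, c.open_target.mem_nhds hy] with z hz hz'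
    rw [inCoordinates_frame (f z) hz, ← mfderiv_eq_fderiv, mfderiv_comp z
      (mdifferentiableAt_chart hc₀ hz) (mdifferentiableAt_chart_symm hc hz')]
    rfl
  have h3 := (contMDiff_gram g μ ν (f y)).comp y hf
  exact h3.contDiffAt

omit hu h in
theorem coord_apply {p : FrameHom n M} (hx : p.proj ∈ c.source) (v w : Model n) :
    ∑ μ, ∑ ν, g.coord c (c p.proj) μ ν * (frameCoord c p v μ * frameCoord c p w ν) =
      g.val p.proj (p.2 v) (p.2 w) := by
  let D : Model n →L[ℝ] Model n := mfderiv (𝓡 n) (𝓡 n) c.symm (c p.proj)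
  let gv : M → Model n →L[ℝ] Model n →L[ℝ] ℝ := fun x => g.val x
  have h1 (v : Model n) : D (frameCoord c p v) = p.2 v :=
    congrArg (fun L => L (p.2 v)) (mfderiv_chart_symm_comp hc hx)
  have h2 := bilinear_eq_sum (fun x' z => gv (c.symm (c p.proj)) (D x') (D z))
    (fun y => ⟨fun a b => by simp, fun a b => by simp⟩)
    (fun y => ⟨fun a b => by simp, fun a b => by simp⟩)
    (frameCoord c p v) (frameCoord c p w)
  refine h2.symm.trans ?_
  rw [h1, h1, c.left_inv hx]
  rfl

omit hu in
theorem gram_localFrame (i j : Fin n) : ∑ μ, ∑ ν, g.coord c (localBase c r₀ u) μ ν *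
    localFrame c r₀ u (stdVec n i) μ * localFrame c r₀ u (stdVec n j) ν = etaMatrix n s i j := by
  have h1 := coord_apply (g := g) hc h (stdVec n i) (stdVec n j)
  refine Eq.trans ?_ (h1.trans (((chartAt (OModel n) r₀).symm u).2 i j))
  exact Finset.sum_congr rfl fun _ _ => Finset.sum_congr rfl fun _ _ => mul_assoc _ _ _

/-- Differentiate Bᵀ G(Y) B = η in a vertical direction. G(Y) does not vary, and with DB = B X the
result is Xᵀ η + η X = 0. -/
theorem exists_skew_of_vertical {v : OModel n} (hv : fderiv ℝ (localBase c r₀) u v = 0) :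
    ∃ X : Matrix (Fin n) (Fin n) ℝ, X.transpose * etaMatrix n s + etaMatrix n s * X = 0 ∧
      fderiv ℝ (localFrame c r₀) u v =
        (localFrame c r₀ u).comp (Matrix.toEuclideanCLM (𝕜 := ℝ) X) := by
  have hB := isInvertible_localFrame hc h
  let X := (Matrix.toEuclideanCLM (𝕜 := ℝ)).symm
    ((localFrame c r₀ u).inverse.comp (fderiv ℝ (localFrame c r₀) u v))
  have hX : fderiv ℝ (localFrame c r₀) u v =
        (localFrame c r₀ u).comp (Matrix.toEuclideanCLM (𝕜 := ℝ) X) := by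
    ext1 z
    simp only [X, StarAlgEquiv.apply_symm_apply, ContinuousLinearMap.comp_apply,
      hB.self_apply_inverse]
  refine ⟨X, ?_, hX⟩
  have hdB := ((contDiffAt_localFrame hu hc h).differentiableAt (by simp)).hasFDerivAt
  have hdY := ((contDiffAt_localBase hu hc h).differentiableAt (by simp)).hasFDerivAt
  have hG (μ ν : Fin n) := (((contDiffAt_coord (g := g) hc (c.map_source h) μ ν).differentiableAt
    (by simp)).hasFDerivAt).comp u hdY
  have hBi (i μ : Fin n) := (EuclideanSpace.proj μ : Model n →L[ℝ] ℝ).hasFDerivAt.comp u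
    (hdB.clm_apply (hasFDerivAt_const (stdVec n i) u))
  ext i j
  have h1 := HasFDerivAt.fun_sum (u := Finset.univ) fun μ _ => HasFDerivAt.fun_sum
    (u := Finset.univ) fun ν _ => ((hG μ ν).mul (hBi i μ)).mul (hBi j ν)
  have h2 := (hasFDerivAt_const (𝕜 := ℝ) (etaMatrix n s i j) u).congr_of_eventuallyEq
    ((eventually_mem_source hu c.open_source h).mono
      fun u hu => gram_localFrame (g := g) hc hu.2 i j)
  have h3 := congrArg (fun L => L v) (h1.unique h2)
  have h4 := gram_localFrame (g := g) hc h (r₀ := r₀) (u := u)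
  have h5 (i μ : Fin n) : fderiv ℝ (localFrame c r₀) u v (stdVec n i) μ =
      ∑ k, X k i * localFrame c r₀ u (stdVec n k) μ := by
    have h6 : Matrix.toEuclideanCLM (𝕜 := ℝ) X (stdVec n i) = ∑ k, X k i • stdVec n k := by
      conv_lhs => rw [← sum_smul_stdVec (Matrix.toEuclideanCLM (𝕜 := ℝ) X (stdVec n i))]
      simp only [toEuclideanCLM_stdVec]
    rw [hX, ContinuousLinearMap.comp_apply, h6]
    simp
  simp [hv, h5] at h3
  have h6 : (X.transpose * etaMatrix n s + etaMatrix n s * X) i j =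
      ∑ k, etaMatrix n s i k * X k j + ∑ k, X k i * etaMatrix n s k j := by
    rw [Matrix.add_apply, Matrix.mul_apply, Matrix.mul_apply, add_comm]
    rfl
  rw [h6]
  refine Eq.trans ?_ h3
  simp only [← h4]
  simp only [Finset.sum_add_distrib, Finset.mul_sum, Finset.sum_mul]
  congr 1
  all_goals
    rw [Finset.sum_comm]
    refine Finset.sum_congr rfl fun _ _ => ?_
    rw [Finset.sum_comm]
    exact Finset.sum_congr rfl fun _ _ => Finset.sum_congr rfl fun _ _ => by ring

end LocalForms
end DiffGeom
end

/-! ### The right action and the vertical vectors. -/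

noncomputable section
namespace DiffGeom
open Set
section VerticalVectors
set_option maxSynthPendingDepth 3
open Filter Topology Bundle

variable {n s : ℕ} {M : Type*} [TopologicalSpace M] [ChartedSpace (Model n) M]
  [IsManifold (𝓡 n) ∞ M] {g : PseudoRiemannianMetric n s M}

local notation "𝓙" => ModelWithCorners.prod (𝓡 n) 𝓘(ℝ, Model n →L[ℝ] Model n)

theorem act_expPseudoOrthogonal_zero {X : Matrix (Fin n) (Fin n) ℝ}
    (hX : X.transpose * etaMatrix n s + etaMatrix n s * X = 0) (r : OFrame g) :
    r.act (expPseudoOrthogonal hX 0) = r := by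
  have h : Matrix.toEuclideanCLM (𝕜 := ℝ) (NormedSpace.exp ((0 : ℝ) • X)) =
      ContinuousLinearMap.id ℝ (Model n) := by
    rw [zero_smul, NormedSpace.exp_zero, map_one]; rfl
  apply Subtype.ext
  change (⟨r.1.proj, r.frame.comp (Matrix.toEuclideanCLM (𝕜 := ℝ)
    (NormedSpace.exp ((0 : ℝ) • X)))⟩ : FrameHom n M) = r.1
  rw [h]
  rfl

theorem mdifferentiableAt_act (a : PseudoOrthogonal n s) (r : OFrame g) :
    MDifferentiableAt 𝓘(ℝ, OModel n) 𝓘(ℝ, OModel n) (fun r : OFrame g => r.act a) r := by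
  refine mdifferentiableAt_oframe ?_
  have h1 := (contMDiff_coe_oframe r).mdifferentiableAt (by simp)
  rw [mdifferentiableAt_hom_bundle] at h1 ⊢
  refine ⟨h1.1, ?_⟩
  let K := (ContinuousLinearMap.compL ℝ (Model n) (Model n) (Model n)).flip
    (Matrix.toEuclideanCLM (𝕜 := ℝ) a.1)
  have h2 := (K.differentiableAt.mdifferentiableAt).comp r h1.2
  refine h2.congr_of_eventuallyEq ?_
  filter_upwards [(contMDiff_base (g := g)).continuous.continuousAt.tendsto.eventually
    ((chartAt (Model n) r.base).open_source.mem_nhds (mem_chart_source _ _))] with q hq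
  refine (inCoordinates_frame (q.act a).1 hq).trans ?_
  have h3 := inCoordinates_frame q.1 hq
  exact Eq.trans rfl (congrArg K h3).symm

theorem mdifferentiableAt_act_curve {k : ℝ → PseudoOrthogonal n s} (r : OFrame g) {t : ℝ}
    (hk : DifferentiableAt ℝ (fun t => Matrix.toEuclideanCLM (𝕜 := ℝ) (k t).1) t) :
    MDifferentiableAt 𝓘(ℝ, ℝ) 𝓘(ℝ, OModel n) (fun t : ℝ => r.act (k t)) t := by
  refine mdifferentiableAt_oframe ?_
  rw [mdifferentiableAt_hom_bundle]
  refine ⟨mdifferentiableAt_const, ?_⟩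
  let K := ContinuousLinearMap.compL ℝ (Model n) (Model n) (Model n)
    (frameCoord (chartAt (Model n) r.base) r.1)
  have h2 : DifferentiableAt ℝ (fun t => K (Matrix.toEuclideanCLM (𝕜 := ℝ) (k t).1)) t :=
    K.differentiableAt.comp t hk
  exact h2.mdifferentiableAt.congr_of_eventuallyEq (Filter.Eventually.of_forall fun t =>
    inCoordinates_frame (r.act (k t)).1 (mem_chart_source _ r.base))

theorem mdifferentiableAt_act_exp {X : Matrix (Fin n) (Fin n) ℝ}
    (hX : X.transpose * etaMatrix n s + etaMatrix n s * X = 0) (r : OFrame g) :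
    MDifferentiableAt 𝓘(ℝ, ℝ) 𝓘(ℝ, OModel n)
      (fun t : ℝ => r.act (expPseudoOrthogonal hX t)) 0 :=
  mdifferentiableAt_act_curve r (hasDerivAt_exp_smul X).differentiableAt

variable {A : MetricConnection g} {r₀ : OFrame g} {u : OModel n}
  (hu : u ∈ (chartAt (OModel n) r₀).target)
  {c : OpenPartialHomeomorph M (Model n)} (hc : c ∈ IsManifold.maximalAtlas (𝓡 n) ∞ M)
  (h : ((chartAt (OModel n) r₀).symm u).base ∈ c.source)
include hu hc h

theorem exists_lift_act (a : PseudoOrthogonal n s)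
    (ha : ((chartAt (OModel n) r₀).symm u).act a ∈ (chartAt (OModel n) r₀).source) (w : OModel n) :
    ∃ w', fderiv ℝ (localBase c r₀) (chartAt (OModel n) r₀ (((chartAt (OModel n) r₀).symm u).act a))
        w' = fderiv ℝ (localBase c r₀) u w ∧
      fderiv ℝ (localFrame c r₀) (chartAt (OModel n) r₀ (((chartAt (OModel n) r₀).symm u).act a))
        w' = (fderiv ℝ (localFrame c r₀) u w).comp (Matrix.toEuclideanCLM (𝕜 := ℝ) a.1) ∧
      ∀ i j, localForm A r₀ (chartAt (OModel n) r₀ (((chartAt (OModel n) r₀).symm u).act a)) i j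
        w' = (a.1⁻¹ * (Matrix.of fun k l => localForm A r₀ u k l w) * a.1) i j := by
  set φ := chartAt (OModel n) r₀ with hφ
  let ρ : OModel n → OModel n := fun u => φ ((φ.symm u).act a)
  have hρu : ρ u ∈ φ.target := φ.map_source ha
  have hφρ : φ.symm (ρ u) = (φ.symm u).act a := φ.left_inv ha
  have hsymm : MDifferentiableAt 𝓘(ℝ, OModel n) 𝓘(ℝ, OModel n) φ.symm u :=
    (contMDiffAt_oframe_symm hu).mdifferentiableAt (by simp)
  have hact := (mdifferentiableAt_act a (φ.symm u)).comp u hsymm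
  have hev : ∀ᶠ u in 𝓝 u, φ.symm (ρ u) = (φ.symm u).act a := by
    filter_upwards [hact.continuousAt.tendsto.eventually (φ.open_source.mem_nhds ha)] with u hu
    exact φ.left_inv hu
  have hρ : DifferentiableAt ℝ ρ u := by
    have h1 : MDifferentiableAt 𝓘(ℝ, OModel n) 𝓘(ℝ, OModel n) φ ((φ.symm u).act a) :=
      (contMDiffAt_extChartAt' (I := 𝓘(ℝ, OModel n)) (n := ∞) ha).mdifferentiableAt (by simp)
    exact (h1.comp u hact).differentiableAt
  have hbase : (φ.symm (ρ u)).base ∈ c.source := by rw [hφρ]; exact h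
  have hY := ((contDiffAt_localBase hρu hc hbase).differentiableAt (by simp)).hasFDerivAt
  have hB := ((contDiffAt_localFrame hρu hc hbase).differentiableAt (by simp)).hasFDerivAt
  have hB' := ((contDiffAt_localFrame hu hc h).differentiableAt (by simp)).hasFDerivAt
  -- The vector w' is the image of `w` under right translation by `a`, read in the chart. The
  -- translation fixes the base point, multiplies the frame matrix by `a`, and conjugates the
  -- connection form by equivariance.
  refine ⟨fderiv ℝ ρ u w, ?_, ?_, fun i j => ?_⟩
  · have h1 := hY.comp u hρ.hasFDerivAt
    have h2 : localBase c r₀ ∘ ρ =ᶠ[𝓝 u] localBase c r₀ := by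
      filter_upwards [hev] with u hu
      change c (φ.symm (ρ u)).base = _
      rw [hu]; rfl
    rw [← h2.fderiv_eq, h1.fderiv]
    rfl
  · have h1 := hB.comp u hρ.hasFDerivAt
    let K := (ContinuousLinearMap.compL ℝ (Model n) (Model n) (Model n)).flip
      (Matrix.toEuclideanCLM (𝕜 := ℝ) a.1)
    have h2 : localFrame c r₀ ∘ ρ =ᶠ[𝓝 u] K ∘ localFrame c r₀ := by
      filter_upwards [hev] with u hu
      change frameCoord c (φ.symm (ρ u)).1 = _
      rw [hu]; rfl
    have h3 := congrArg (fun L => L w) (h1.unique ((K.hasFDerivAt.comp u hB').congr_of_eventuallyEq h2))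
    exact h3
  · have h1 := A.equivariant a (φ.symm u) (chartFrame r₀ u w) i j
    refine Eq.trans ?_ h1
    have h2 : (chartFrame r₀ (ρ u) (fderiv ℝ ρ u w) : OModel n) =
        mfderiv 𝓘(ℝ, OModel n) 𝓘(ℝ, OModel n) (fun r : OFrame g => r.act a) (φ.symm u)
          (chartFrame r₀ u w) := by
      have h3 := mfderiv_comp_chart_symm hu (mdifferentiableAt_act a (φ.symm u)) w
      have h4 : MDifferentiableAt 𝓘(ℝ, OModel n) 𝓘(ℝ, OModel n) φ.symm (ρ u) :=
        (contMDiffAt_oframe_symm hρu).mdifferentiableAt (by simp)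
      have h5 := mfderiv_comp u h4 hρ.mdifferentiableAt
      have h6 : mfderiv 𝓘(ℝ, OModel n) 𝓘(ℝ, OModel n) (φ.symm ∘ ρ) u =
          mfderiv 𝓘(ℝ, OModel n) 𝓘(ℝ, OModel n) (fun u => (φ.symm u).act a) u :=
        Filter.EventuallyEq.mfderiv_eq hev
      rw [mfderiv_eq_fderiv] at h5
      exact ((congrArg (fun L : OModel n →L[ℝ] OModel n => L w) h5).symm.trans
        (congrArg (fun L : OModel n →L[ℝ] OModel n => L w) h6)).trans h3
    let F : OFrame g → OModel n →L[ℝ] ℝ := fun r => A.form r i j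
    change F (φ.symm (ρ u)) (chartFrame r₀ (ρ u) (fderiv ℝ ρ u w)) = F _ _
    rw [h2, hφρ]

theorem exists_curve_of_vertical {v : OModel n} (hv : fderiv ℝ (localBase c r₀) u v = 0) :
    ∃ X : Matrix (Fin n) (Fin n) ℝ, (∀ i j, localForm A r₀ u i j v = X i j) ∧
      ∃ γ : ℝ → OModel n, γ 0 = u ∧ HasDerivAt γ v 0 ∧ ∀ᶠ t in 𝓝 (0 : ℝ),
      IsUnit (NormedSpace.exp (t • X)).det ∧
      localFrame c r₀ (γ t) = (localFrame c r₀ u).comp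
        (Matrix.toEuclideanCLM (𝕜 := ℝ) (NormedSpace.exp (t • X))) ∧
      ∀ w, ∃ w', fderiv ℝ (localBase c r₀) (γ t) w' = fderiv ℝ (localBase c r₀) u w ∧
        fderiv ℝ (localFrame c r₀) (γ t) w' = (fderiv ℝ (localFrame c r₀) u w).comp
          (Matrix.toEuclideanCLM (𝕜 := ℝ) (NormedSpace.exp (t • X))) ∧
        ∀ i j, localForm A r₀ (γ t) i j w' =
          ((NormedSpace.exp (t • X))⁻¹ * (Matrix.of fun k l => localForm A r₀ u k l w) *
            NormedSpace.exp (t • X)) i j := by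
  obtain ⟨X, hX, hXv⟩ := exists_skew_of_vertical hu hc h hv
  set φ := chartAt (OModel n) r₀ with hφ
  let κ : ℝ → OFrame g := fun t => (φ.symm u).act (expPseudoOrthogonal hX t)
  have hκ0 : κ 0 = φ.symm u := act_expPseudoOrthogonal_zero hX _
  have hκ : MDifferentiableAt 𝓘(ℝ, ℝ) 𝓘(ℝ, OModel n) κ 0 := mdifferentiableAt_act_exp hX _
  have hmem : κ 0 ∈ φ.source := by rw [hκ0]; exact φ.map_target hu
  have hev : ∀ᶠ t in 𝓝 (0 : ℝ), κ t ∈ φ.source :=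
    hκ.continuousAt.tendsto.eventually (φ.open_source.mem_nhds hmem)
  have hγ : DifferentiableAt ℝ (fun t => φ (κ t)) 0 := by
    have h1 : MDifferentiableAt 𝓘(ℝ, OModel n) 𝓘(ℝ, OModel n) φ (κ 0) :=
      (contMDiffAt_extChartAt' (I := 𝓘(ℝ, OModel n)) (n := ∞) hmem).mdifferentiableAt (by simp)
    exact (h1.comp 0 hκ).differentiableAt
  have hγ0 : φ (κ 0) = u := by rw [hκ0, φ.right_inv hu]
  have hY := ((contDiffAt_localBase hu hc h).differentiableAt (by simp)).hasFDerivAt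
  have hB := ((contDiffAt_localFrame hu hc h).differentiableAt (by simp)).hasFDerivAt
  have hBκ (t : ℝ) (ht : κ t ∈ φ.source) : localFrame c r₀ (φ (κ t)) = (localFrame c r₀ u).comp
        (Matrix.toEuclideanCLM (𝕜 := ℝ) (expPseudoOrthogonal hX t).1) := by
    change frameCoord c (φ.symm (φ (κ t))).1 = _
    rw [φ.left_inv ht]; rfl
  have hYκ (t : ℝ) (ht : κ t ∈ φ.source) : localBase c r₀ (φ (κ t)) = localBase c r₀ u := by
    change c (φ.symm (φ (κ t))).base = _
    rw [φ.left_inv ht]; rfl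
  -- The orbit curve through the frame has velocity `v`: DY sends both vectors to 0 and DB sends
  -- both to B X, and the pair of derivatives is injective.
  have hderiv : deriv (fun t => φ (κ t)) 0 = v := by
    rw [← sub_eq_zero]
    refine eq_zero_of_fderiv_local hu hc h ?_ ?_
    · rw [map_sub, hv, sub_zero]
      rw [← hγ0] at hY
      have h1 := hY.comp_hasDerivAt (0 : ℝ) hγ.hasDerivAt
      rw [hγ0] at h1
      exact h1.unique ((hasDerivAt_const (0 : ℝ) (localBase c r₀ u)).congr_of_eventuallyEq
        (hev.mono hYκ))
    · rw [map_sub, hXv, sub_eq_zero]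
      rw [← hγ0] at hB
      have h1 := hB.comp_hasDerivAt (0 : ℝ) hγ.hasDerivAt
      rw [hγ0] at h1
      have h2 := ((ContinuousLinearMap.compL ℝ (Model n) (Model n) (Model n)
        (localFrame c r₀ u)).hasFDerivAt).comp_hasDerivAt (0 : ℝ) (hasDerivAt_exp_smul X)
      exact h1.unique (h2.congr_of_eventuallyEq (hev.mono hBκ))
  refine ⟨X, fun i j => ?_, fun t => φ (κ t), hγ0, hderiv ▸ hγ.hasDerivAt, ?_⟩
  · have h1 := A.vertical (φ.symm u) X hX i j
    rw [← h1]
    let F : OFrame g → OModel n →L[ℝ] ℝ := fun r => A.form r i j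
    have h2 : (chartFrame r₀ u v : OModel n) = mfderiv 𝓘(ℝ, ℝ) 𝓘(ℝ, OModel n) κ 0 (1 : ℝ) := by
      have h3 : MDifferentiableAt 𝓘(ℝ, OModel n) 𝓘(ℝ, OModel n) φ.symm (φ (κ 0)) := by
        rw [hγ0]; exact (contMDiffAt_oframe_symm hu).mdifferentiableAt (by simp)
      have h4 := mfderiv_comp (0 : ℝ) h3 hγ.mdifferentiableAt
      have h5 : mfderiv 𝓘(ℝ, ℝ) 𝓘(ℝ, OModel n) (φ.symm ∘ fun t => φ (κ t)) 0 =
          mfderiv 𝓘(ℝ, ℝ) 𝓘(ℝ, OModel n) κ 0 :=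
        Filter.EventuallyEq.mfderiv_eq (hev.mono fun t ht => φ.left_inv ht)
      rw [mfderiv_eq_fderiv] at h4
      have h6 := (congrArg (fun L : ℝ →L[ℝ] OModel n => L 1) h4).symm.trans
        (congrArg (fun L : ℝ →L[ℝ] OModel n => L 1) h5)
      refine Eq.trans ?_ h6
      let D : OModel n → OModel n →L[ℝ] OModel n :=
        fun z => mfderiv 𝓘(ℝ, OModel n) 𝓘(ℝ, OModel n) φ.symm z
      change D u v = D (φ (κ 0)) (fderiv ℝ (fun t => φ (κ t)) 0 1)
      rw [hγ0, fderiv_apply_one_eq_deriv, hderiv]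
    change F (φ.symm u) (chartFrame r₀ u v) = F (κ 0) (mfderiv 𝓘(ℝ, ℝ) 𝓘(ℝ, OModel n) κ 0 (1 : ℝ))
    rw [h2, hκ0]
  · filter_upwards [hev] with t ht
    refine ⟨(Matrix.isUnit_iff_isUnit_det _).1 (Matrix.isUnit_exp _), hBκ t ht, fun w => ?_⟩
    exact exists_lift_act hu hc h (expPseudoOrthogonal hX t) ht w

theorem isAdaptedAt : IsAdaptedAt s (localBase c r₀) (localFrame c r₀) (localForm A r₀)
    (g.coord c) u where
  contDiffAt_base := (contDiffAt_localBase hu hc h).of_le (WithTop.coe_le_coe.2 (le_top : (4 : ℕ∞) ≤ ⊤))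
  contDiffAt_frame := (contDiffAt_localFrame hu hc h).of_le (WithTop.coe_le_coe.2 (le_top : (4 : ℕ∞) ≤ ⊤))
  contDiffAt_form i j := (contDiffAt_localForm hu i j).of_le (WithTop.coe_le_coe.2 (le_top : (4 : ℕ∞) ≤ ⊤))
  isInvertible := isInvertible_localFrame hc h
  skew i j := by
    refine ContinuousLinearMap.ext fun v => ?_
    exact congrArg (fun L => L (chartFrame r₀ u v)) (A.skew ((chartAt (OModel n) r₀).symm u) i j)
  gram := gram_localFrame hc h
  eq_zero v := eq_zero_of_fderiv_local hu hc h
  vertical v := exists_curve_of_vertical hu hc h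

theorem eventually_isAdaptedAt : ∀ᶠ u in 𝓝 u, IsAdaptedAt s (localBase c r₀) (localFrame c r₀)
    (localForm A r₀) (g.coord c) u :=
  (eventually_mem_source hu c.open_source h).mono fun _ hu => isAdaptedAt hu.1 hc hu.2

end VerticalVectors
end DiffGeom
end

/-! ### Pullbacks, and exterior derivatives in an arbitrary chart of O(M,g). -/

noncomputable section
namespace DiffGeom
open Set
section Pullbacks
set_option maxSynthPendingDepth 3
variable {E E' : Type*} [NormedAddCommGroup E] [NormedSpace ℝ E] [NormedAddCommGroup E']
  [NormedSpace ℝ E'] {n k s : ℕ}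

theorem sigmaForm_compContinuousLinearMap (L : E' →L[ℝ] E) (θ : Fin n → E →L[ℝ] ℝ)
    (ϖ : Fin n → Fin n → E →L[ℝ] ℝ) (h : 3 + k = n) (i : Fin n) :
    (sigmaForm s θ ϖ h i).compContinuousLinearMap L =
      sigmaForm s (fun i => (θ i).comp L) (fun i j => (ϖ i j).comp L) h i := by
  ext v
  simp only [sigmaForm, ← starForm_compContinuousLinearMap, ← ContinuousLinearMap.smul_comp,
    ← wedge_compContinuousLinearMap,
    ContinuousAlternatingMap.compContinuousLinearMap_apply, ContinuousAlternatingMap.smul_apply,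
    ContinuousAlternatingMap.sum_apply]

theorem tauForm_compContinuousLinearMap (L : E' →L[ℝ] E) (θ : Fin n → E →L[ℝ] ℝ)
    (ϖ : Fin n → Fin n → E →L[ℝ] ℝ) (h : 3 + k = n) (i : Fin n) :
    (tauForm s θ ϖ h i).compContinuousLinearMap L =
      tauForm s (fun i => (θ i).comp L) (fun i j => (ϖ i j).comp L) h i := by
  ext v
  simp only [tauForm, ← starForm_compContinuousLinearMap, ← ContinuousLinearMap.smul_comp,
    ← wedge_compContinuousLinearMap, ContinuousAlternatingMap.add_apply,
    ContinuousAlternatingMap.compContinuousLinearMap_apply, ContinuousAlternatingMap.smul_apply,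
    ContinuousAlternatingMap.sum_apply]

theorem ContDiffAt.sigmaForm {F : Type*} [NormedAddCommGroup F] [NormedSpace ℝ F]
    {N : WithTop ℕ∞} {θ : F → Fin n → E →L[ℝ] ℝ} {ϖ : F → Fin n → Fin n → E →L[ℝ] ℝ} {x : F}
    (hθ : ∀ i, ContDiffAt ℝ N (fun u => θ u i) x)
    (hϖ : ∀ i j, ContDiffAt ℝ N (fun u => ϖ u i j) x) (h : 3 + k = n) (i : Fin n) :
    ContDiffAt ℝ N (fun u => sigmaForm s (θ u) (ϖ u) h i) x :=
  ContDiffAt.const_smul _ (ContDiffAt.sum fun j _ => ContDiffAt.sum fun l _ =>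
    ContDiffAt.wedge ((hϖ j l).const_smul _) (ContDiffAt.starForm hθ h _))

theorem ContDiffAt.tauForm {F : Type*} [NormedAddCommGroup F] [NormedSpace ℝ F]
    {N : WithTop ℕ∞} {θ : F → Fin n → E →L[ℝ] ℝ} {ϖ : F → Fin n → Fin n → E →L[ℝ] ℝ} {x : F}
    (hθ : ∀ i, ContDiffAt ℝ N (fun u => θ u i) x)
    (hϖ : ∀ i j, ContDiffAt ℝ N (fun u => ϖ u i j) x) (h : 3 + k = n) (i : Fin n) :
    ContDiffAt ℝ N (fun u => tauForm s (θ u) (ϖ u) h i) x :=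
  ContDiffAt.const_smul _ ((ContDiffAt.sum fun j _ => ContDiffAt.sum fun l _ => ContDiffAt.sum
    fun m _ => ContDiffAt.wedge (hϖ j i) (ContDiffAt.wedge ((hϖ l m).const_smul _)
      (ContDiffAt.starForm hθ h _))).add
    (ContDiffAt.sum fun j _ => ContDiffAt.sum fun l _ => ContDiffAt.sum
    fun m _ => ContDiffAt.wedge (hϖ j m) (ContDiffAt.wedge ((hϖ m l).const_smul _)
      (ContDiffAt.starForm hθ h _))))

theorem ContDiffAt.oneForm {F : Type*} [NormedAddCommGroup F] [NormedSpace ℝ F]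
    {N : WithTop ℕ∞} {α : F → E →L[ℝ] ℝ} {x : F} (hα : ContDiffAt ℝ N α x) :
    ContDiffAt ℝ N (fun u => oneForm (α u)) x :=
  (ContinuousAlternatingMap.ofSubsingletonLIE (𝕜 := ℝ) (E := E) (F := ℝ)
    (0 : Fin 1)).toContinuousLinearEquiv.contDiff.contDiffAt.comp x hα

end Pullbacks

section LocalRepresentatives
set_option maxSynthPendingDepth 3
open Filter Topology Bundle

variable {n s : ℕ} {M : Type*} [TopologicalSpace M] [ChartedSpace (Model n) M]
  [IsManifold (𝓡 n) ∞ M] {g : PseudoRiemannianMetric n s M}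

/-- The expression of a differential form in the chart at `r₀`. -/
def localRep {k : ℕ} (α : OForm g k) (r₀ : OFrame g) (u : OModel n) : OModel n [⋀^Fin k]→L[ℝ] ℝ :=
  (α ((chartAt (OModel n) r₀).symm u)).compContinuousLinearMap (chartFrame r₀ u)

theorem mdifferentiable_chartAt_oframe (r : OFrame g) :
    (chartAt (OModel n) r).MDifferentiable 𝓘(ℝ, OModel n) 𝓘(ℝ, OModel n) := by
  have : IsManifold 𝓘(ℝ, OModel n) 1 (OFrame g) := IsManifold.of_le (n := ∞) (by simp)
  exact mdifferentiable_chart r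

variable {A : MetricConnection g} {r₀ : OFrame g} {u : OModel n}
  (hu : u ∈ (chartAt (OModel n) r₀).target)

theorem localRep_tau (hn : 3 ≤ n) (i : Fin n) :
    localRep (A.tau hn i) r₀ u =
      tauForm s (localSolder r₀ u) (localForm A r₀ u) (Nat.add_sub_cancel' hn) i :=
  tauForm_compContinuousLinearMap (E := OModel n) (E' := OModel n) (chartFrame r₀ u) _ _ _ i

theorem localRep_sigma (hn : 3 ≤ n) (i : Fin n) :
    localRep (A.sigma hn i) r₀ u =
      sigmaForm s (localSolder r₀ u) (localForm A r₀ u) (Nat.add_sub_cancel' hn) i :=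
  sigmaForm_compContinuousLinearMap (E := OModel n) (E' := OModel n) (chartFrame r₀ u) _ _ _ i

include hu

theorem surjective_chartFrame : Function.Surjective (chartFrame r₀ u) := fun v =>
  (mdifferentiable_chartAt_oframe r₀).symm.mfderiv_surjective hu v

theorem compContinuousLinearMap_chartFrame_injective {k : ℕ}
    {α β : TangentSpace 𝓘(ℝ, OModel n) ((chartAt (OModel n) r₀).symm u) [⋀^Fin k]→L[ℝ] ℝ}
    (h : α.compContinuousLinearMap (chartFrame r₀ u) =
      β.compContinuousLinearMap (chartFrame r₀ u)) : α = β := by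
  ext v
  choose w hw using fun a => surjective_chartFrame hu (v a)
  have h1 := congrArg (fun γ => γ w) h
  simp only [ContinuousAlternatingMap.compContinuousLinearMap_apply, Function.comp_def, hw] at h1
  exact h1

theorem contDiffAt_localSolder (i : Fin n) : ContDiffAt ℝ ∞ (fun u => localSolder r₀ u i) u := by
  let x := ((chartAt (OModel n) r₀).symm u).base
  have hc := IsManifold.chart_mem_maximalAtlas (I := 𝓡 n) (n := ∞) x
  have hx : ((chartAt (OModel n) r₀).symm u).base ∈ (chartAt (Model n) x).source :=
    mem_chart_source (Model n) x
  have hY := contDiffAt_localBase hu hc hx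
  have hB := contDiffAt_localFrame hu hc hx
  have h1 : ContDiffAt ℝ ∞ (fun u => (localFrame (chartAt (Model n) x) r₀ u).inverse) u := by
    obtain ⟨e, he⟩ := isInvertible_localFrame (r₀ := r₀) hc hx
    have h2 : ContDiffAt ℝ ∞ ContinuousLinearMap.inverse (localFrame (chartAt (Model n) x) r₀ u) := by
      rw [← he]; exact contDiffAt_map_inverse e
    exact h2.comp u hB
  have h2 : ContDiffAt ℝ ∞ (fun u => solderCoord (localBase (chartAt (Model n) x) r₀)
      (localFrame (chartAt (Model n) x) r₀) u i) u :=
    contDiffAt_const.clm_comp (h1.clm_comp (hY.fderiv_right (by simp)))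
  refine h2.congr_of_eventuallyEq ?_
  filter_upwards [eventually_mem_source hu (chartAt (Model n) x).open_source hx] with u hu
  exact (solderCoord_eq hu.1 hc hu.2 i).symm

/-- The exterior derivative of a form on `O(M,g)` can be computed in any chart. -/
theorem manifoldExtDeriv_compContinuousLinearMap {k : ℕ} (α : OForm g k)
    (hα : ∀ r₁ : OFrame g, DifferentiableAt ℝ (localRep α r₁) (chartAt (OModel n) r₁ r₁)) :
    (manifoldExtDeriv α ((chartAt (OModel n) r₀).symm u)).compContinuousLinearMap
      (chartFrame r₀ u) = extDeriv (localRep α r₀) u := by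
  set φ := chartAt (OModel n) r₀ with hφ
  set r₁ := φ.symm u with hr₁
  let ψ := chartAt (OModel n) r₁
  let f : OModel n → OModel n := ψ ∘ φ.symm
  have hsymm {u} (hu : u ∈ φ.target) : MDifferentiableAt 𝓘(ℝ, OModel n) 𝓘(ℝ, OModel n) φ.symm u :=
    (contMDiffAt_oframe_symm hu).mdifferentiableAt (by simp)
  have hf : ContDiffAt ℝ ∞ f u := by
    rw [← contMDiffAt_iff_contDiffAt]
    have h1 : ContMDiffAt 𝓘(ℝ, OModel n) 𝓘(ℝ, OModel n) ∞ ψ (φ.symm u) :=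
      contMDiffAt_extChartAt (I := 𝓘(ℝ, OModel n)) (n := ∞)
    exact h1.comp u (contMDiffAt_oframe_symm hu)
  have hev : ∀ᶠ u in 𝓝 u, u ∈ φ.target ∧ φ.symm u ∈ ψ.source :=
    Filter.Eventually.and (φ.open_target.mem_nhds hu)
      ((hsymm hu).continuousAt.tendsto.eventually
        (ψ.open_source.mem_nhds (mem_chart_source _ r₁)))
  have hder {u} (hu : u ∈ φ.target ∧ φ.symm u ∈ ψ.source) (v : OModel n) :
      fderiv ℝ f u v = (mfderiv 𝓘(ℝ, OModel n) 𝓘(ℝ, OModel n) ψ (φ.symm u) (chartFrame r₀ u v) : OModel n) := by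
    have h1 := mfderiv_comp_chart_symm hu.1
      ((mdifferentiable_chartAt_oframe r₁).mdifferentiableAt hu.2) v
    rw [mfderiv_eq_fderiv] at h1
    exact h1
  let F : OFrame g → OModel n [⋀^Fin k]→L[ℝ] ℝ := α
  -- The expressions of `α` in the two charts differ by pullback along the transition map `f`, and
  -- the exterior derivative commutes with pullbacks.
  have hloc : localRep α r₀ =ᶠ[𝓝 u]
      fun u => (localRep α r₁ (f u)).compContinuousLinearMap (fderiv ℝ f u) := by
    filter_upwards [hev] with u hu
    have h2 : ψ.symm (f u) = φ.symm u := ψ.left_inv hu.2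
    have h3 (v : OModel n) : (chartFrame r₁ (f u) (fderiv ℝ f u v) : OModel n) =
        (chartFrame r₀ u v : OModel n) := by
      rw [hder hu]
      exact congrArg (fun L => L (chartFrame r₀ u v))
        ((mdifferentiable_chartAt_oframe r₁).symm_comp_deriv hu.2)
    ext v
    change F (φ.symm u) (fun a => chartFrame r₀ u (v a)) =
      F (ψ.symm (f u)) (fun a => chartFrame r₁ (f u) (fderiv ℝ f u (v a)))
    rw [h2]
    exact congrArg (F (φ.symm u)) (funext fun a => (h3 (v a)).symm)
  have hs : minSmoothness ℝ 2 ≤ (∞ : WithTop ℕ∞) := by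
    rw [minSmoothness_of_isRCLikeNormedField]
    exact WithTop.coe_le_coe.2 (le_top : (2 : ℕ∞) ≤ ⊤)
  have hd : DifferentiableAt ℝ (localRep α r₁) (f u) := hα r₁
  rw [hloc.extDeriv_eq, extDeriv_pullback hd hf hs]
  ext v
  change extDeriv (localRep α r₁) (ψ r₁) (fun a => mfderiv 𝓘(ℝ, OModel n) 𝓘(ℝ, OModel n) ψ r₁
    (chartFrame r₀ u (v a))) = extDeriv (localRep α r₁) (f u) (fun a => fderiv ℝ f u (v a))
  exact congrArg (extDeriv (localRep α r₁) (ψ r₁))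
    (funext fun a => (hder ⟨hu, mem_chart_source _ r₁⟩ (v a)).symm)

end LocalRepresentatives
end DiffGeom
end

/-! ### From the coframe in a chart to the global equivalence. -/

noncomputable section
namespace DiffGeom
open Set
section LocalStructureEquations
set_option maxSynthPendingDepth 3
open Filter Topology

section Congruence
variable {E : Type*} [NormedAddCommGroup E] [NormedSpace ℝ E] {n s : ℕ}
  {θ θ' : E → Fin n → E →L[ℝ] ℝ} {ϖ : E → Fin n → Fin n → E →L[ℝ] ℝ} {x : E}
  {T : Fin n → Fin n → Fin n → ℝ} {R : Fin n → Fin n → Fin n → Fin n → ℝ} {e : Fin n → E}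

theorem StructureEquations.congr (H : StructureEquations s θ ϖ x T R e) (h : θ' =ᶠ[𝓝 x] θ) :
    StructureEquations s θ' ϖ x T R e := by
  have hx : θ' x = θ x := h.self_of_nhds
  have hi (i : Fin n) : (fun u => θ' u i) =ᶠ[𝓝 x] fun u => θ u i :=
    h.mono fun u hu => congrFun hu i
  exact
  { contDiffAt_solder := fun i => (H.contDiffAt_solder i).congr_of_eventuallyEq (hi i)
    contDiffAt_connection := H.contDiffAt_connection
    skew := H.skew
    dual := hx ▸ H.dual
    horizontal := H.horizontal
    exists_vertical := hx ▸ H.exists_vertical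
    torsion_antisymm := H.torsion_antisymm
    curvature_antisymm := H.curvature_antisymm
    curvature_skew := H.curvature_skew
    fderiv_solder := fun i u v => by rw [(hi i).fderiv_eq, hx]; exact H.fderiv_solder i u v
    fderiv_connection := fun i j u v => by rw [hx]; exact H.fderiv_connection i j u v }

variable [FiniteDimensional ℝ E] (H : StructureEquations s θ ϖ x T R e) {k : ℕ} (hn : 4 ≤ n)
  (h : 3 + k = n)
include H hn

theorem StructureEquations.vacuum_of_extDeriv_tauForm_eq_zero
    (hτ : ∀ i, extDeriv (fun u => tauForm s (θ u) (ϖ u) h i) x = 0) :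
    (∀ l a b, T l a b = 0) ∧ ∀ a p, ∑ j, eta n s p * R j p j a -
      1 / 2 * delta p a * ∑ j, ∑ l, eta n s l * R j l j l = 0 := by
  -- Here k = n − 3 is positive, so the forms θ* with four indices are available.
  obtain ⟨m, rfl⟩ : ∃ m, k = m + 1 := ⟨k - 1, by omega⟩
  exact ⟨H.torsion_eq_zero h (by omega) hτ, H.einstein_eq_zero h (by omega) hτ⟩

theorem StructureEquations.extDeriv_sigmaForm_eq_tauForm (hT : ∀ l a b, T l a b = 0)
    (hR : ∀ a p, ∑ j, eta n s p * R j p j a -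
      1 / 2 * delta p a * ∑ j, ∑ l, eta n s l * R j l j l = 0) (i : Fin n) :
    extDeriv (fun u => sigmaForm s (θ u) (ϖ u) h i) x = tauForm s (θ x) (ϖ x) h i := by
  obtain ⟨m, rfl⟩ : ∃ m, k = m + 1 := ⟨k - 1, by omega⟩
  exact H.extDeriv_sigmaForm_eq h (by omega) hT hR i

end Congruence

variable {n s : ℕ} {M : Type*} [TopologicalSpace M] [ChartedSpace (Model n) M]
  [IsManifold (𝓡 n) ∞ M] {g : PseudoRiemannianMetric n s M}

section Points
variable {A : MetricConnection g} {r₀ : OFrame g} {u : OModel n}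
  (hu : u ∈ (chartAt (OModel n) r₀).target)
  {c : OpenPartialHomeomorph M (Model n)} (hc : c ∈ IsManifold.maximalAtlas (𝓡 n) ∞ M)
  (h : ((chartAt (OModel n) r₀).symm u).base ∈ c.source)
include hu

theorem manifoldExtDeriv_tau_comp (hn : 3 ≤ n) (i : Fin n) :
    (manifoldExtDeriv (A.tau hn i) ((chartAt (OModel n) r₀).symm u)).compContinuousLinearMap
      (chartFrame r₀ u) = extDeriv (fun u => tauForm s (localSolder r₀ u) (localForm A r₀ u)
        (Nat.add_sub_cancel' hn) i) u := by
  rw [manifoldExtDeriv_compContinuousLinearMap hu]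
  · exact congrArg (fun β => extDeriv β u) (funext fun u => localRep_tau hn i)
  · intro r₁
    have hr := (chartAt (OModel n) r₁).map_source (mem_chart_source _ r₁)
    have h1 := ContDiffAt.tauForm (s := s) (contDiffAt_localSolder hr)
      (contDiffAt_localForm (A := A) hr) (Nat.add_sub_cancel' hn) i
    exact (h1.congr_of_eventuallyEq (Eventually.of_forall fun u =>
      localRep_tau hn i)).differentiableAt (by simp)

theorem manifoldExtDeriv_sigma_comp (hn : 3 ≤ n) (i : Fin n) :
    (manifoldExtDeriv (A.sigma hn i) ((chartAt (OModel n) r₀).symm u)).compContinuousLinearMap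
      (chartFrame r₀ u) = extDeriv (fun u => sigmaForm s (localSolder r₀ u) (localForm A r₀ u)
        (Nat.add_sub_cancel' hn) i) u := by
  rw [manifoldExtDeriv_compContinuousLinearMap hu]
  · exact congrArg (fun β => extDeriv β u) (funext fun u => localRep_sigma hn i)
  · intro r₁
    have hr := (chartAt (OModel n) r₁).map_source (mem_chart_source _ r₁)
    have h1 := ContDiffAt.sigmaForm (s := s) (contDiffAt_localSolder hr)
      (contDiffAt_localForm (A := A) hr) (Nat.add_sub_cancel' hn) i
    exact (h1.congr_of_eventuallyEq (Eventually.of_forall fun u =>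
      localRep_sigma hn i)).differentiableAt (by simp)

theorem manifoldExtDeriv_solder_comp (i : Fin n) :
    (manifoldExtDeriv (fun r : OFrame g => oneForm (solder r i))
      ((chartAt (OModel n) r₀).symm u)).compContinuousLinearMap (chartFrame r₀ u) =
      extDeriv (fun u => oneForm (localSolder r₀ u i)) u := by
  refine manifoldExtDeriv_compContinuousLinearMap hu (fun r : OFrame g => oneForm (solder r i))
    fun r₁ => ?_
  have hr := (chartAt (OModel n) r₁).map_source (mem_chart_source _ r₁)
  exact (ContDiffAt.oneForm (contDiffAt_localSolder hr i)).differentiableAt (by simp)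

include hc h

theorem structureEquations_local : StructureEquations s (localSolder r₀) (localForm A r₀) u
    (torsionCoeff (localBase c r₀) (localFrame c r₀) (localForm A r₀) u)
    (curvatureCoeff (localBase c r₀) (localFrame c r₀) (localForm A r₀) u)
    (fun l => horizontalLift (localBase c r₀) (localForm A r₀) u
      (localFrame c r₀ u (stdVec n l))) := by
  refine (IsAdaptedAt.structureEquations rfl (eventually_isAdaptedAt hu hc h)).congr ?_
  filter_upwards [eventually_mem_source hu c.open_source h] with u hu
  exact funext fun i => (solderCoord_eq hu.1 hc hu.2 i).symm

theorem torsion_comp_apply (i : Fin n) (v w : OModel n) :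
    A.torsion i ((chartAt (OModel n) r₀).symm u) ![chartFrame r₀ u v, chartFrame r₀ u w] =
      ∑ p, ∑ q, torsionCoeff (localBase c r₀) (localFrame c r₀) (localForm A r₀) u i p q *
        (localSolder r₀ u p v * localSolder r₀ u q w) := by
  have H := structureEquations_local (A := A) hu hc h
  have h1 : manifoldExtDeriv (fun r : OFrame g => oneForm (solder r i))
      ((chartAt (OModel n) r₀).symm u) ![chartFrame r₀ u v, chartFrame r₀ u w] =
      extDeriv (fun u => oneForm (localSolder r₀ u i)) u ![v, w] := by
    rw [← manifoldExtDeriv_solder_comp hu]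
    exact congrArg (manifoldExtDeriv (fun r : OFrame g => oneForm (solder r i))
      ((chartAt (OModel n) r₀).symm u)) (by ext1 a; fin_cases a <;> rfl)
  have h2 (j : Fin n) : wedge (A.form ((chartAt (OModel n) r₀).symm u) i j)
      (oneForm (solder ((chartAt (OModel n) r₀).symm u) j))
        ![chartFrame r₀ u v, chartFrame r₀ u w] =
      localForm A r₀ u i j v * localSolder r₀ u j w -
        localForm A r₀ u i j w * localSolder r₀ u j v := by
    rw [wedge_apply, Fin.sum_univ_two]
    have h3 : (-1 : ℝ) ^ 0 * (localForm A r₀ u i j v * localSolder r₀ u j w) +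
        (-1) ^ 1 * (localForm A r₀ u i j w * localSolder r₀ u j v) =
        localForm A r₀ u i j v * localSolder r₀ u j w -
          localForm A r₀ u i j w * localSolder r₀ u j v := by ring
    exact h3
  change manifoldExtDeriv (fun r : OFrame g => oneForm (solder r i))
      ((chartAt (OModel n) r₀).symm u) ![chartFrame r₀ u v, chartFrame r₀ u w] +
    (∑ j, wedge (A.form ((chartAt (OModel n) r₀).symm u) i j)
      (oneForm (solder ((chartAt (OModel n) r₀).symm u) j)))
        ![chartFrame r₀ u v, chartFrame r₀ u w] = _
  rw [h1, ContinuousAlternatingMap.sum_apply, Finset.sum_congr rfl fun j _ => h2 j,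
    extDeriv_oneForm_apply ((H.contDiffAt_solder i).differentiableAt one_ne_zero),
    H.fderiv_solder, sub_add_cancel]

/-- The torsion is quadratic in the solder forms, so its coefficients determine it. Conversely they
are its values on the horizontal lifts of the frame, which are dual to θ. -/
theorem torsion_eq_zero_iff_torsionCoeff : (∀ i, A.torsion i ((chartAt (OModel n) r₀).symm u) = 0) ↔
    ∀ i p q, torsionCoeff (localBase c r₀) (localFrame c r₀) (localForm A r₀) u i p q = 0 := by
  have H := structureEquations_local (A := A) hu hc h
  constructor
  · intro hT i p q
    have h1 := torsion_comp_apply (A := A) hu hc h i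
      (horizontalLift (localBase c r₀) (localForm A r₀) u (localFrame c r₀ u (stdVec n p)))
      (horizontalLift (localBase c r₀) (localForm A r₀) u (localFrame c r₀ u (stdVec n q)))
    rw [hT i] at h1
    have h2 (a b : Fin n) := H.dual a b
    simp only [h2] at h1
    simpa using h1.symm
  · intro hT i
    refine compContinuousLinearMap_chartFrame_injective hu ?_
    ext v
    have h1 := torsion_comp_apply (A := A) hu hc h i (v 0) (v 1)
    simp only [hT, zero_mul, Finset.sum_const_zero] at h1
    refine Eq.trans ?_ h1
    exact congrArg (A.torsion i ((chartAt (OModel n) r₀).symm u))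
      (by ext1 a; fin_cases a <;> rfl)

theorem torsion_and_einstein_of_closed (hn : 4 ≤ n) (hτ : ∀ i r,
      manifoldExtDeriv (A.tau (Nat.le_of_succ_le hn) i) r = 0) :
    (∀ i p q, torsionCoeff (localBase c r₀) (localFrame c r₀) (localForm A r₀) u i p q = 0) ∧
      ∀ a p, ∑ j, eta n s p * curvatureCoeff (localBase c r₀) (localFrame c r₀)
          (localForm A r₀) u j p j a -
        1 / 2 * delta p a * ∑ j, ∑ l, eta n s l * curvatureCoeff (localBase c r₀)
          (localFrame c r₀) (localForm A r₀) u j l j l = 0 := by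
  refine (structureEquations_local (A := A) hu hc h).vacuum_of_extDeriv_tauForm_eq_zero hn
    (Nat.add_sub_cancel' (Nat.le_of_succ_le hn)) fun i => ?_
  rw [← manifoldExtDeriv_tau_comp hu (Nat.le_of_succ_le hn), hτ]
  rfl

end Points

theorem exists_oframe_base (x : M) : ∃ r : OFrame g, r.base = x := by
  obtain ⟨e, he⟩ := g.exists_orthonormal x
  let e' : Fin n → Model n := e
  let L : Model n →L[ℝ] Model n := LinearMap.toContinuousLinearMap
    ((EuclideanSpace.basisFun (Fin n) ℝ).toBasis.constr ℝ e')
  have hL (j : Fin n) : L (stdVec n j) = e' j := by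
    have := (EuclideanSpace.basisFun (Fin n) ℝ).toBasis.constr_basis ℝ e' j
    rwa [OrthonormalBasis.coe_toBasis, EuclideanSpace.basisFun_apply] at this
  let gv : Model n →L[ℝ] Model n →L[ℝ] ℝ := g.val x
  refine ⟨⟨⟨x, L⟩, fun i j => ?_⟩, rfl⟩
  change gv (L (stdVec n i)) (L (stdVec n j)) = _
  rw [hL, hL]
  exact he i j

variable (A : MetricConnection g) (hn : 4 ≤ n)

theorem MetricConnection.isLeviCivita_and_isVacuumEinstein_of_closed (hτ : ∀ i r,
      manifoldExtDeriv (A.tau (Nat.le_of_succ_le hn) i) r = 0) :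
    A.IsLeviCivita ∧ g.IsVacuumEinstein := by
  constructor
  · intro i r
    have hr := (chartAt (OModel n) r).map_source (mem_chart_source _ r)
    have hc := IsManifold.chart_mem_maximalAtlas (I := 𝓡 n) (n := ∞) r.base
    have hl : (chartAt (OModel n) r).symm (chartAt (OModel n) r r) = r :=
      (chartAt (OModel n) r).left_inv (mem_chart_source _ r)
    have h : ((chartAt (OModel n) r).symm (chartAt (OModel n) r r)).base ∈
        (chartAt (Model n) r.base).source := by
      rw [hl]; exact mem_chart_source _ _
    have h1 := (torsion_eq_zero_iff_torsionCoeff (A := A) hr hc h).2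
      (torsion_and_einstein_of_closed hr hc h hn hτ).1 i
    rwa [hl] at h1
  · intro c hc x hx μ ν
    obtain ⟨r, rfl⟩ := exists_oframe_base (g := g) x
    have hr := (chartAt (OModel n) r).map_source (mem_chart_source _ r)
    have hl : (chartAt (OModel n) r).symm (chartAt (OModel n) r r) = r :=
      (chartAt (OModel n) r).left_inv (mem_chart_source _ r)
    have h : ((chartAt (OModel n) r).symm (chartAt (OModel n) r r)).base ∈ c.source := by
      rw [hl]; exact hx
    -- Comparison with the coordinate Einstein tensor requires zero torsion near the frame;
    -- closedness of τ at all nearby frames supplies it.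
    have h1 := (IsAdaptedAt.einsteinTensor_eq_zero_iff rfl
      (eventually_isAdaptedAt (A := A) hr hc h)
      ((eventually_mem_source hr c.open_source h).mono fun u hu =>
        (torsion_and_einstein_of_closed hu.1 hc hu.2 hn hτ).1)).2
      (torsion_and_einstein_of_closed hr hc h hn hτ).2 μ ν
    have h2 : localBase c r (chartAt (OModel n) r r) = c r.base := by
      unfold localBase; rw [hl]
    rwa [h2] at h1

theorem MetricConnection.tau_eq_manifoldExtDeriv_sigma (hA : A.IsLeviCivita)
    (hg : g.IsVacuumEinstein) (i : Fin n) (r : OFrame g) :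
    A.tau (Nat.le_of_succ_le hn) i r =
      manifoldExtDeriv (A.sigma (Nat.le_of_succ_le hn) i) r := by
  have hr := (chartAt (OModel n) r).map_source (mem_chart_source _ r)
  have hc := IsManifold.chart_mem_maximalAtlas (I := 𝓡 n) (n := ∞) r.base
  have hl : (chartAt (OModel n) r).symm (chartAt (OModel n) r r) = r :=
    (chartAt (OModel n) r).left_inv (mem_chart_source _ r)
  have h : ((chartAt (OModel n) r).symm (chartAt (OModel n) r r)).base ∈
      (chartAt (Model n) r.base).source := by
    rw [hl]; exact mem_chart_source _ _
  have hT : ∀ᶠ u in 𝓝 (chartAt (OModel n) r r), ∀ i p q,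
      torsionCoeff (localBase (chartAt (Model n) r.base) r)
        (localFrame (chartAt (Model n) r.base) r) (localForm A r) u i p q = 0 :=
    (eventually_mem_source hr (chartAt (Model n) r.base).open_source h).mono fun u hu =>
      (torsion_eq_zero_iff_torsionCoeff hu.1 hc hu.2).1 fun i => hA i _
  have hR := (IsAdaptedAt.einsteinTensor_eq_zero_iff rfl
    (eventually_isAdaptedAt (A := A) hr hc h) hT).1 fun μ ν => hg _ hc _ h μ ν
  have h1 := (structureEquations_local (A := A) hr hc h).extDeriv_sigmaForm_eq_tauForm hn
    (Nat.add_sub_cancel' (Nat.le_of_succ_le hn)) hT.self_of_nhds hR i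
  rw [← manifoldExtDeriv_sigma_comp hr, ← localRep_tau] at h1
  have h2 := compContinuousLinearMap_chartFrame_injective hr h1
  rw [hl] at h2
  exact h2.symm

theorem MetricConnection.closed_of_tau_eq_manifoldExtDeriv_sigma (hn : 3 ≤ n)
    (h : ∀ i r, A.tau hn i r = manifoldExtDeriv (A.sigma hn i) r) (i : Fin n) (r : OFrame g) :
    manifoldExtDeriv (A.tau hn i) r = 0 := by
  have hr := (chartAt (OModel n) r).map_source (mem_chart_source _ r)
  have hl : (chartAt (OModel n) r).symm (chartAt (OModel n) r r) = r :=
    (chartAt (OModel n) r).left_inv (mem_chart_source _ r)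
  -- The hypothesis holds at every frame, so τ and dσ have the same expression on the whole chart
  -- domain and d² = 0 applies there.
  have h1 : (fun u => tauForm s (localSolder r u) (localForm A r u)
      (Nat.add_sub_cancel' hn) i) =ᶠ[𝓝 (chartAt (OModel n) r r)]
      extDeriv (fun u => sigmaForm s (localSolder r u) (localForm A r u)
        (Nat.add_sub_cancel' hn) i) := by
    filter_upwards [(chartAt (OModel n) r).open_target.mem_nhds hr] with u hu
    rw [← localRep_tau hn i, ← manifoldExtDeriv_sigma_comp hu hn, ← h]
    rfl
  have hs : minSmoothness ℝ 2 ≤ (∞ : WithTop ℕ∞) := by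
    rw [minSmoothness_of_isRCLikeNormedField]
    exact WithTop.coe_le_coe.2 (le_top : (2 : ℕ∞) ≤ ⊤)
  have h2 := manifoldExtDeriv_tau_comp (A := A) hr hn i
  rw [h1.extDeriv_eq, extDeriv_extDeriv_apply (ContDiffAt.sigmaForm (contDiffAt_localSolder hr)
    (contDiffAt_localForm hr) _ i) hs] at h2
  have h3 := compContinuousLinearMap_chartFrame_injective hr (β := 0) h2
  rwa [hl] at h3

end LocalStructureEquations
end DiffGeom
end

theorem mainTheorem7 {n s : ℕ} (hn : 4 ≤ n) {M : Type*} [TopologicalSpace M]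
    [ChartedSpace (EuclideanSpace ℝ (Fin n)) M] [IsManifold (𝓡 n) ∞ M]
    (g : DiffGeom.PseudoRiemannianMetric n s M) (A : DiffGeom.MetricConnection g) :
    List.TFAE [
      ∀ i r, DiffGeom.manifoldExtDeriv (A.tau (Nat.le_of_succ_le hn) i) r = 0,
      ∀ i r, A.tau (Nat.le_of_succ_le hn) i r =
        DiffGeom.manifoldExtDeriv (A.sigma (Nat.le_of_succ_le hn) i) r,
      A.IsLeviCivita ∧ g.IsVacuumEinstein] := by
  tfae_have 1 → 3 := A.isLeviCivita_and_isVacuumEinstein_of_closed hn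
  tfae_have 3 → 2 := fun h => A.tau_eq_manifoldExtDeriv_sigma hn h.1 h.2
  tfae_have 2 → 1 := A.closed_of_tau_eq_manifoldExtDeriv_sigma (Nat.le_of_succ_le hn)
  tfae_finish
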